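/- Let $m\ge 1$ be odd and let $M$ be a complex manifold with a half-flat spin $\tfrac m2$ Grassmann structure: a holomorphic isomorphism $T^*M\cong E\otimes S^mH$, where $E$ (of positive rank) and $H$ (of rank $2$) are holomorphic vector bundles with holomorphic connections $\nabla^E$, $\nabla^H$, where $H^*$ carries a holomorphic $\nabla^H$-parallel symplectic form $\omega_H\in\Gamma(\Lambda^2H)$, where $TM=E^*\otimes S^mH^*$ is equipped with the Grassmann connection $\nabla^E\otimes\mathrm{Id}+\mathrm{Id}\otimes\nabla^{S^mH}$ (no condition on its torsion), and where the connection induced by $\nabla^H$ on $S^mH$ is flat. Let $\omega_E\in\Gamma(\Lambda^2E)$ be a holomorphic $\nabla^E$-parallel symplectic form on $E^*$. Let $\omega_H^m$ be the bilinear form on $S^mH^*$ with $$\omega_H^m(h_1\cdots h_m,h'_1\cdots h'_m)=\sum_{\sigma,\tau\in S_m}\prod_{i=1}^m\omega_H(h_{\sigma(i)},h'_{\tau(i)}).$$ For a frame $X_{aA}=e_a\otimes h_A$ of $TM$ built from frames $(e_a)$ of $E^*$ and $(h_A)$ of $S^mH^*$, with dual coframe $X^{aA}$, $\omega_{ab}=\omega_E(e_a,e_b)$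 and $\omega_{AB}=\omega_H^m(h_A,h_B)$, put $$g=\omega_E\otimes\omega_H^m,\qquad \Omega=\sum\omega_{ab}\,\omega_{cd}\,\omega_{AC}\,\omega_{BD}\;X^{aA}\wedge X^{bB}\wedge X^{cC}\wedge X^{dD}.$$ Then $g$ is a complex Riemannian (holomorphic, symmetric, nondegenerate) metric, $\Omega$ is a holomorphic $4$-form which vanishes at no point, and $g$ and $\Omega$ are invariant under $\mathrm{Sp}(E)\cdot\mathrm{Sp}(H)$. Let $*$ be the Hodge operator of $g$ (for any local unit volume form) and $B_\Omega\beta=*(*\Omega\wedge\beta)$ for $2$-forms $\beta$. The curvature $F$ of a holomorphic connection $\nabla$ in a holomorphic vector bundle $W\to M$ has a unique decomposition $$F(e\otimes h_1\cdots h_m,\,e'\otimes h'_1\cdots h'_m)=\sum_{\sigma,\tau\in S_m}\sum_{i=0}^m\Big(\prod_{j=1}^i\omega_H(h_{\sigma(j)},h'_{\tau(j)})\Big)\,F^{(i)}\big(e,e';h_{\sigma(i+1)},\dots,h_{\sigma(m)},h'_{\tau(i+1)},\dots,h'_{\tau(m)}\big),$$ with $F^{(i)}$ $\mathrm{End}\,W$-valued,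 totally symmetric in its $2m-2i$ arguments from $H^*$, skew in $e,e'$ for even $i$ and symmetric in $e,e'$ for odd $i$; $\nabla$ is called $k$-partially flat if $F^{(i)}=0$ for all $i\le 2k$. If $\Omega$ is co-closed, $d*\Omega=0$, then every $\tfrac{m-1}2$-partially flat holomorphic connection $\nabla$ in a holomorphic vector bundle $W\to M$ is $(\Omega,\lambda)$-self-dual with $\lambda=-4(m+2)$, that is, $B_\Omega$ has a nonzero real constant eigenvalue, $B_\Omega F=\lambda F$ and $(d*\Omega)\wedge F=0$; hence $\nabla$ is a Yang–Mills connection, $d^\nabla *F=0$. -/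

import Mathlib

open scoped Manifold ContDiff TensorProduct Bundle

noncomputable section

namespace GrassmannYM

/-! ### Symmetric powers -/

section SymmetricPowers

variable {m : ℕ} {H : Type*} [AddCommGroup H] [Module ℂ H] {N : Type*} [AddCommGroup N] [Module ℂ N]

/-- The product `h₁ ⋯ hₘ` in the symmetric power `S^m H`. -/
def symProd (h : Fin m → H) : Sym[ℂ]^m H := SymmetricPower.tprod ℂ h

/-- A symmetric multilinear map induces a linear map on the symmetric power. -/
def symLift (f : MultilinearMap ℂ (fun _ : Fin m => H) N)
    (hf : ∀ (σ : Equiv.Perm (Fin m)) (h : Fin m → H), f (fun i => h (σ i)) = f h) :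
    Sym[ℂ]^m H →ₗ[ℂ] N where
  __ := AddCon.lift (addConGen (SymmetricPower.Rel ℂ (Fin m) H))
    (PiTensorProduct.lift f).toAddMonoidHom (by
      refine AddCon.addConGen_le.2 ?_
      rintro _ _ ⟨e, h⟩
      simpa [AddCon.ker_rel] using (hf e h).symm)
  map_smul' r x := by
    induction x using AddCon.induction_on with
    | H x => exact (PiTensorProduct.lift f).map_smul r x

theorem symLift_symProd (f : MultilinearMap ℂ (fun _ : Fin m => H) N)
    (hf : ∀ (σ : Equiv.Perm (Fin m)) (h : Fin m → H), f (fun i => h (σ i)) = f h)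
    (h : Fin m → H) : symLift f hf (symProd h) = f h :=
  PiTensorProduct.lift.tprod (φ := f) h

theorem symProd_perm (σ : Equiv.Perm (Fin m)) (h : Fin m → H) :
    symProd (fun i => h (σ i)) = symProd h :=
  SymmetricPower.tprod_equiv σ h

theorem sym_hom_ext {f g : Sym[ℂ]^m H →ₗ[ℂ] N} (h : ∀ x, f (symProd x) = g (symProd x)) :
    f = g :=
  LinearMap.ext_on_range (SymmetricPower.span_tprod_eq_top ℂ (Fin m) H) h

/-- The endomorphism `S^m B` of `S^m H` induced by an endomorphism `B` of `H`. -/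
def symMap (B : H →ₗ[ℂ] H) : Sym[ℂ]^m H →ₗ[ℂ] Sym[ℂ]^m H :=
  symLift ((SymmetricPower.tprod ℂ).compLinearMap fun _ => B)
    fun σ h => symProd_perm σ fun i => B (h i)

/-- `(h, h') ↦ ∏ i, b (h i) (h' i)` as a multilinear map in each family. -/
def prodForm (b : H →ₗ[ℂ] H →ₗ[ℂ] ℂ) :
    MultilinearMap ℂ (fun _ : Fin m => H) (MultilinearMap ℂ (fun _ : Fin m => H) ℂ) :=
  ((LinearMap.applyₗ (MultilinearMap.mkPiAlgebra ℂ (Fin m) ℂ)).compMultilinearMap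
    MultilinearMap.compLinearMapMultilinear).compLinearMap fun _ => b

theorem prodForm_apply (b : H →ₗ[ℂ] H →ₗ[ℂ] ℂ) (h h' : Fin m → H) :
    prodForm b h h' = ∏ i, b (h i) (h' i) := by
  simp [prodForm]

/-- `(h, h') ↦ ∑_σ ∑_τ ∏ i, b (h (σ i)) (h' (τ i))`. -/
def symProdForm (b : H →ₗ[ℂ] H →ₗ[ℂ] ℂ) :
    MultilinearMap ℂ (fun _ : Fin m => H) (MultilinearMap ℂ (fun _ : Fin m => H) ℂ) :=
  ∑ σ : Equiv.Perm (Fin m), ∑ τ : Equiv.Perm (Fin m),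
    (MultilinearMap.domDomCongrLinearEquiv ℂ ℂ H ℂ τ).toLinearMap.compMultilinearMap
      ((prodForm b).domDomCongr σ)

theorem symProdForm_apply (b : H →ₗ[ℂ] H →ₗ[ℂ] ℂ) (h h' : Fin m → H) :
    symProdForm b h h' = ∑ σ : Equiv.Perm (Fin m), ∑ τ : Equiv.Perm (Fin m),
      ∏ i, b (h (σ i)) (h' (τ i)) := by
  simp [symProdForm, prodForm_apply]

theorem symProdForm_perm_right (b : H →ₗ[ℂ] H →ₗ[ℂ] ℂ) (h h' : Fin m → H)
    (ρ : Equiv.Perm (Fin m)) :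
    symProdForm b h (fun i => h' (ρ i)) = symProdForm b h h' := by
  simp only [symProdForm_apply]
  refine Finset.sum_congr rfl fun σ _ => ?_
  exact Fintype.sum_equiv (Equiv.mulLeft ρ) _ _ fun τ => rfl

theorem symProdForm_perm_left (b : H →ₗ[ℂ] H →ₗ[ℂ] ℂ) (h h' : Fin m → H)
    (ρ : Equiv.Perm (Fin m)) :
    symProdForm b (fun i => h (ρ i)) h' = symProdForm b h h' := by
  simp only [symProdForm_apply]
  exact Fintype.sum_equiv (Equiv.mulLeft ρ) _ _ fun τ => rfl

/-- The bilinear form on `S^m H` induced by a bilinear form `b` on `H`, written `b^m`: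
`b^m (h₁⋯hₘ, h'₁⋯h'ₘ) = ∑_σ ∑_τ ∏ i, b (h (σ i)) (h' (τ i))`
(see `powForm_symProd`). -/
def powForm (m : ℕ) (b : H →ₗ[ℂ] H →ₗ[ℂ] ℂ) : Sym[ℂ]^m H →ₗ[ℂ] Sym[ℂ]^m H →ₗ[ℂ] ℂ :=
  symLift
    { toFun := fun h => symLift (symProdForm b h) fun σ h' => symProdForm_perm_right b h h' σ
      map_update_add' := fun h i x y => sym_hom_ext fun h' => by
        simp [symLift_symProd, MultilinearMap.map_update_add]
      map_update_smul' := fun h i c x => sym_hom_ext fun h' => by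
        simp [symLift_symProd, MultilinearMap.map_update_smul] }
    fun σ h => sym_hom_ext fun h' => by
      simpa [symLift_symProd] using symProdForm_perm_left b h h' σ

theorem powForm_symProd (b : H →ₗ[ℂ] H →ₗ[ℂ] ℂ) (h h' : Fin m → H) :
    powForm m b (symProd h) (symProd h') =
      ∑ σ : Equiv.Perm (Fin m), ∑ τ : Equiv.Perm (Fin m), ∏ i, b (h (σ i)) (h' (τ i)) := by
  rw [← symProdForm_apply, powForm, symLift_symProd]
  exact symLift_symProd (symProdForm b h) (fun σ h' => symProdForm_perm_right b h h' σ) h'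

end SymmetricPowers

/-! ### The 4-form on a tensor product of two spaces with skew forms -/

section FourForm

variable {E F : Type*} [AddCommGroup E] [Module ℂ E] [AddCommGroup F] [Module ℂ F]

/-- `(e₁ ⊗ f₁, e₂ ⊗ f₂) ↦ a(e₁,e₂) • f₁ ⊗ f₂`. -/
def contractFirst (a : E →ₗ[ℂ] E →ₗ[ℂ] ℂ) : (E ⊗[ℂ] F) →ₗ[ℂ] (E ⊗[ℂ] F) →ₗ[ℂ] (F ⊗[ℂ] F) :=
  TensorProduct.curry
    ((TensorProduct.lid ℂ (F ⊗[ℂ] F)).toLinearMap ∘ₗ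
      (LinearMap.rTensor (F ⊗[ℂ] F) (TensorProduct.lift a)) ∘ₗ
      (TensorProduct.tensorTensorTensorComm ℂ E F E F).toLinearMap)

theorem contractFirst_tmul (a : E →ₗ[ℂ] E →ₗ[ℂ] ℂ) (e₁ e₂ : E) (f₁ f₂ : F) :
    contractFirst a (e₁ ⊗ₜ[ℂ] f₁) (e₂ ⊗ₜ[ℂ] f₂) = a e₁ e₂ • (f₁ ⊗ₜ[ℂ] f₂) := by
  simp [contractFirst]

/-- The 4-linear form `t` on `E ⊗ F` with
`t (e₁⊗f₁, e₂⊗f₂, e₃⊗f₃, e₄⊗f₄) = a(e₁,e₂) a(e₃,e₄) b(f₁,f₃) b(f₂,f₄)`, that is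
`t = ∑ a_{ij} a_{kl} b_{IK} b_{JL} X^{iI} ⊗ X^{jJ} ⊗ X^{kK} ⊗ X^{lL}`
in the basis `X^{iI}` dual to a product basis of `E ⊗ F` (see `fourTensor_tmul`). -/
def fourTensor (a : E →ₗ[ℂ] E →ₗ[ℂ] ℂ) (b : F →ₗ[ℂ] F →ₗ[ℂ] ℂ) :
    MultilinearMap ℂ (fun _ : Fin 4 => E ⊗[ℂ] F) ℂ :=
  MultilinearMap.mk'
    (fun v => LinearMap.BilinForm.tmul b b
      (contractFirst a (v 0) (v 1)) (contractFirst a (v 2) (v 3)))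
    (fun v i x y => by fin_cases i <;> simp)
    (fun v i c x => by fin_cases i <;> simp)

theorem fourTensor_tmul (a : E →ₗ[ℂ] E →ₗ[ℂ] ℂ) (b : F →ₗ[ℂ] F →ₗ[ℂ] ℂ)
    (e : Fin 4 → E) (f : Fin 4 → F) :
    fourTensor a b (fun i => e i ⊗ₜ[ℂ] f i) =
      a (e 0) (e 1) * a (e 2) (e 3) * b (f 0) (f 2) * b (f 1) (f 3) := by
  simp [fourTensor, contractFirst_tmul]
  ring

/-- The 4-form `∑ a_{ij} a_{kl} b_{IK} b_{JL} X^{iI} ∧ X^{jJ} ∧ X^{kK} ∧ X^{lL}` on `E ⊗ F`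
(the wedge product of covectors being normalised by
`(α₁ ∧ ⋯ ∧ α₄)(v₁, …, v₄) = det (αᵢ(vⱼ))`). -/
def fourForm (a : E →ₗ[ℂ] E →ₗ[ℂ] ℂ) (b : F →ₗ[ℂ] F →ₗ[ℂ] ℂ) :
    (E ⊗[ℂ] F) [⋀^Fin 4]→ₗ[ℂ] ℂ :=
  MultilinearMap.alternatization (fourTensor a b)

end FourForm

/-! ### Multilinear algebra of a metric

An `A`-valued `p`-form on `V` is given by its values on `p`-tuples of vectors. -/

section Hodge

variable {V : Type*} [AddCommGroup V] [Module ℂ V] {A : Type*} [AddCommGroup A] [Module ℂ A]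

/-- The wedge product of a scalar `p`-form and an `A`-valued `q`-form. -/
def wedge {p q : ℕ} (α : (Fin p → V) → ℂ) (β : (Fin q → V) → A) (v : Fin (p + q) → V) : A :=
  ((p.factorial * q.factorial : ℂ)⁻¹) • ∑ σ : Equiv.Perm (Fin (p + q)),
    ((Equiv.Perm.sign σ : ℤ) : ℂ) •
      α (fun i => v (σ (Fin.castAdd q i))) • β (fun j => v (σ (Fin.natAdd p j)))

/-- `b^i = ∑ j, g^{ij} b_j`: the vectors with `g(b^i, b_j) = δ_{ij}`, for a basis `b_i` and a
metric `g` with inverse Gram matrix `g^{ij}`. -/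
def dualFrame {ι : Type*} [Fintype ι] [DecidableEq ι] (g : V →ₗ[ℂ] V →ₗ[ℂ] ℂ) (b : ι → V)
    (i : ι) : V :=
  ∑ j, ((Matrix.of fun k l => g (b k) (b l))⁻¹ i j) • b j

/-- The Hodge operator from `p`-forms to `q`-forms of a metric `g` and a unit volume form `vol` on
an `n`-dimensional space, `p + q = n`:
`(∗β)(v) = (1/p!) ∑_{i₁…iₚ} β(b^{i₁}, …, b^{iₚ}) vol(b_{i₁}, …, b_{iₚ}, v)`
(for any basis `b_i`, with `b^i` the `g`-dual basis). This is the operator determined by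
`α ∧ ∗β = ⟨α, β⟩ vol`. It is set to `0` if `p + q ≠ n`. -/
def hodgeStar [FiniteDimensional ℂ V] (g : V →ₗ[ℂ] V →ₗ[ℂ] ℂ) {n : ℕ} (vol : (Fin n → V) → ℂ)
    (p q : ℕ) (β : (Fin p → V) → A) (v : Fin q → V) : A :=
  if h : p + q = n then
    ((p.factorial : ℂ)⁻¹) • ∑ I : Fin p → Fin (Module.finrank ℂ V),
      vol (fun k => Fin.append (fun i => Module.finBasis ℂ V (I i)) v (Fin.cast h.symm k)) •
        β (fun i => dualFrame g (Module.finBasis ℂ V) (I i))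
  else 0

/-- `B_Ω β = ∗(∗Ω ∧ β)` for a 4-form `Ω` and an `A`-valued 2-form `β`. It does not change if `vol`
is replaced by `-vol`. -/
def bOperator [FiniteDimensional ℂ V] (g : V →ₗ[ℂ] V →ₗ[ℂ] ℂ) {n : ℕ} (vol : (Fin n → V) → ℂ)
    (Ω : (Fin 4 → V) → ℂ) (β : (Fin 2 → V) → A) : (Fin 2 → V) → A :=
  hodgeStar g vol (n - 4 + 2) 2 (wedge (hodgeStar g vol 4 (n - 4) Ω) β)

end Hodge

/-! ### Holomorphic objects on a complex manifold

`M` is a complex manifold modelled on `EM`; "holomorphic" is `C^ω` over `ℂ`. -/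

section Geometry

variable {EM : Type*} [NormedAddCommGroup EM] [NormedSpace ℂ EM]
  {M : Type*} [TopologicalSpace M] [ChartedSpace EM M]

instance tangentFiniteDimensional [FiniteDimensional ℂ EM] (x : M) :
    FiniteDimensional ℂ (TangentSpace 𝓘(ℂ, EM) x) :=
  inferInstanceAs (FiniteDimensional ℂ EM)

/-- `f` is a holomorphic function on `U`. -/
def IsHolFun (U : Set M) (f : M → ℂ) : Prop :=
  ContMDiffOn 𝓘(ℂ, EM) 𝓘(ℂ, ℂ) ω f U

/-- `s` is a holomorphic section of the bundle `V` on `U`. -/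
def IsHolSection (FV : Type*) [NormedAddCommGroup FV] [NormedSpace ℂ FV]
    {V : M → Type*} [TopologicalSpace (Bundle.TotalSpace FV V)]
    [∀ x, TopologicalSpace (V x)] [FiberBundle FV V]
    (U : Set M) (s : ∀ x, V x) : Prop :=
  ContMDiffOn 𝓘(ℂ, EM) (𝓘(ℂ, EM).prod 𝓘(ℂ, FV)) ω (fun x => Bundle.TotalSpace.mk' FV x (s x)) U

variable [IsManifold 𝓘(ℂ, EM) ω M]

/-- `X` is a holomorphic vector field on `U`. -/
def IsHolVectorField (U : Set M) (X : ∀ x : M, TangentSpace 𝓘(ℂ, EM) x) : Prop :=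
  IsHolSection (EM := EM) EM (V := fun x : M => TangentSpace 𝓘(ℂ, EM) x) U X

/-- The `p`-form `α` is holomorphic on `U`: it takes holomorphic values on holomorphic local vector
fields. -/
def IsHolForm {p : ℕ} (U : Set M) (α : ∀ x : M, (Fin p → TangentSpace 𝓘(ℂ, EM) x) → ℂ) : Prop :=
  ∀ U' : Set M, IsOpen U' → U' ⊆ U → ∀ X : Fin p → ∀ x : M, TangentSpace 𝓘(ℂ, EM) x,
    (∀ i, IsHolVectorField U' (X i)) → IsHolFun (EM := EM) U' fun x => α x fun i => X i x

section Connection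

variable {FV : Type*} [NormedAddCommGroup FV] [NormedSpace ℂ FV]
  {V : M → Type*} [TopologicalSpace (Bundle.TotalSpace FV V)]
  [∀ x, AddCommGroup (V x)] [∀ x, Module ℂ (V x)] [∀ x, TopologicalSpace (V x)]
  [∀ x, IsTopologicalAddGroup (V x)] [∀ x, ContinuousSMul ℂ (V x)]
  [FiberBundle FV V] [VectorBundle ℂ FV V]

/-- The connection maps holomorphic local sections of `V` to holomorphic local sections of
`T^*M ⊗ V`. -/
def IsHolConnection (cov : CovariantDerivative 𝓘(ℂ, EM) FV V) : Prop :=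
  ∀ U : Set M, IsOpen U → ContMDiffCovariantDerivativeOn FV ω cov.toFun U

/-- The curvature `F(X,Y) s = ∇_X ∇_Y s - ∇_Y ∇_X s - ∇_{[X,Y]} s` at `x`, a 2-form with values in
the endomorphisms of `V x`; `X`, `Y`, `s` are the local extensions of the arguments that are
constant in the trivialisations at `x`. -/
def curvature (cov : CovariantDerivative 𝓘(ℂ, EM) FV V) (x : M)
    (v : Fin 2 → TangentSpace 𝓘(ℂ, EM) x) (u : V x) : V x :=
  let X : ∀ y : M, TangentSpace 𝓘(ℂ, EM) y := FiberBundle.extend EM (v 0)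
  let Y : ∀ y : M, TangentSpace 𝓘(ℂ, EM) y := FiberBundle.extend EM (v 1)
  let s : ∀ y : M, V y := FiberBundle.extend FV u
  cov (fun y => cov s y (Y y)) x (v 0) - cov (fun y => cov s y (X y)) x (v 1)
    - cov s x (VectorField.mlieBracket 𝓘(ℂ, EM) X Y x)

/-- `b` is a holomorphic, parallel, fibrewise symplectic form on the bundle `V` with connection
`cov`. -/
structure IsParallelSymplectic (cov : CovariantDerivative 𝓘(ℂ, EM) FV V)
    (b : ∀ x, V x →ₗ[ℂ] V x →ₗ[ℂ] ℂ) : Prop where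
  alt : ∀ x v, b x v v = 0
  nondegenerate : ∀ x v, (∀ w, b x v w = 0) → v = 0
  holomorphic : ∀ U : Set M, IsOpen U → ∀ s t : ∀ x, V x,
    IsHolSection (EM := EM) FV U s → IsHolSection (EM := EM) FV U t →
      IsHolFun (EM := EM) U fun x => b x (s x) (t x)
  parallel : ∀ U : Set M, IsOpen U → ∀ s t : ∀ x, V x,
    IsHolSection (EM := EM) FV U s → IsHolSection (EM := EM) FV U t →
      ∀ x ∈ U, ∀ v : TangentSpace 𝓘(ℂ, EM) x,
        mvfderiv 𝓘(ℂ, EM) (fun y => b y (s y) (t y)) x v =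
          b x (cov s x v) (t x) + b x (s x) (cov t x v)

/-- The exterior derivative of a scalar `p`-form at `x`:
`(dα)(v₀, …, vₚ) = ∑ i, (-1)^i v_i (α(X₀, …, X̂ᵢ, …, Xₚ))`, where `X_j` is the vector field with
value `v_j` at `x` that is constant in the chart at `x` (these fields commute). -/
def extD {p : ℕ} (α : ∀ x : M, (Fin p → TangentSpace 𝓘(ℂ, EM) x) → ℂ) (x : M)
    (v : Fin (p + 1) → TangentSpace 𝓘(ℂ, EM) x) : ℂ :=
  ∑ i : Fin (p + 1), (-1 : ℂ) ^ (i : ℕ) *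
    mvfderiv 𝓘(ℂ, EM) (fun y : M => α y fun j => FiberBundle.extend EM (v (i.succAbove j)) y) x (v i)

/-- The exterior covariant derivative `d^∇ α` of an `End V`-valued `p`-form at `x`:
`(d^∇ α)(v₀, …, vₚ) = ∑ i, (-1)^i (∇_{v_i} (α(X₀, …, X̂ᵢ, …, Xₚ)))`, with `X_j` as for `extD`, where
`(∇_v C) u = ∇_v (C s) - C (∇_v s)` for a section `C` of `End V` and a local section `s` of `V`
through `u`. -/
def extDNabla (cov : CovariantDerivative 𝓘(ℂ, EM) FV V) {p : ℕ}
    (α : ∀ x : M, (Fin p → TangentSpace 𝓘(ℂ, EM) x) → (V x → V x)) (x : M)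
    (v : Fin (p + 1) → TangentSpace 𝓘(ℂ, EM) x) (u : V x) : V x :=
  ∑ i : Fin (p + 1), (-1 : ℂ) ^ (i : ℕ) •
    (cov (fun y => α y (fun j => FiberBundle.extend EM (v (i.succAbove j)) y)
        (FiberBundle.extend FV u y)) x (v i)
      - α x (fun j => v (i.succAbove j)) (cov (FiberBundle.extend FV u) x (v i)))

end Connection

/-! ### Complex Riemannian metrics, self-duality, Yang–Mills connections -/

section Metric

/-- `g` is a complex Riemannian metric: a holomorphic field of nondegenerate symmetric bilinear
forms. -/
structure IsComplexRiemannian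
    (g : ∀ x : M, TangentSpace 𝓘(ℂ, EM) x →ₗ[ℂ] TangentSpace 𝓘(ℂ, EM) x →ₗ[ℂ] ℂ) : Prop where
  symm : ∀ x v w, g x v w = g x w v
  nondegenerate : ∀ x v, (∀ w, g x v w = 0) → v = 0
  holomorphic : IsHolForm (p := 2) Set.univ fun x v => g x (v 0) (v 1)

/-- `vol` is a volume form of the metric `g` on `U`, that is a holomorphic `n`-form of unit length,
`vol(v₁, …, vₙ)² = det (g(vᵢ, vⱼ))`, where `n = dim M`. Every point has a neighbourhood with
such a form, and two of them differ by a locally constant sign. -/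
structure IsVolumeFormOn
    (g : ∀ x : M, TangentSpace 𝓘(ℂ, EM) x →ₗ[ℂ] TangentSpace 𝓘(ℂ, EM) x →ₗ[ℂ] ℂ) (U : Set M)
    (vol : ∀ x : M, TangentSpace 𝓘(ℂ, EM) x [⋀^Fin (Module.finrank ℂ EM)]→ₗ[ℂ] ℂ) : Prop where
  holomorphic : IsHolForm U fun x v => vol x v
  unit : ∀ x ∈ U, ∀ v : Fin (Module.finrank ℂ EM) → TangentSpace 𝓘(ℂ, EM) x,
    vol x v ^ 2 = (Matrix.of fun i j => g x (v i) (v j)).det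

variable [FiniteDimensional ℂ EM]

/-- `d ∗ Ω = 0`. As for all notions below, `∗` is taken with respect to any local volume form of
`g`; the choice of its sign does not matter. -/
def IsCoClosed
    (g : ∀ x : M, TangentSpace 𝓘(ℂ, EM) x →ₗ[ℂ] TangentSpace 𝓘(ℂ, EM) x →ₗ[ℂ] ℂ)
    (Ω : ∀ x : M, TangentSpace 𝓘(ℂ, EM) x [⋀^Fin 4]→ₗ[ℂ] ℂ) : Prop :=
  ∀ U : Set M, IsOpen U → ∀ vol, IsVolumeFormOn g U vol → ∀ x ∈ U, ∀ v,
    extD (fun y => hodgeStar (g y) (vol y) 4 (Module.finrank ℂ EM - 4) (Ω y)) x v = 0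

/-- The 4-form `Ω` is appropriate: the field of endomorphisms `B_Ω` of `Λ²T^*M` has a nonzero real
constant eigenvalue. -/
def IsAppropriate
    (g : ∀ x : M, TangentSpace 𝓘(ℂ, EM) x →ₗ[ℂ] TangentSpace 𝓘(ℂ, EM) x →ₗ[ℂ] ℂ)
    (Ω : ∀ x : M, TangentSpace 𝓘(ℂ, EM) x [⋀^Fin 4]→ₗ[ℂ] ℂ) : Prop :=
  ∃ l : ℝ, l ≠ 0 ∧ ∀ U : Set M, IsOpen U → ∀ vol, IsVolumeFormOn g U vol → ∀ x ∈ U,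
    ∃ β : TangentSpace 𝓘(ℂ, EM) x [⋀^Fin 2]→ₗ[ℂ] ℂ,
      β ≠ 0 ∧ bOperator (g x) (vol x) (Ω x) β = (l : ℂ) • ⇑β

variable {FV : Type*} [NormedAddCommGroup FV] [NormedSpace ℂ FV]
  {V : M → Type*} [TopologicalSpace (Bundle.TotalSpace FV V)]
  [∀ x, AddCommGroup (V x)] [∀ x, Module ℂ (V x)] [∀ x, TopologicalSpace (V x)]
  [∀ x, IsTopologicalAddGroup (V x)] [∀ x, ContinuousSMul ℂ (V x)]
  [FiberBundle FV V] [VectorBundle ℂ FV V]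

/-- The connection is `(Ω, l)`-self-dual, for an appropriate 4-form `Ω` and a real number `l ≠ 0`:
its curvature satisfies `B_Ω F = l F` and `(d ∗ Ω) ∧ F = 0`. -/
structure IsSelfDual
    (g : ∀ x : M, TangentSpace 𝓘(ℂ, EM) x →ₗ[ℂ] TangentSpace 𝓘(ℂ, EM) x →ₗ[ℂ] ℂ)
    (Ω : ∀ x : M, TangentSpace 𝓘(ℂ, EM) x [⋀^Fin 4]→ₗ[ℂ] ℂ) (l : ℝ)
    (cov : CovariantDerivative 𝓘(ℂ, EM) FV V) : Prop where
  appropriate : IsAppropriate g Ω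
  ne_zero : l ≠ 0
  eigen : ∀ U : Set M, IsOpen U → ∀ vol, IsVolumeFormOn g U vol → ∀ x ∈ U,
    bOperator (g x) (vol x) (Ω x) (curvature cov x) = (l : ℂ) • curvature cov x
  wedge_eq_zero : ∀ U : Set M, IsOpen U → ∀ vol, IsVolumeFormOn g U vol → ∀ x ∈ U,
    wedge (extD (fun y => hodgeStar (g y) (vol y) 4 (Module.finrank ℂ EM - 4) (Ω y)) x)
      (curvature cov x) = 0

/-- The Yang–Mills equation `d^∇ ∗ F = 0`. -/
def IsYangMills
    (g : ∀ x : M, TangentSpace 𝓘(ℂ, EM) x →ₗ[ℂ] TangentSpace 𝓘(ℂ, EM) x →ₗ[ℂ] ℂ)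
    (cov : CovariantDerivative 𝓘(ℂ, EM) FV V) : Prop :=
  ∀ U : Set M, IsOpen U → ∀ vol, IsVolumeFormOn g U vol → ∀ x ∈ U, ∀ v u,
    extDNabla cov
      (fun y => hodgeStar (g y) (vol y) 2 (Module.finrank ℂ EM - 2) (curvature cov y)) x v u = 0

end Metric

/-! ### Spin `m/2` Grassmann structures

The bundles `Es`, `Hs` below are the duals `E^*`, `H^*` of the bundles in `T^*M = E ⊗ S^m H`, so
that `TM = E^* ⊗ S^m H^*`; connections on a bundle and on its dual determine each other. -/

section Grassmann

variable {FE : Type*} [NormedAddCommGroup FE] [NormedSpace ℂ FE]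
  {Es : M → Type*} [TopologicalSpace (Bundle.TotalSpace FE Es)]
  [∀ x, AddCommGroup (Es x)] [∀ x, Module ℂ (Es x)] [∀ x, TopologicalSpace (Es x)]
  [∀ x, IsTopologicalAddGroup (Es x)] [∀ x, ContinuousSMul ℂ (Es x)]
  [FiberBundle FE Es] [VectorBundle ℂ FE Es]
  {FH : Type*} [NormedAddCommGroup FH] [NormedSpace ℂ FH]
  {Hs : M → Type*} [TopologicalSpace (Bundle.TotalSpace FH Hs)]
  [∀ x, AddCommGroup (Hs x)] [∀ x, Module ℂ (Hs x)] [∀ x, TopologicalSpace (Hs x)]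
  [∀ x, IsTopologicalAddGroup (Hs x)] [∀ x, ContinuousSMul ℂ (Hs x)]
  [FiberBundle FH Hs] [VectorBundle ℂ FH Hs]

variable (EM FE Es FH Hs) in
/-- A spin `m/2` Grassmann structure: a holomorphic identification `TM = E^* ⊗ S^m H^*` where `H^*`
has rank 2 and carries a symplectic form parallel for a connection `∇^H`, together with a
connection `∇^E` on `E^*` and the Grassmann connection
`∇ = ∇^E ⊗ Id + Id ⊗ ∇^{S^m H}` on `TM`. -/
structure SpinGrassmann (m : ℕ) where
  iso : ∀ x : M, (Es x ⊗[ℂ] Sym[ℂ]^m (Hs x)) ≃ₗ[ℂ] TangentSpace 𝓘(ℂ, EM) x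
  iso_holomorphic : ∀ U : Set M, IsOpen U → ∀ (e : ∀ x, Es x) (h : Fin m → ∀ x, Hs x),
    IsHolSection (EM := EM) FE U e → (∀ i, IsHolSection (EM := EM) FH U (h i)) →
      IsHolVectorField U fun x => iso x (e x ⊗ₜ[ℂ] symProd fun i => h i x)
  rank_H : Module.finrank ℂ FH = 2
  nablaE : CovariantDerivative 𝓘(ℂ, EM) FE Es
  nablaE_holomorphic : IsHolConnection nablaE
  nablaH : CovariantDerivative 𝓘(ℂ, EM) FH Hs
  nablaH_holomorphic : IsHolConnection nablaH
  omegaH : ∀ x, Hs x →ₗ[ℂ] Hs x →ₗ[ℂ] ℂ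
  omegaH_parallel : IsParallelSymplectic nablaH omegaH
  nabla : CovariantDerivative 𝓘(ℂ, EM) EM (fun x : M => TangentSpace 𝓘(ℂ, EM) x)
  nabla_holomorphic : IsHolConnection nabla
  nabla_tmul : ∀ U : Set M, IsOpen U → ∀ (e : ∀ x, Es x) (h : Fin m → ∀ x, Hs x),
    IsHolSection (EM := EM) FE U e → (∀ i, IsHolSection (EM := EM) FH U (h i)) →
      ∀ x ∈ U, ∀ v : TangentSpace 𝓘(ℂ, EM) x,
        nabla (fun y => iso y (e y ⊗ₜ[ℂ] symProd fun i => h i y)) x v =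
          iso x (nablaE e x v ⊗ₜ[ℂ] symProd fun i => h i x) +
          ∑ i, iso x (e x ⊗ₜ[ℂ] symProd (Function.update (fun j => h j x) i (nablaH (h i) x v)))

namespace SpinGrassmann

variable {m : ℕ} (S : SpinGrassmann EM FE Es FH Hs m)

/-- The tangent vector `e ⊗ h₁ ⋯ hₘ`. -/
def vec (x : M) (e : Es x) (h : Fin m → Hs x) : TangentSpace 𝓘(ℂ, EM) x :=
  S.iso x (e ⊗ₜ[ℂ] symProd h)

/-- The structure is half-flat: the connection induced by `∇^H` on `S^m H^*` is flat. The
curvature of that connection acts on products `h₁ ⋯ hₘ` as a derivation. -/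
def IsHalfFlat : Prop :=
  ∀ (x : M) (v : Fin 2 → TangentSpace 𝓘(ℂ, EM) x) (h : Fin m → Hs x),
    ∑ i, symProd (Function.update h i (curvature S.nablaH x v (h i))) = 0

variable (omegaE : ∀ x, Es x →ₗ[ℂ] Es x →ₗ[ℂ] ℂ)

/-- `g = ω_E ⊗ ω_H^m`. -/
def metric (x : M) : TangentSpace 𝓘(ℂ, EM) x →ₗ[ℂ] TangentSpace 𝓘(ℂ, EM) x →ₗ[ℂ] ℂ :=
  LinearMap.compl₁₂ (LinearMap.BilinForm.tmul (omegaE x) (powForm m (S.omegaH x)))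
    (S.iso x).symm.toLinearMap (S.iso x).symm.toLinearMap

/-- `Ω = ∑ ω_{ab} ω_{cd} ω_{AC} ω_{BD} X^{aA} ∧ X^{bB} ∧ X^{cC} ∧ X^{dD}`, where `ω_{ab}` and
`ω_{AB}` are the matrices of `ω_E` and `ω_H^m` and `X^{aA}` is the coframe dual to
`X_{aA} = e_a ⊗ h_A`. -/
def canonicalForm (x : M) : TangentSpace 𝓘(ℂ, EM) x [⋀^Fin 4]→ₗ[ℂ] ℂ :=
  (fourForm (omegaE x) (powForm m (S.omegaH x))).compLinearMap (S.iso x).symm.toLinearMap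

/-- The endomorphism of `T_x M` given by `e ⊗ h₁⋯hₘ ↦ (A e) ⊗ (B h₁)⋯(B hₘ)`. -/
def action (x : M) (A : Es x →ₗ[ℂ] Es x) (B : Hs x →ₗ[ℂ] Hs x) :
    TangentSpace 𝓘(ℂ, EM) x →ₗ[ℂ] TangentSpace 𝓘(ℂ, EM) x :=
  (S.iso x).toLinearMap ∘ₗ TensorProduct.map A (symMap B) ∘ₗ (S.iso x).symm.toLinearMap

/-- `(A, B)` is an element of `Sp(E_x) × Sp(H_x)`. -/
def IsSymplecticPair (x : M) (A : Es x →ₗ[ℂ] Es x) (B : Hs x →ₗ[ℂ] Hs x) : Prop :=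
  (∀ e e', omegaE x (A e) (A e') = omegaE x e e') ∧
    ∀ h h', S.omegaH x (B h) (B h') = S.omegaH x h h'

variable {FV : Type*} [NormedAddCommGroup FV] [NormedSpace ℂ FV]
  {V : M → Type*} [TopologicalSpace (Bundle.TotalSpace FV V)]
  [∀ x, AddCommGroup (V x)] [∀ x, Module ℂ (V x)] [∀ x, TopologicalSpace (V x)]
  [∀ x, IsTopologicalAddGroup (V x)] [∀ x, ContinuousSMul ℂ (V x)]
  [FiberBundle FV V] [VectorBundle ℂ FV V]

/-- `comp i`, `0 ≤ i ≤ m`, are the components of the curvature of `cov` at `x` under the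
decomposition of `Λ²(E ⊗ S^m H)` into the submodules `Λ²E ⊗ ω_H^i S^{2m-2i}H` (`i` even) and
`S²E ⊗ ω_H^i S^{2m-2i}H` (`i` odd):
`F(e ⊗ h₁⋯hₘ, e' ⊗ h'₁⋯h'ₘ) = ∑_σ ∑_τ ∑_{i=0}^m (∏_{j ≤ i} ω_H(h_{σ j}, h'_{τ j}))
  F^{(i)}(e, e'; h_{σ(i+1)}, …, h_{σ m}, h'_{τ(i+1)}, …, h'_{τ m})`,
where `F^{(i)}` is symmetric in its `2m - 2i` arguments from `H^*`, and skew in `e, e'` for even `i`,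
symmetric for odd `i`. These properties determine the components. -/
structure IsCurvatureDecomposition (cov : CovariantDerivative 𝓘(ℂ, EM) FV V) (x : M)
    (comp : ∀ i : Fin (m + 1), Es x →ₗ[ℂ] Es x →ₗ[ℂ]
      MultilinearMap ℂ (fun _ : Fin (m - i) ⊕ Fin (m - i) => Hs x) (V x →ₗ[ℂ] V x)) : Prop where
  symm_E : ∀ (i : Fin (m + 1)) (e e' : Es x), comp i e' e = (-1 : ℂ) ^ ((i : ℕ) + 1) • comp i e e'
  symm_H : ∀ (i : Fin (m + 1)) (e e' : Es x) (σ : Equiv.Perm (Fin (m - i) ⊕ Fin (m - i)))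
    (h : Fin (m - i) ⊕ Fin (m - i) → Hs x),
    comp i e e' (fun j => h (σ j)) = comp i e e' h
  eq_sum : ∀ (e e' : Es x) (h h' : Fin m → Hs x) (u : V x),
    curvature cov x ![S.vec x e h, S.vec x e' h'] u =
      ∑ σ : Equiv.Perm (Fin m), ∑ τ : Equiv.Perm (Fin m), ∑ i : Fin (m + 1),
        (∏ j : Fin i, S.omegaH x (h (σ (Fin.castLE i.is_le j))) (h' (τ (Fin.castLE i.is_le j)))) •
          comp i e e' (Sum.elim
            (fun j => h (σ ⟨i + j, by omega⟩))
            (fun j => h' (τ ⟨i + j, by omega⟩))) u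

/-- The connection is `k`-partially flat: `F^{(i)} = 0` for all `i ≤ 2k`. -/
def IsPartiallyFlat (k : ℕ) (cov : CovariantDerivative 𝓘(ℂ, EM) FV V) : Prop :=
  ∀ x : M, ∃ comp, S.IsCurvatureDecomposition cov x comp ∧
    ∀ i : Fin (m + 1), (i : ℕ) ≤ 2 * k → comp i = 0

end SpinGrassmann

end Grassmann

end Geometry

end GrassmannYM

end

/-! The statement is pointwise algebra followed by one Leibniz rule. For odd `m` the bound `i ≤ 2 *
((m - 1) / 2) = m - 1` kills every curvature component but the last, so `F = ω_H^m ⊗ T` with `T`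
symmetric on `E^*` (`curvatureForm_of_isPartiallyFlat`). Also `ω_H^m` is skew for odd `m`, and it is
nondegenerate because its Gram matrix in the monomials of a basis of `H^*` is antidiagonal; hence `g
= ω_E ⊗ ω_H^m` is symmetric and nondegenerate.

Eigenvalue. `∗Ω ∧ β` is the Hodge dual of the contraction `½ ∑ Ω(·, ·, c'ₖ, c'ₗ) β(cₖ, cₗ)`
(`wedge_hodgeStar`), and `∗∗ = 1` on 2-forms (`hodgeStar_hodgeStar_two`), so `B_Ω` is this
contraction. On decomposable vectors `Ω` is a sum of six products of two `ω_E` and two `ω_H^m`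
(`fourForm_tmul`). Contracted with `ω_H^m ⊗ T`, the products in which `ω_E` meets `T` in both
arguments vanish, skew against symmetric; the others return `ω_H^m ⊗ T`, with a trace `N = dim S^m H
= m + 1` or with coefficient one. The total is `-4(N + 1) = -4(m + 2)` (`contraction_fourForm`). As
this number is not zero and such 2-forms exist at every point, `Ω` vanishes nowhere.

Yang–Mills equation. From `∗F = λ⁻¹ ∗Ω ∧ F` the Leibniz rule expresses `d^∇ ∗F` by `(d∗Ω) ∧ F`, zero
by co-closedness, and `∗Ω ∧ d^∇F`, zero by the Bianchi identity (`bianchi`,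
`extDNabla_wedge_curvature`).

Forms are plain functions of tuples, so wedge products and exterior derivatives are handled as
iterated alternating sums `altSum`. The Hodge operator is controlled by one fact: the alternation of
a top form with a covector vanishes (`altSum_top_degree`). The analytic part shows that `F` is
tensorial, that extensions constant in a chart commute, and that `∗Ω` is holomorphic although
`hodgeStar` is defined by an arbitrary basis at each point. -/

noncomputable section

namespace GrassmannYM

/-! ### Alternating sums -/

section AltSum

variable {V : Type*} {A : Type*} [AddCommGroup A] [Module ℂ A]

/-- `∑ i, (-1)^i f (vᵢ) (v₀, …, v̂ᵢ, …, vₖ)`. -/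
def altSum {k : ℕ} (f : V → (Fin k → V) → A) (v : Fin (k + 1) → V) : A :=
  ∑ i : Fin (k + 1), (-1 : ℂ) ^ (i : ℕ) • f (v i) (i.removeNth v)

theorem altSum_cons {k : ℕ} (f : V → (Fin (k + 1) → V) → A) (x : V) (v : Fin (k + 1) → V) :
    altSum f (Fin.cons x v : Fin (k + 2) → V) =
      f x v - altSum (fun y u => f y (Fin.cons x u : Fin (k + 1) → V)) v := by
  rw [altSum, Fin.sum_univ_succ, altSum, sub_eq_add_neg, ← Finset.sum_neg_distrib]
  congr 1
  · simp
  · refine Finset.sum_congr rfl fun i _ => ?_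
    have : (i.succ.removeNth (Fin.cons x v : Fin (k + 2) → V)) =
        (Fin.cons x (i.removeNth v) : Fin (k + 1) → V) := by
      funext j
      refine Fin.cases ?_ (fun j => ?_) j <;> simp [Fin.removeNth]
    rw [this]
    simp [pow_succ]

theorem altSum_add {k : ℕ} (f g : V → (Fin k → V) → A) :
    altSum (fun x w => f x w + g x w) = altSum f + altSum g := by
  funext v; simp [altSum, Finset.sum_add_distrib]

theorem altSum_neg {k : ℕ} (f : V → (Fin k → V) → A) :
    altSum (fun x w => -f x w) = -altSum f := by
  funext v; simp [altSum]

theorem altSum_zero {k : ℕ} : altSum (fun (_ : V) (_ : Fin k → V) => (0 : A)) = 0 := by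
  funext v; simp [altSum]

theorem altSum_sum {k : ℕ} {ι : Type*} (s : Finset ι) (f : ι → V → (Fin k → V) → A) :
    altSum (fun x w => ∑ i ∈ s, f i x w) = ∑ i ∈ s, altSum (f i) := by
  funext v
  simp only [altSum, Finset.smul_sum, Finset.sum_apply]
  exact Finset.sum_comm

theorem altSum_smul {k : ℕ} (c : ℂ) (f : V → (Fin k → V) → A) :
    altSum (fun x w => c • f x w) = c • altSum f := by
  funext v
  simp only [altSum, Finset.smul_sum, Pi.smul_apply]
  exact Finset.sum_congr rfl fun i _ => smul_comm _ _ _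

theorem altSum_smul_const {k : ℕ} (f : V → (Fin k → V) → ℂ) (a : A) (v : Fin (k + 1) → V) :
    altSum (fun x w => f x w • a) v = altSum f v • a := by
  simp [altSum, Finset.sum_smul, smul_smul]

/-- Iterated alternating sums are antisymmetric in the two extracted arguments. -/
theorem altSum_altSum_swap {k : ℕ} (h : V → V → (Fin k → V) → A) (v : Fin (k + 2) → V) :
    altSum (fun x => altSum (h x)) v = -altSum (fun y => altSum fun x => h x y) v := by
  simp only [altSum, Finset.smul_sum, ← Finset.sum_neg_distrib, ← Finset.sum_product']
  -- A pair `(i, j)` extracts the positions `i` and then `i.succAbove j`. The map extracts the same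
  -- two positions in the other order; it is an involution and reverses the sign `(-1)^(i + j)`.
  refine Finset.sum_bij' (fun p _ => (p.1.succAbove p.2, p.2.predAbove p.1))
    (fun p _ => (p.1.succAbove p.2, p.2.predAbove p.1)) (fun _ _ => by simp) (fun _ _ => by simp)
    ?_ ?_ ?_
  · rintro ⟨i, j⟩ -
    simp [Fin.succAbove_succAbove_predAbove, Fin.predAbove_predAbove_succAbove]
  · rintro ⟨i, j⟩ -
    simp [Fin.succAbove_succAbove_predAbove, Fin.predAbove_predAbove_succAbove]
  · rintro ⟨i, j⟩ -
    have h1 : (i.succAbove j).removeNth v (j.predAbove i) = v i := by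
      simp [Fin.removeNth, Fin.succAbove_succAbove_predAbove]
    have h2 : i.removeNth v j = v (i.succAbove j) := rfl
    have h3 := Fin.neg_one_pow_succAbove_add_predAbove (R := ℂ) i j
    simp only [h1, h2, smul_smul, ← pow_add, h3, neg_smul, neg_neg,
      ← Fin.removeNth_removeNth_eq_swap]

/-- A cyclic shift is an even permutation of the order of extraction, so the signs of
`altSum_altSum_swap` cancel; the chain below uses four transpositions. -/
theorem altSum_three_cyclic {k : ℕ} (h : V → V → V → (Fin k → V) → A) (v : Fin (k + 3) → V) :
    altSum (fun z => altSum fun x => altSum fun y => h z x y) v =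
      altSum (fun z => altSum fun x => altSum fun y => h x y z) v := by
  have e1 : (fun z => altSum fun x => altSum fun y => h x y z) =
      (fun z w => -(altSum (fun y => altSum fun x => h x y z) w) : V → (Fin (k + 2) → V) → A) := by
    funext z w
    exact altSum_altSum_swap _ w
  have e3 : (fun y => altSum fun z => altSum fun x => h x y z) =
      (fun y w => -(altSum (fun x => altSum fun z => h x y z) w) :
        V → (Fin (k + 2) → V) → A) := by
    funext y w
    exact altSum_altSum_swap _ w
  symm
  calc altSum (fun z => altSum fun x => altSum fun y => h x y z) v
      = -altSum (fun z => altSum fun y => altSum fun x => h x y z) v := by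
        rw [e1, altSum_neg]; rfl
    _ = altSum (fun y => altSum fun z => altSum fun x => h x y z) v := by
        rw [altSum_altSum_swap fun z y => altSum fun x => h x y z, neg_neg]
    _ = -altSum (fun y => altSum fun x => altSum fun z => h x y z) v := by
        rw [e3, altSum_neg]; rfl
    _ = altSum (fun x => altSum fun y => altSum fun z => h x y z) v := by
        rw [altSum_altSum_swap fun y x => altSum fun z => h x y z, neg_neg]

/-- A triple alternating sum of a function with vanishing cyclic sums is zero. -/
theorem altSum_three_eq_zero {k : ℕ} (h : V → V → V → (Fin k → V) → A)
    (hc : ∀ x y z w, h x y z w + h y z x w + h z x y w = 0) (v : Fin (k + 3) → V) :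
    altSum (fun z => altSum fun x => altSum fun y => h z x y) v = 0 := by
  have h1 := altSum_three_cyclic h v
  have h2 := altSum_three_cyclic (fun z x y => h x y z) v
  have h3 : altSum (fun z => altSum fun x => altSum fun y => fun w =>
      (h z x y w + h x y z w) + h y z x w) v = 0 := by
    have : (fun z => altSum fun x => altSum fun y => fun w =>
      (h z x y w + h x y z w) + h y z x w) = fun (_ : V) (_ : Fin (k + 2) → V) => (0 : A) := by
      funext z
      have : ∀ x, (fun y (w : Fin k → V) => (h z x y w + h x y z w) + h y z x w) =
          fun _ _ => 0 := fun x => by funext y w; exact hc _ _ _ _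
      simp only [this]
      rw [show (fun x => altSum fun (_ : V) (_ : Fin k → V) => (0 : A)) =
        fun (_ : V) (_ : Fin (k + 1) → V) => (0 : A) from funext fun _ => altSum_zero]
      exact altSum_zero
    rw [this, altSum_zero]; rfl
  have h4 : altSum (fun z => altSum fun x => altSum fun y => fun w =>
      (h z x y w + h x y z w) + h y z x w) v =
      altSum (fun z => altSum fun x => altSum fun y => h z x y) v +
      altSum (fun z => altSum fun x => altSum fun y => h x y z) v +
      altSum (fun z => altSum fun x => altSum fun y => h y z x) v := by
    simp only [altSum_add]
    simp only [altSum, Pi.add_apply, smul_add, Finset.sum_add_distrib]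
  -- The three cyclic variants have the same alternating sum, so their vanishing total is three
  -- times each of them.
  rw [h3, ← h2, ← h1] at h4
  have h5 : (3 : ℂ) • altSum (fun z => altSum fun x => altSum fun y => h z x y) v = 0 := by
    rw [h4]; module
  exact (smul_eq_zero.1 h5).resolve_left (by norm_num)

/-- Moving the first extracted argument of a triple alternating sum to the last place. -/
theorem altSum_three_rotate {k : ℕ} (h : V → V → V → (Fin k → V) → A) (v : Fin (k + 3) → V) :
    altSum (fun z => altSum fun x => altSum fun y => h z x y) v =
      altSum (fun x => altSum fun y => altSum fun z => h z x y) v := by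
  rw [altSum_three_cyclic, altSum_three_cyclic]

end AltSum

/-! ### Sums over permutations -/

section PermSum

variable {V : Type*} {A : Type*} [AddCommGroup A] [Module ℂ A]

/-- The permutation of `Fin (k + 1)` which maps `0` to `i` and is `τ` on the remaining points. -/
def permCons {k : ℕ} (p : Fin (k + 1) × Equiv.Perm (Fin k)) : Equiv.Perm (Fin (k + 1)) :=
  p.1.cycleRange.symm * Equiv.Perm.decomposeFin.symm (0, p.2)

theorem permCons_zero {k : ℕ} (p : Fin (k + 1) × Equiv.Perm (Fin k)) : permCons p 0 = p.1 := by
  simp [permCons]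

theorem permCons_succ {k : ℕ} (p : Fin (k + 1) × Equiv.Perm (Fin k)) (j : Fin k) :
    permCons p j.succ = p.1.succAbove (p.2 j) := by
  simp [permCons]

theorem sign_permCons {k : ℕ} (p : Fin (k + 1) × Equiv.Perm (Fin k)) :
    Equiv.Perm.sign (permCons p) = (-1) ^ (p.1 : ℕ) * Equiv.Perm.sign p.2 := by
  rw [permCons, Equiv.Perm.sign_mul, Equiv.Perm.sign_symm, Fin.sign_cycleRange]
  simp [Equiv.Perm.decomposeFin.symm_sign]

theorem permCons_bijective {k : ℕ} :
    Function.Bijective (permCons : Fin (k + 1) × Equiv.Perm (Fin k) → _) := by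
  rw [Fintype.bijective_iff_injective_and_card]
  constructor
  · rintro ⟨i, τ⟩ ⟨i', τ'⟩ h
    have h0 : i = i' := by
      have := permCons_zero (i, τ)
      rw [h, permCons_zero] at this
      exact this.symm
    subst h0
    refine Prod.ext rfl (Equiv.ext fun j => ?_)
    have := permCons_succ (i, τ) j
    rw [h, permCons_succ] at this
    exact (Fin.succAbove_right_injective this).symm
  · simp [Fintype.card_perm, Nat.factorial_succ]

/-- Permutations are sorted by the image `i` of `0`, which contributes the sign `(-1)^i`. Iterated,
this turns antisymmetrisations into iterated `altSum`s. -/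
theorem sum_perm_succ {k : ℕ} (G : (Fin (k + 1) → V) → A) (v : Fin (k + 1) → V) :
    ∑ σ : Equiv.Perm (Fin (k + 1)), ((Equiv.Perm.sign σ : ℤ) : ℂ) • G (fun i => v (σ i)) =
      altSum (fun x w => ∑ τ : Equiv.Perm (Fin k), ((Equiv.Perm.sign τ : ℤ) : ℂ) •
        G (Fin.cons x (fun j => w (τ j)) : Fin (k + 1) → V)) v := by
  rw [← Function.Bijective.sum_comp permCons_bijective, Fintype.sum_prod_type, altSum]
  refine Finset.sum_congr rfl fun i _ => ?_
  rw [Finset.smul_sum]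
  refine Finset.sum_congr rfl fun τ _ => ?_
  have : (fun j => v (permCons (i, τ) j)) =
      (Fin.cons (v i) (fun j => i.removeNth v (τ j)) : Fin (k + 1) → V) := by
    funext j
    refine Fin.cases ?_ (fun j => ?_) j
    · simp [permCons_zero]
    · simp [permCons_succ, Fin.removeNth]
  rw [this, sign_permCons, smul_smul]
  simp

/-- Cyclic rotation of `p + 2` places by two. -/
def rotateTwo (p : ℕ) : Equiv.Perm (Fin (p + 2)) := (finRotate (p + 2))⁻¹ * (finRotate (p + 2))⁻¹

theorem sign_rotateTwo (p : ℕ) : Equiv.Perm.sign (rotateTwo p) = 1 := by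
  rw [rotateTwo, Equiv.Perm.sign_mul, Int.units_mul_self]

theorem rotateTwo_zero (p : ℕ) : rotateTwo p 0 = Fin.natAdd p 0 := by
  simp only [rotateTwo, Equiv.Perm.mul_apply]
  rw [Equiv.Perm.inv_eq_iff_eq, Equiv.Perm.inv_eq_iff_eq]
  ext; simp [Fin.val_add]

theorem rotateTwo_one (p : ℕ) : rotateTwo p 1 = Fin.natAdd p 1 := by
  simp only [rotateTwo, Equiv.Perm.mul_apply]
  rw [Equiv.Perm.inv_eq_iff_eq, Equiv.Perm.inv_eq_iff_eq]
  ext; simp [Fin.val_add]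

theorem rotateTwo_succ_succ (p : ℕ) (j : Fin p) : rotateTwo p j.succ.succ = Fin.castAdd 2 j := by
  simp only [rotateTwo, Equiv.Perm.mul_apply]
  rw [Equiv.Perm.inv_eq_iff_eq, Equiv.Perm.inv_eq_iff_eq]
  ext
  have h := j.2
  rw [finRotate_apply, finRotate_apply]
  simp only [Fin.val_add, Fin.val_castAdd, Fin.val_succ, Fin.val_one]
  rw [Nat.mod_eq_of_lt (a := j + 1) (by omega), Nat.mod_eq_of_lt (by omega)]

/-- Translation by the even permutation `rotateTwo` brings the arguments of `β` to the front, where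
they are extracted one by one. The remaining `p!` permutations contribute equally since `ψ` is
alternating, and `(p! 2!)⁻¹ p! = ½`. Alternation is a hypothesis because `hodgeStar` returns a bare
function. -/
theorem wedge_two_eq {p : ℕ} (ψ : (Fin p → V) → ℂ)
    (hψ : ∀ (w : Fin p → V) (τ : Equiv.Perm (Fin p)),
      ψ (fun i => w (τ i)) = ((Equiv.Perm.sign τ : ℤ) : ℂ) * ψ w)
    (β : (Fin 2 → V) → A) (v : Fin (p + 2) → V) :
    wedge ψ β v = (2⁻¹ : ℂ) • altSum (fun x => altSum fun y w => ψ w • β ![x, y]) v := by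
  set G : (Fin (p + 2) → V) → A := fun u => ψ (fun j => u j.succ.succ) • β ![u 0, u 1] with hG
  have h1 : ∑ σ : Equiv.Perm (Fin (p + 2)), ((Equiv.Perm.sign σ : ℤ) : ℂ) •
      ψ (fun i => v (σ (Fin.castAdd 2 i))) • β (fun j => v (σ (Fin.natAdd p j))) =
      ∑ σ : Equiv.Perm (Fin (p + 2)), ((Equiv.Perm.sign σ : ℤ) : ℂ) • G (fun i => v (σ i)) := by
    rw [← Equiv.sum_comp (Equiv.mulRight (rotateTwo p)) fun σ : Equiv.Perm (Fin (p + 2)) =>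
      ((Equiv.Perm.sign σ : ℤ) : ℂ) • G (fun i => v (σ i))]
    refine Finset.sum_congr rfl fun σ _ => ?_
    simp only [Equiv.coe_mulRight, hG, Equiv.Perm.sign_mul, sign_rotateTwo, mul_one,
      Equiv.Perm.mul_apply, rotateTwo_zero, rotateTwo_one, rotateTwo_succ_succ]
    congr 3
    funext j
    fin_cases j <;> rfl
  have h2 : ∑ σ : Equiv.Perm (Fin (p + 2)), ((Equiv.Perm.sign σ : ℤ) : ℂ) • G (fun i => v (σ i)) =
      (p.factorial : ℂ) • altSum (fun x => altSum fun y w => ψ w • β ![x, y]) v := by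
    rw [sum_perm_succ, ← Pi.smul_apply, ← altSum_smul]
    congr 1
    funext x w
    rw [sum_perm_succ fun u => G (Fin.cons x u), ← Pi.smul_apply, ← altSum_smul]
    congr 1
    funext y u
    have : ∀ τ : Equiv.Perm (Fin p), ((Equiv.Perm.sign τ : ℤ) : ℂ) •
        G (Fin.cons x (Fin.cons y (fun j => u (τ j)) : Fin (p + 1) → V)) = ψ u • β ![x, y] := by
      intro τ
      have hs : ((Equiv.Perm.sign τ : ℤ) : ℂ) * ((Equiv.Perm.sign τ : ℤ) : ℂ) = 1 := by
        rw [← Int.cast_mul, Int.units_coe_mul_self]; simp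
      have h0 : G (Fin.cons x (Fin.cons y (fun j => u (τ j)) : Fin (p + 1) → V)) =
          ψ (fun j => u (τ j)) • β ![x, y] := by simp [hG]
      rw [h0, hψ, smul_smul, ← mul_assoc, hs, one_mul]
    simp only [this]
    simp [Fintype.card_perm, Nat.cast_smul_eq_nsmul]
  have hp : (p.factorial : ℂ) ≠ 0 := by exact_mod_cast p.factorial_ne_zero
  rw [wedge, h1, h2, smul_smul]
  congr 1
  simp
  field_simp

end PermSum

/-! ### Dual families of a bilinear form -/

section DualPair

variable {V : Type*} [AddCommGroup V] [Module ℂ V] {ι κ : Type*} [Fintype ι] [Fintype κ]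

/-- The families `c` and `c'` expand every vector by means of the bilinear form `g`. -/
structure DualPair (g : V →ₗ[ℂ] V →ₗ[ℂ] ℂ) (c c' : ι → V) : Prop where
  sum_left : ∀ v, ∑ i, g (c' i) v • c i = v
  sum_right : ∀ v, ∑ i, g v (c i) • c' i = v

/-- A left kernel vector of the Gram matrix would be the coordinate vector of an element of the
radical of `g`. -/
theorem gram_det_ne_zero [DecidableEq ι] {g : V →ₗ[ℂ] V →ₗ[ℂ] ℂ}
    (hg : ∀ v, (∀ w, g v w = 0) → v = 0) (b : Module.Basis ι ℂ V) :
    (Matrix.of fun k l => g (b k) (b l)).det ≠ 0 := by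
  intro h
  obtain ⟨c, hc, h0⟩ := Matrix.exists_vecMul_eq_zero_iff.2 h
  refine hc (funext fun i => ?_)
  have hz : ∑ i, c i • b i = 0 := by
    refine hg _ fun w => ?_
    have : g (∑ i, c i • b i) = 0 := b.ext fun l => by
      simpa [Matrix.vecMul, dotProduct] using congrFun h0 l
    rw [this]; rfl
  exact Fintype.linearIndependent_iff.1 b.linearIndependent c hz i

/-- Symmetry of `g` is not assumed: the lemma serves the skew forms `ω_E` and `ω_H^m` as well as the
metric. This is why the order of arguments in `DualPair` matters. -/
theorem dualPair_dualFrame [DecidableEq ι] {g : V →ₗ[ℂ] V →ₗ[ℂ] ℂ}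
    (hg : ∀ v, (∀ w, g v w = 0) → v = 0) (b : Module.Basis ι ℂ V) :
    DualPair g b (dualFrame g b) := by
  have hdet := gram_det_ne_zero hg b
  have h1 : ∀ i l, g (dualFrame g b i) (b l) = if i = l then 1 else 0 := by
    intro i l
    have := congrFun (congrFun (Matrix.nonsing_inv_mul (Matrix.of fun k l => g (b k) (b l))
      (isUnit_iff_ne_zero.2 hdet)) i) l
    rw [Matrix.one_apply, Matrix.mul_apply] at this
    rw [← this, dualFrame]
    simp
  refine ⟨fun v => ?_, fun v => ?_⟩
  · have : (∑ i, (g (dualFrame g b i)).smulRight (b i)) = LinearMap.id := b.ext fun l => by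
      simp [h1]
    simpa using LinearMap.congr_fun this v
  · rw [← sub_eq_zero]
    refine hg _ fun w => ?_
    have : g (∑ i, g v (b i) • dualFrame g b i - v) = 0 := b.ext fun l => by simp [h1]
    rw [this]; rfl

theorem tmul_apply_tmul {W : Type*} [AddCommGroup W] [Module ℂ W] (a : V →ₗ[ℂ] V →ₗ[ℂ] ℂ)
    (b : W →ₗ[ℂ] W →ₗ[ℂ] ℂ) (x x' : V) (y y' : W) :
    LinearMap.BilinForm.tmul a b (x ⊗ₜ[ℂ] y) (x' ⊗ₜ[ℂ] y') = b y y' * a x x' :=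
  LinearMap.BilinForm.tensorDistrib_tmul ℂ ℂ a b x y x' y'

namespace DualPair

variable {g : V →ₗ[ℂ] V →ₗ[ℂ] ℂ} {c c' : ι → V} {d d' : κ → V}

theorem left_nondegenerate (h : DualPair g c c') {v : V} (hv : ∀ w, g v w = 0) : v = 0 := by
  rw [← h.sum_right v]; simp [hv]

theorem sum_left_symm (h : DualPair g c c') (hs : ∀ v w, g v w = g w v) (v : V) :
    ∑ i, g (c i) v • c' i = v := by
  simpa only [hs v] using h.sum_right v

theorem tmul {W : Type*} [AddCommGroup W] [Module ℂ W] {a : V →ₗ[ℂ] V →ₗ[ℂ] ℂ}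
    {b : W →ₗ[ℂ] W →ₗ[ℂ] ℂ} {e e' : ι → V} {f f' : κ → W} (he : DualPair a e e')
    (hf : DualPair b f f') :
    DualPair (LinearMap.BilinForm.tmul a b) (fun p : ι × κ => e p.1 ⊗ₜ[ℂ] f p.2)
      (fun p : ι × κ => e' p.1 ⊗ₜ[ℂ] f' p.2) := by
  constructor <;> intro v
  · induction v with
    | zero => simp
    | add x y hx hy => simp only [map_add, add_smul, Finset.sum_add_distrib, hx, hy]
    | tmul x y =>
      conv_rhs => rw [← he.sum_left x, ← hf.sum_left y]
      simp only [TensorProduct.sum_tmul, TensorProduct.tmul_sum, Fintype.sum_prod_type,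
        TensorProduct.smul_tmul_smul]
      rw [Finset.sum_comm]
      exact Finset.sum_congr rfl fun i _ => Finset.sum_congr rfl fun j _ => by
        rw [tmul_apply_tmul, mul_comm]
  · induction v with
    | zero => simp
    | add x y hx hy => simp only [map_add, LinearMap.add_apply, add_smul, Finset.sum_add_distrib, hx, hy]
    | tmul x y =>
      conv_rhs => rw [← he.sum_right x, ← hf.sum_right y]
      simp only [TensorProduct.sum_tmul, TensorProduct.tmul_sum, Fintype.sum_prod_type,
        TensorProduct.smul_tmul_smul]
      rw [Finset.sum_comm]
      exact Finset.sum_congr rfl fun i _ => Finset.sum_congr rfl fun j _ => by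
        rw [tmul_apply_tmul, mul_comm]

theorem map {W : Type*} [AddCommGroup W] [Module ℂ W] (h : DualPair g c c') (φ : V ≃ₗ[ℂ] W) :
    DualPair (LinearMap.compl₁₂ g φ.symm.toLinearMap φ.symm.toLinearMap) (fun i => φ (c i))
      (fun i => φ (c' i)) := by
  constructor <;> intro v
  · simpa using congrArg φ (h.sum_left (φ.symm v))
  · simpa using congrArg φ (h.sum_right (φ.symm v))

/-- Contractions with a pair of dual families do not depend on the families. -/
theorem sum_multilinear_eq {A : Type*} [AddCommGroup A] [Module ℂ A] (hc : DualPair g c c')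
    (hd : DualPair g d d') {p : ℕ} (F : MultilinearMap ℂ (fun _ : Fin p => V) ℂ)
    (G : MultilinearMap ℂ (fun _ : Fin p => V) A) :
    ∑ I : Fin p → ι, F (fun i => c (I i)) • G (fun i => c' (I i)) =
      ∑ I : Fin p → κ, F (fun i => d (I i)) • G (fun i => d' (I i)) := by
  classical
  -- Both sides become one double sum: `c` expands in `d`, and `d'` in `c'`, with the same
  -- coefficients `g (d' k) (c i)`.
  have h1 : ∀ I : Fin p → ι, F (fun i => c (I i)) =
      ∑ K : Fin p → κ, (∏ i, g (d' (K i)) (c (I i))) * F (fun i => d (K i)) := by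
    intro I
    conv_lhs => rw [show (fun i => c (I i)) = fun i => ∑ k, g (d' k) (c (I i)) • d k from
      funext fun i => (hd.sum_left _).symm]
    rw [MultilinearMap.map_sum]
    refine Finset.sum_congr rfl fun K _ => ?_
    rw [MultilinearMap.map_smul_univ, smul_eq_mul]
  have h2 : ∀ K : Fin p → κ, G (fun i => d' (K i)) =
      ∑ I : Fin p → ι, (∏ i, g (d' (K i)) (c (I i))) • G (fun i => c' (I i)) := by
    intro K
    conv_lhs => rw [show (fun i => d' (K i)) = fun i => ∑ k, g (d' (K i)) (c k) • c' k from
      funext fun i => (hc.sum_right _).symm]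
    rw [MultilinearMap.map_sum]
    refine Finset.sum_congr rfl fun I _ => ?_
    rw [MultilinearMap.map_smul_univ]
  simp only [h1, h2, Finset.sum_smul, Finset.smul_sum, smul_smul]
  rw [Finset.sum_comm]
  refine Finset.sum_congr rfl fun K _ => Finset.sum_congr rfl fun I _ => ?_
  rw [mul_comm]

end DualPair

end DualPair

/-! ### Exterior and interior multiplication -/

section Interior

variable {V : Type*} [AddCommGroup V] [Module ℂ V] {A : Type*} [AddCommGroup A] [Module ℂ A]

/-- The left side is an alternating form of degree `n + 1` on a space of dimension `n`. Every
identity for volume forms below descends from this vanishing. -/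
theorem altSum_top_degree [FiniteDimensional ℂ V] {n : ℕ} (hn : Module.finrank ℂ V = n)
    (μ : V [⋀^Fin n]→ₗ[ℂ] ℂ) (θ : V →ₗ[ℂ] A) (v : Fin (n + 1) → V) :
    altSum (fun y w => μ w • θ y) v = 0 := by
  let f : V →ₗ[ℂ] V [⋀^Fin n]→ₗ[ℂ] A :=
    { toFun := fun y => (LinearMap.toSpanSingleton ℂ A (θ y)).compAlternatingMap μ
      map_add' := fun x y => by ext w; simp
      map_smul' := fun c x => by ext w; simpa using smul_comm _ _ _ }
  have h := AlternatingMap.alternatizeUncurryFin_apply f v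
  rw [AlternatingMap.map_linearDependent] at h
  · refine Eq.trans (Finset.sum_congr rfl fun i _ => ?_) h.symm
    rw [← Int.cast_smul_eq_zsmul ℂ]
    simp [f]
  · intro hl
    have := hl.fintype_card_le_finrank
    simp [hn] at this

variable [FiniteDimensional ℂ V] {q : ℕ}

/-- This is `θ ∧ ι_x μ = θ(x) μ`: evaluate `altSum_top_degree` on `(x, v)` and split off the first
term. The next three lemmas repeat the step, with one more inserted vector each time. -/
theorem altSum_one (hn : Module.finrank ℂ V = q + 1) (μ : V [⋀^Fin (q + 1)]→ₗ[ℂ] ℂ)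
    (θ : V →ₗ[ℂ] A) (x : V) (v : Fin (q + 1) → V) :
    altSum (fun y u => μ (Fin.cons x u : Fin (q + 1) → V) • θ y) v = μ v • θ x := by
  have h := altSum_top_degree hn μ θ (Fin.cons x v)
  rw [altSum_cons, sub_eq_zero] at h
  exact h.symm

theorem altSum_two (hn : Module.finrank ℂ V = q + 2) (μ : V [⋀^Fin (q + 2)]→ₗ[ℂ] ℂ)
    (θ : V →ₗ[ℂ] A) (x y : V) (v : Fin (q + 1) → V) :
    altSum (fun z u => μ (Fin.cons x (Fin.cons y u : Fin (q + 1) → V) : Fin (q + 2) → V) • θ z) v =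
      μ (Fin.cons x v : Fin (q + 2) → V) • θ y - μ (Fin.cons y v : Fin (q + 2) → V) • θ x := by
  have h := altSum_one hn μ θ x (Fin.cons y v)
  rw [altSum_cons, sub_eq_iff_eq_add] at h
  rw [h]; abel

theorem altSum_three (hn : Module.finrank ℂ V = q + 3) (μ : V [⋀^Fin (q + 3)]→ₗ[ℂ] ℂ)
    (θ : V →ₗ[ℂ] A) (x y z : V) (v : Fin (q + 1) → V) :
    altSum (fun t u => μ (Fin.cons x (Fin.cons y (Fin.cons z u : Fin (q + 1) → V) :
        Fin (q + 2) → V) : Fin (q + 3) → V) • θ t) v =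
      μ (Fin.cons x (Fin.cons y v : Fin (q + 2) → V) : Fin (q + 3) → V) • θ z -
      μ (Fin.cons x (Fin.cons z v : Fin (q + 2) → V) : Fin (q + 3) → V) • θ y +
      μ (Fin.cons y (Fin.cons z v : Fin (q + 2) → V) : Fin (q + 3) → V) • θ x := by
  have h := altSum_two hn μ θ x y (Fin.cons z v)
  rw [altSum_cons, sub_eq_iff_eq_add] at h
  rw [h]; abel

theorem altSum_four (hn : Module.finrank ℂ V = q + 4) (μ : V [⋀^Fin (q + 4)]→ₗ[ℂ] ℂ)
    (θ : V →ₗ[ℂ] A) (x y z t : V) (v : Fin (q + 1) → V) :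
    altSum (fun s u => μ (Fin.cons x (Fin.cons y (Fin.cons z (Fin.cons t u : Fin (q + 1) → V) :
        Fin (q + 2) → V) : Fin (q + 3) → V) : Fin (q + 4) → V) • θ s) v =
      μ (Fin.cons x (Fin.cons y (Fin.cons z v : Fin (q + 2) → V) : Fin (q + 3) → V) :
        Fin (q + 4) → V) • θ t -
      μ (Fin.cons x (Fin.cons y (Fin.cons t v : Fin (q + 2) → V) : Fin (q + 3) → V) :
        Fin (q + 4) → V) • θ z +
      μ (Fin.cons x (Fin.cons z (Fin.cons t v : Fin (q + 2) → V) : Fin (q + 3) → V) :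
        Fin (q + 4) → V) • θ y -
      μ (Fin.cons y (Fin.cons z (Fin.cons t v : Fin (q + 2) → V) : Fin (q + 3) → V) :
        Fin (q + 4) → V) • θ x := by
  have h := altSum_three hn μ θ x y z (Fin.cons t v)
  rw [altSum_cons, sub_eq_iff_eq_add] at h
  rw [h]; abel

end Interior

/-! ### The Hodge operator -/

section Hodge

variable {V : Type*} [AddCommGroup V] [Module ℂ V] {A : Type*} [AddCommGroup A] [Module ℂ A]
  {ι κ : Type*} [Fintype ι] [Fintype κ]

theorem sum_pi_succ {A : Type*} [AddCommMonoid A] {p : ℕ} (f : (Fin (p + 1) → ι) → A) :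
    ∑ I : Fin (p + 1) → ι, f I = ∑ i, ∑ J : Fin p → ι, f (Fin.cons i J : Fin (p + 1) → ι) := by
  rw [← Fintype.sum_prod_type', ← Equiv.sum_comp (Fin.consEquiv fun _ => ι)]
  rfl

/-- The values of a multilinear map with the last `q` arguments fixed. -/
def appendRight {n p q : ℕ} (μ : MultilinearMap ℂ (fun _ : Fin n => V) A) (h : p + q = n)
    (v : Fin q → V) : MultilinearMap ℂ (fun _ : Fin p => V) A :=
  (μ.domDomCongr (((finCongr h).symm.trans finSumFinEquiv.symm).trans
    (Equiv.sumComm (Fin p) (Fin q)))).currySum v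

theorem appendRight_apply {n p q : ℕ} (μ : MultilinearMap ℂ (fun _ : Fin n => V) A)
    (h : p + q = n) (v : Fin q → V) (u : Fin p → V) :
    appendRight μ h v u = μ fun k => Fin.append u v (Fin.cast h.symm k) := by
  subst h
  simp only [appendRight, MultilinearMap.currySum_apply, MultilinearMap.domDomCongr_apply]
  congr 1
  funext k
  refine Fin.addCases (fun i => ?_) (fun i => ?_) k <;> simp

/-- The definition uses `Module.finBasis` at each point, which need not depend holomorphically on
the point. Independence of the dual families permits a holomorphic local frame instead. -/
theorem hodgeStar_eq [FiniteDimensional ℂ V] {g : V →ₗ[ℂ] V →ₗ[ℂ] ℂ}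
    (hg : ∀ v, (∀ w, g v w = 0) → v = 0) {c c' : κ → V} (hc : DualPair g c c')
    {n p q : ℕ} (h : p + q = n) (vol : MultilinearMap ℂ (fun _ : Fin n => V) ℂ)
    (β : MultilinearMap ℂ (fun _ : Fin p => V) A) (v : Fin q → V) :
    hodgeStar g vol p q β v = ((p.factorial : ℂ)⁻¹) • ∑ I : Fin p → κ,
      vol (fun k => Fin.append (fun i => c (I i)) v (Fin.cast h.symm k)) •
        β (fun i => c' (I i)) := by
  rw [hodgeStar, dif_pos h]
  have e : ∀ u : Fin p → V, vol (fun k => Fin.append u v (Fin.cast h.symm k)) =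
    appendRight vol h v u := fun u => (appendRight_apply vol h v u).symm
  simp only [e]
  rw [(dualPair_dualFrame hg _).sum_multilinear_eq hc]

omit [AddCommGroup V] [Module ℂ V] in
theorem append_four {q : ℕ} (h : 4 + q = q + 4) (x y z t : V) (v : Fin q → V) :
    (fun k => Fin.append ![x, y, z, t] v (Fin.cast h.symm k)) =
      (Fin.cons x (Fin.cons y (Fin.cons z (Fin.cons t v : Fin (q + 1) → V) :
        Fin (q + 2) → V) : Fin (q + 3) → V) : Fin (q + 4) → V) := by
  funext k
  obtain ⟨k, rfl⟩ := (finCongr h).surjective k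
  refine Fin.addCases (fun i => ?_) (fun i => ?_) k
  · fin_cases i
    · simp; rfl
    · simp; rfl
    · simp; rfl
    · simp; rfl
  · have : (finCongr h) (Fin.natAdd 4 i) = i.succ.succ.succ.succ := by
      ext; simp
    rw [this]
    simp only [Fin.cons_succ]
    rw [← this]
    simp

omit [AddCommGroup V] [Module ℂ V] in
theorem append_two {q : ℕ} (h : 2 + (q + 2) = q + 4) (x y : V) (v : Fin (q + 2) → V) :
    (fun k => Fin.append ![x, y] v (Fin.cast h.symm k)) =
      (Fin.cons x (Fin.cons y v : Fin (q + 3) → V) : Fin (q + 4) → V) := by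
  funext k
  obtain ⟨k, rfl⟩ := (finCongr h).surjective k
  refine Fin.addCases (fun i => ?_) (fun i => ?_) k
  · fin_cases i
    · simp; rfl
    · simp; rfl
  · have : (finCongr h) (Fin.natAdd 2 i) = i.succ.succ := by
      ext; simp
    rw [this]
    simp only [Fin.cons_succ]
    rw [← this]
    simp

variable [FiniteDimensional ℂ V]

/-- The basis entering the definition of the Hodge operator. -/
local notation "b" => Module.finBasis ℂ V

variable {g : V →ₗ[ℂ] V →ₗ[ℂ] ℂ} {q : ℕ}

theorem hodgeStar_four (vol : (Fin (q + 4) → V) → ℂ) (β : (Fin 4 → V) → A) (v : Fin q → V) :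
    hodgeStar g vol 4 q β v = (24⁻¹ : ℂ) • ∑ I : Fin 4 → Fin (Module.finrank ℂ V),
      vol (Fin.cons (b (I 0)) (Fin.cons (b (I 1)) (Fin.cons (b (I 2)) (Fin.cons (b (I 3)) v :
        Fin (q + 1) → V) : Fin (q + 2) → V) : Fin (q + 3) → V) : Fin (q + 4) → V) •
      β (fun i => dualFrame g b (I i)) := by
  have h : 4 + q = q + 4 := add_comm _ _
  rw [hodgeStar, dif_pos h]
  congr 1
  refine Finset.sum_congr rfl fun I _ => ?_
  rw [← append_four h]
  congr 2
  funext k'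
  congr 2
  funext i'; fin_cases i' <;> rfl

theorem hodgeStar_two (vol : (Fin (q + 4) → V) → ℂ) (β : (Fin 2 → V) → A) (v : Fin (q + 2) → V) :
    hodgeStar g vol 2 (q + 2) β v = (2⁻¹ : ℂ) • ∑ i, ∑ j,
      vol (Fin.cons (b i) (Fin.cons (b j) v : Fin (q + 3) → V) : Fin (q + 4) → V) •
      β ![dualFrame g b i, dualFrame g b j] := by
  have h : 2 + (q + 2) = q + 4 := by omega
  rw [hodgeStar, dif_pos h]
  simp only [sum_pi_succ, Finset.univ_unique, Finset.sum_singleton]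
  congr 1
  refine Finset.sum_congr rfl fun i _ => Finset.sum_congr rfl fun j _ => ?_
  rw [← append_two h]
  congr 2
  · funext k'
    congr 2
    funext i'; fin_cases i' <;> rfl
  · funext i'; fin_cases i' <;> rfl

/-- The contraction of a 4-form and a 2-form, `½ ∑ Ω(x, y, c'ₖ, c'ₗ) β(cₖ, cₗ)`. -/
def contraction (c c' : κ → V) (Ω : (Fin 4 → V) → ℂ) (β : (Fin 2 → V) → A) (w : Fin 2 → V) : A :=
  (2⁻¹ : ℂ) • ∑ k, ∑ l, Ω ![w 0, w 1, c' k, c' l] • β ![c k, c l]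

theorem hodgeStar_four_perm (vol : V [⋀^Fin (q + 4)]→ₗ[ℂ] ℂ) (Ω : (Fin 4 → V) → ℂ)
    (w : Fin q → V) (τ : Equiv.Perm (Fin q)) :
    hodgeStar g vol 4 q Ω (fun i => w (τ i)) =
      ((Equiv.Perm.sign τ : ℤ) : ℂ) * hodgeStar g vol 4 q Ω w := by
  simp only [hodgeStar_four, smul_eq_mul]
  rw [mul_left_comm]
  congr 1
  simp only [Finset.mul_sum]
  refine Finset.sum_congr rfl fun I _ => ?_
  rw [← mul_assoc]
  congr 1
  have := ((((vol.curryLeft (b (I 0))).curryLeft (b (I 1))).curryLeft (b (I 2))).curryLeft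
    (b (I 3))).map_perm w τ
  rw [Units.smul_def, ← Int.cast_smul_eq_zsmul ℂ] at this
  exact this

/-- The 2-form given by a bilinear map. -/
def twoForm (B : V →ₗ[ℂ] V →ₗ[ℂ] A) (w : Fin 2 → V) : A := B (w 0) (w 1)

omit [FiniteDimensional ℂ V] in
theorem bilin_swap {B : V →ₗ[ℂ] V →ₗ[ℂ] A} (hB : ∀ x, B x x = 0) (x y : V) :
    B x y = -B y x := by
  have := hB (x + y)
  simp only [map_add, LinearMap.add_apply, hB, zero_add, add_zero] at this
  exact eq_neg_of_add_eq_zero_right this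

/-- The inner sum is evaluated by `altSum_four` and the outer one by `altSum_three`. `B` takes up
two of the four inserted vectors and `P` the other two; each of the six splittings arises in both
orders of the arguments of `B`, which gives the factor 2. -/
theorem altSum_altSum_four (hn : Module.finrank ℂ V = q + 4) (vol : V [⋀^Fin (q + 4)]→ₗ[ℂ] ℂ)
    {B : V →ₗ[ℂ] V →ₗ[ℂ] A} (hB : ∀ x, B x x = 0) (x y z t : V) (v : Fin (q + 2) → V)
    {P : V → V → ℂ} (hP : P = fun x y =>
      vol (Fin.cons x (Fin.cons y v : Fin (q + 3) → V) : Fin (q + 4) → V)) :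
    altSum (fun r => altSum fun s u => vol (Fin.cons x (Fin.cons y (Fin.cons z (Fin.cons t u :
        Fin (q + 1) → V) : Fin (q + 2) → V) : Fin (q + 3) → V) : Fin (q + 4) → V) • B r s) v =
      (2 : ℂ) • (P x y • B z t - P x z • B y t + P y z • B x t + P x t • B y z - P y t • B x z +
        P z t • B x y) := by
  subst hP
  have h4 := fun r => funext fun u : Fin (q + 1) → V => altSum_four hn vol (B r) x y z t u
  simp only [h4]
  have h3 := fun x y z t => altSum_three (q := q + 1) hn vol (B.flip t) x y z v
  simp only [LinearMap.flip_apply] at h3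
  have hlin : ∀ f1 f2 f3 f4 : V → (Fin (q + 1) → V) → A,
      altSum (fun r u => f1 r u - f2 r u + f3 r u - f4 r u) v =
        altSum f1 v - altSum f2 v + altSum f3 v - altSum f4 v := by
    intro f1 f2 f3 f4
    simp only [altSum, smul_add, smul_sub, Finset.sum_add_distrib, Finset.sum_sub_distrib]
  refine (hlin _ _ _ _).trans ?_
  rw [h3, h3, h3, h3, bilin_swap hB t z, bilin_swap hB t y, bilin_swap hB z y, bilin_swap hB t x,
    bilin_swap hB z x, bilin_swap hB y x]
  module

/-- `∗Ω ∧ β = ∗(½ ∑ Ω(·, ·, b'ₖ, b'ₗ) β(bₖ, bₗ))`. -/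
theorem wedge_hodgeStar (hn : Module.finrank ℂ V = q + 4) (vol : V [⋀^Fin (q + 4)]→ₗ[ℂ] ℂ)
    (Ω : V [⋀^Fin 4]→ₗ[ℂ] ℂ) {B : V →ₗ[ℂ] V →ₗ[ℂ] A} (hB : ∀ x, B x x = 0) :
    wedge (hodgeStar g vol 4 q Ω) (twoForm B) =
      hodgeStar g vol 2 (q + 2) (contraction b (dualFrame g b) Ω (twoForm B)) := by
  funext v
  rw [wedge_two_eq _ (hodgeStar_four_perm vol _), hodgeStar_two]
  set P : V → V → ℂ := fun x y =>
    vol (Fin.cons x (Fin.cons y v : Fin (q + 3) → V) : Fin (q + 4) → V) with hP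
  have h1 : ∀ x y (w : Fin q → V), hodgeStar g vol 4 q Ω w • twoForm B ![x, y] =
      (24⁻¹ : ℂ) • ∑ I : Fin 4 → Fin (Module.finrank ℂ V), Ω (fun i => dualFrame g b (I i)) •
        vol (Fin.cons (b (I 0)) (Fin.cons (b (I 1)) (Fin.cons (b (I 2)) (Fin.cons (b (I 3)) w :
        Fin (q + 1) → V) : Fin (q + 2) → V) : Fin (q + 3) → V) : Fin (q + 4) → V) • B x y := by
    intro x y w
    rw [hodgeStar_four, smul_assoc, Finset.sum_smul]
    congr 1
    refine Finset.sum_congr rfl fun I _ => ?_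
    rw [smul_eq_mul, mul_comm, mul_smul]
    rfl
  have h2 : altSum (fun x => altSum fun y w => hodgeStar g vol 4 q Ω w • twoForm B ![x, y]) v =
      (24⁻¹ : ℂ) • ∑ I : Fin 4 → Fin (Module.finrank ℂ V), Ω (fun i => dualFrame g b (I i)) •
      (2 : ℂ) • (P (b (I 0)) (b (I 1)) • B (b (I 2)) (b (I 3)) -
        P (b (I 0)) (b (I 2)) • B (b (I 1)) (b (I 3)) +
        P (b (I 1)) (b (I 2)) • B (b (I 0)) (b (I 3)) +
        P (b (I 0)) (b (I 3)) • B (b (I 1)) (b (I 2)) -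
        P (b (I 1)) (b (I 3)) • B (b (I 0)) (b (I 2)) +
        P (b (I 2)) (b (I 3)) • B (b (I 0)) (b (I 1))) := by
    simp only [h1, altSum_smul, altSum_sum]
    have hsm : ∀ (c : ℂ) (f : V → (Fin (q + 1) → V) → A),
      altSum (fun x => c • f x) v = c • altSum f v := fun c f => congrFun (altSum_smul c f) v
    have hsu : ∀ (f : (Fin 4 → Fin (Module.finrank ℂ V)) → V → (Fin (q + 1) → V) → A),
        altSum (fun x => ∑ I, f I x) v = ∑ I, altSum (f I) v := by
      intro f
      have := congrFun (altSum_sum Finset.univ f) v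
      simp only [Finset.sum_apply] at this
      rw [← this]
      congr 1
      funext x w
      simp
    rw [hsm, hsu]
    congr 1
    refine Finset.sum_congr rfl fun I _ => ?_
    rw [hsm, altSum_altSum_four hn vol hB _ _ _ _ _ hP]
  -- Renaming the summation indices by `σ` moves `σ` onto the arguments of `Ω` and costs its sign.
  -- So the six terms of `h2`, with their signs, are all equal.
  have h3 : ∀ σ : Equiv.Perm (Fin 4), ∑ I : Fin 4 → Fin (Module.finrank ℂ V),
      Ω (fun i => dualFrame g b (I i)) • P (b (I (σ 0))) (b (I (σ 1))) •
        B (b (I (σ 2))) (b (I (σ 3))) = ((Equiv.Perm.sign σ : ℤ) : ℂ) •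
      ∑ I : Fin 4 → Fin (Module.finrank ℂ V),
      Ω (fun i => dualFrame g b (I i)) • P (b (I 0)) (b (I 1)) • B (b (I 2)) (b (I 3)) := by
    intro σ
    rw [← Equiv.sum_comp (Equiv.arrowCongr σ (Equiv.refl (Fin (Module.finrank ℂ V)))),
      Finset.smul_sum]
    refine Finset.sum_congr rfl fun I _ => ?_
    have h4 : Ω (fun i => dualFrame g b (I (σ.symm i))) =
        ((Equiv.Perm.sign σ : ℤ) : ℂ) * Ω (fun i => dualFrame g b (I i)) := by
      have := Ω.map_perm (fun i => dualFrame g b (I i)) σ⁻¹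
      rw [Units.smul_def, ← Int.cast_smul_eq_zsmul ℂ, Equiv.Perm.sign_inv] at this
      exact this
    rw [smul_smul _ (Ω _), ← h4]
    simp [Equiv.arrowCongr, Function.comp_def]
  -- These permutations carry the index pattern `01|23` to `02|13`, `12|03`, `03|12`, `13|02` and
  -- `23|01`.
  have s1 := h3 (Equiv.swap 1 2)
  have s2 := h3 (Equiv.swap 0 1 * Equiv.swap 1 2)
  have s3 := h3 (Equiv.swap 1 3 * Equiv.swap 2 3)
  have s4 := h3 (Equiv.swap 0 1 * Equiv.swap 1 3 * Equiv.swap 2 3)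
  have s5 := h3 (Equiv.swap 0 2 * Equiv.swap 1 3)
  simp only [Equiv.Perm.mul_apply, show Equiv.swap (1 : Fin 4) 2 0 = 0 by decide,
    show Equiv.swap (1 : Fin 4) 2 1 = 2 by decide, show Equiv.swap (1 : Fin 4) 2 2 = 1 by decide,
    show Equiv.swap (1 : Fin 4) 2 3 = 3 by decide, show Equiv.swap (0 : Fin 4) 1 0 = 1 by decide,
    show Equiv.swap (0 : Fin 4) 1 1 = 0 by decide, show Equiv.swap (0 : Fin 4) 1 2 = 2 by decide,
    show Equiv.swap (0 : Fin 4) 1 3 = 3 by decide, show Equiv.swap (1 : Fin 4) 3 0 = 0 by decide,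
    show Equiv.swap (1 : Fin 4) 3 1 = 3 by decide, show Equiv.swap (1 : Fin 4) 3 2 = 2 by decide,
    show Equiv.swap (1 : Fin 4) 3 3 = 1 by decide, show Equiv.swap (2 : Fin 4) 3 0 = 0 by decide,
    show Equiv.swap (2 : Fin 4) 3 1 = 1 by decide, show Equiv.swap (2 : Fin 4) 3 2 = 3 by decide,
    show Equiv.swap (2 : Fin 4) 3 3 = 2 by decide, show Equiv.swap (0 : Fin 4) 2 0 = 2 by decide,
    show Equiv.swap (0 : Fin 4) 2 1 = 1 by decide, show Equiv.swap (0 : Fin 4) 2 2 = 0 by decide,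
    show Equiv.swap (0 : Fin 4) 2 3 = 3 by decide, Equiv.Perm.sign_mul,
    Equiv.Perm.sign_swap (show (1 : Fin 4) ≠ 2 by decide),
    Equiv.Perm.sign_swap (show (0 : Fin 4) ≠ 1 by decide),
    Equiv.Perm.sign_swap (show (1 : Fin 4) ≠ 3 by decide),
    Equiv.Perm.sign_swap (show (2 : Fin 4) ≠ 3 by decide),
    Equiv.Perm.sign_swap (show (0 : Fin 4) ≠ 2 by decide)] at s1 s2 s3 s4 s5
  have c1 : ∀ (I : Fin 4 → Fin (Module.finrank ℂ V)) (x : A),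
      Ω (fun i => dualFrame g b (I i)) • (2 : ℂ) • x =
        (2 : ℂ) • Ω (fun i => dualFrame g b (I i)) • x := fun _ _ => smul_comm _ _ _
  have c2 : ∀ i j (x : A), P (b i) (b j) • (2 : ℂ) • x = (2 : ℂ) • P (b i) (b j) • x :=
    fun _ _ _ => smul_comm _ _ _
  rw [h2]
  simp only [c1, ← Finset.smul_sum]
  simp only [smul_add, smul_sub, Finset.sum_add_distrib, Finset.sum_sub_distrib, s1, s2, s3, s4, s5]
  have h5 : ∑ I : Fin 4 → Fin (Module.finrank ℂ V), Ω (fun i => dualFrame g b (I i)) •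
      P (b (I 0)) (b (I 1)) • B (b (I 2)) (b (I 3)) = ∑ i, ∑ j, P (b i) (b j) • (2 : ℂ) •
      contraction b (dualFrame g b) Ω (twoForm B) ![dualFrame g b i, dualFrame g b j] := by
    simp only [sum_pi_succ, Finset.univ_unique, Finset.sum_singleton, contraction]
    refine Finset.sum_congr rfl fun i _ => Finset.sum_congr rfl fun j _ => ?_
    rw [smul_inv_smul₀ two_ne_zero, Finset.smul_sum]
    refine Finset.sum_congr rfl fun k _ => ?_
    rw [Finset.smul_sum]
    refine Finset.sum_congr rfl fun l _ => ?_
    rw [smul_comm (P _ _)]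
    congr 2
    funext i'; fin_cases i' <;> rfl
  rw [h5]
  simp only [c2, ← Finset.smul_sum]
  -- The factors are `½` from the wedge product, `1/24` from `∗Ω`, `2 · 6` from the six equal terms,
  -- and `2` from the `½` in `contraction`; their product is the `½` of `hodgeStar_two`.
  push_cast
  module

end Hodge

/-! ### ### The square of the Hodge operator on 2-forms -/

section HodgeSquare

variable {V : Type*} [AddCommGroup V] [Module ℂ V] {A : Type*} [AddCommGroup A] [Module ℂ A]
  {ι : Type*} [Fintype ι] {g : V →ₗ[ℂ] V →ₗ[ℂ] ℂ} {c c' : ι → V} {q : ℕ}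

/-- Exterior multiplication is adjoint to interior multiplication. -/
theorem sum_mul_altSum (hc : DualPair g c c') {k : ℕ} (f : V [⋀^Fin (k + 1)]→ₗ[ℂ] ℂ)
    (h : (Fin k → V) → ℂ) (x : V) :
    ∑ J : Fin (k + 1) → ι, f (fun i => c' (J i)) * altSum (fun y w => h w • g x y)
      (fun i => c (J i)) =
    (k + 1) * ∑ J : Fin k → ι, f (Fin.cons x (fun i => c' (J i)) : Fin (k + 1) → V) *
      h (fun i => c (J i)) := by
  have hx : ∀ w : Fin k → V, f (Fin.cons x w : Fin (k + 1) → V) =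
      ∑ j, g x (c j) * f (Fin.cons (c' j) w : Fin (k + 1) → V) := by
    intro w
    let φ : V →ₗ[ℂ] ℂ :=
      { toFun := fun y => f.curryLeft y w
        map_add' := fun y z => by simp
        map_smul' := fun a y => by simp }
    have := congrArg φ (hc.sum_right x)
    rw [map_sum] at this
    simp only [map_smul, smul_eq_mul] at this
    exact this.symm
  -- All `k + 1` positions contribute equally: moving the `i`-th argument of `f` to the front costs
  -- `(-1)^i`, which cancels the sign in `altSum`, and the sum over its index is the dual expansion
  -- of `x`.
  have h1 : ∀ i : Fin (k + 1), ∑ J : Fin (k + 1) → ι, f (fun i => c' (J i)) *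
      ((-1 : ℂ) ^ (i : ℕ) * (h (i.removeNth fun i => c (J i)) * g x (c (J i)))) =
      ∑ J : Fin k → ι, f (Fin.cons x (fun i => c' (J i)) : Fin (k + 1) → V) *
      h (fun i => c (J i)) := by
    intro i
    rw [← Equiv.sum_comp (Fin.insertNthEquiv (fun _ => ι) i), Fintype.sum_prod_type,
      Finset.sum_comm]
    refine Finset.sum_congr rfl fun J _ => ?_
    rw [hx, Finset.sum_mul]
    refine Finset.sum_congr rfl fun j _ => ?_
    have e1 : (fun l => c' (Fin.insertNthEquiv (fun _ => ι) i (j, J) l)) =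
        i.insertNth (α := fun _ => V) (c' j) (fun l => c' (J l)) := by
      funext l
      refine Fin.succAboveCases i ?_ (fun l => ?_) l <;> simp
    have e2 : i.removeNth (α := fun _ => V)
        (fun l => c (Fin.insertNthEquiv (fun _ => ι) i (j, J) l)) = fun l => c (J l) := by
      funext l; simp [Fin.removeNth]
    have e3 : c (Fin.insertNthEquiv (fun _ => ι) i (j, J) i) = c j := by simp
    rw [e1, e2, e3, AlternatingMap.map_insertNth, Matrix.vecCons]
    have e4 : ((-1 : ℂ) ^ (i : ℕ)) * (-1) ^ (i : ℕ) = 1 := by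
      rw [← mul_pow]; simp
    rw [← Int.cast_smul_eq_zsmul ℂ]
    push_cast
    rw [smul_eq_mul]
    linear_combination (f (Fin.cons (c' j) fun l => c' (J l)) * h (fun l => c (J l)) * g x (c j)) * e4
  simp only [altSum, smul_eq_mul, Finset.mul_sum]
  rw [Finset.sum_comm]
  simp only [h1]
  simp [← Finset.mul_sum]

variable [FiniteDimensional ℂ V]

/-- By independence of the dual families a basis `e` and its dual frame may be used. Only injective
index tuples contribute, and each gives `vol(e) vol(e^*) = 1`, since `vol(e)² = det G` by the unit
condition and `vol(e^*) = vol(e) / det G`. -/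
theorem sum_vol_mul_vol (hg : ∀ v, (∀ w, g v w = 0) → v = 0) (hc : DualPair g c c') {n : ℕ}
    (hn : Module.finrank ℂ V = n) (vol : V [⋀^Fin n]→ₗ[ℂ] ℂ)
    (hvol : ∀ v, vol v ^ 2 = (Matrix.of fun i j => g (v i) (v j)).det) :
    ∑ I : Fin n → ι, vol (fun i => c (I i)) * vol (fun i => c' (I i)) = n.factorial := by
  set e := Module.finBasisOfFinrankEq ℂ V hn with he
  have h1 := hc.sum_multilinear_eq (dualPair_dualFrame hg e) vol.toMultilinearMap
    vol.toMultilinearMap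
  simp only [AlternatingMap.coe_multilinearMap, smul_eq_mul] at h1
  rw [h1]
  have hdet := gram_det_ne_zero hg e
  have h2 : vol (dualFrame g e) * (Matrix.of fun i j => g (e i) (e j)).det = vol e := by
    have : vol (dualFrame g e) = vol e * ((Matrix.of fun i j => g (e i) (e j))⁻¹).det := by
      conv_lhs => rw [vol.eq_smul_basis_det e]
      rw [AlternatingMap.smul_apply, smul_eq_mul, Module.Basis.det_apply, ← Matrix.det_transpose]
      congr 2
      ext i j
      simp [Module.Basis.toMatrix_apply, dualFrame, Finsupp.single_apply]
    rw [this, mul_assoc, ← Matrix.det_mul, Matrix.nonsing_inv_mul _ (isUnit_iff_ne_zero.2 hdet)]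
    simp
  have h3 : vol e * vol (dualFrame g e) = 1 := by
    have h4 := hvol e
    have : vol e ≠ 0 := by
      intro h0
      rw [h0] at h4
      exact hdet (by rw [← h4]; simp)
    have h5 : vol e * (vol e * vol (dualFrame g e)) = vol e * 1 := by
      rw [mul_one]; conv_rhs => rw [← h2, ← h4]
      ring
    exact mul_left_cancel₀ this h5
  have h4 : ∑ I : Fin n → Fin n, vol (fun i => e (I i)) * vol (fun i => dualFrame g e (I i)) =
      ∑ σ : Equiv.Perm (Fin n), (1 : ℂ) := by
    symm
    refine Finset.sum_of_injOn (fun σ : Equiv.Perm (Fin n) => (σ : Fin n → Fin n))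
      (fun σ _ τ _ h => Equiv.coe_fn_injective h) (fun _ _ => by simp) ?_ ?_
    · intro I _ hI
      have : ¬ Function.Injective I := by
        intro hinj
        refine hI ⟨Equiv.ofBijective I ((Fintype.bijective_iff_injective_and_card I).2 ⟨hinj, rfl⟩),
          by simp, rfl⟩
      rw [Function.Injective] at this
      push Not at this
      obtain ⟨i, j, hij, hne⟩ := this
      rw [vol.map_eq_zero_of_eq (fun i => e (I i)) (congrArg e hij) hne, zero_mul]
    · intro σ _
      have p1 := vol.map_perm e σ
      have p2 := vol.map_perm (dualFrame g e) σ
      rw [Units.smul_def, ← Int.cast_smul_eq_zsmul ℂ, smul_eq_mul] at p1 p2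
      have hs : ((Equiv.Perm.sign σ : ℤ) : ℂ) * ((Equiv.Perm.sign σ : ℤ) : ℂ) = 1 := by
        rw [← Int.cast_mul, Int.units_coe_mul_self]; simp
      change 1 = vol (e ∘ σ) * vol (dualFrame g e ∘ σ)
      rw [p1, p2]
      linear_combination -hs * (vol e * vol (dualFrame g e)) - h3
  rw [h4]
  simp [Fintype.card_perm]

/-- From the full contraction `n!`, two uses of the adjointness `sum_mul_altSum` remove one vector
at a time from both volume forms; the factors `q + 4` and `q + 3` they produce are cancelled at the
end. -/
theorem sum_vol_two (hg : ∀ v, (∀ w, g v w = 0) → v = 0) (hc : DualPair g c c')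
    (hn : Module.finrank ℂ V = q + 4) (vol : V [⋀^Fin (q + 4)]→ₗ[ℂ] ℂ)
    (hvol : ∀ v, vol v ^ 2 = (Matrix.of fun i j => g (v i) (v j)).det) (x y u v : V) :
    ∑ J : Fin (q + 2) → ι,
      vol (Fin.cons x (Fin.cons y (fun i => c (J i)) : Fin (q + 3) → V) : Fin (q + 4) → V) *
      vol (Fin.cons u (Fin.cons v (fun i => c' (J i)) : Fin (q + 3) → V) : Fin (q + 4) → V) =
    ((q + 2).factorial : ℂ) * (g u x * g v y - g u y * g v x) := by
  have k0 : ∀ x u, (((q + 3 : ℕ) : ℂ) + 1) * ∑ J : Fin (q + 3) → ι,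
      vol (Fin.cons u (fun i => c' (J i)) : Fin (q + 4) → V) *
      vol (Fin.cons x (fun i => c (J i)) : Fin (q + 4) → V) = (q + 4).factorial * g u x := by
    intro x u
    rw [← sum_mul_altSum hc vol (fun w => vol (Fin.cons x w : Fin (q + 4) → V)) u]
    have := fun v => altSum_one (q := q + 3) hn vol (g u) x v
    simp only [smul_eq_mul] at this
    simp only [this, smul_eq_mul, ← sum_vol_mul_vol hg hc hn vol hvol, Finset.sum_mul]
    exact Finset.sum_congr rfl fun J _ => by ring
  have k1 := sum_mul_altSum hc (k := q + 2) (vol.curryLeft u)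
    (fun w => vol (Fin.cons x (Fin.cons y w : Fin (q + 3) → V) : Fin (q + 4) → V)) v
  have k2 := fun w => altSum_two (q := q + 2) hn vol (g v) x y w
  simp only [smul_eq_mul] at k1 k2
  simp only [k2, mul_sub, Finset.sum_sub_distrib, ← mul_assoc, ← Finset.sum_mul] at k1
  have k3 : ∀ w : Fin (q + 3) → V, vol.curryLeft u w = vol (Fin.cons u w : Fin (q + 4) → V) :=
    fun _ => rfl
  simp only [k3] at k1
  have k4 := k0 x u
  have k5 := k0 y u
  set K := ∑ J : Fin (q + 2) → ι,
      vol (Fin.cons u (Fin.cons v (fun i => c' (J i)) : Fin (q + 3) → V) : Fin (q + 4) → V) *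
      vol (Fin.cons x (Fin.cons y (fun i => c (J i)) : Fin (q + 3) → V) : Fin (q + 4) → V) with hK
  have h1 : ((q + 4).factorial : ℂ) = (q + 4) * ((q + 3) * (q + 2).factorial) := by
    rw [Nat.factorial_succ, Nat.factorial_succ]; push_cast; ring
  have n1 : (q + 4 : ℂ) ≠ 0 := by exact_mod_cast (Nat.succ_ne_zero (q + 3))
  have n2 : (q + 3 : ℂ) ≠ 0 := by exact_mod_cast (Nat.succ_ne_zero (q + 2))
  rw [h1] at k4 k5
  push_cast at k1 k4 k5
  have h2 : (q + 4 : ℂ) * ((q + 3) * K) = (q + 4) * ((q + 3) * (((q + 2).factorial : ℂ) *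
      (g u x * g v y - g u y * g v x))) := by
    linear_combination -(q + 4 : ℂ) * k1 + g v y * k4 - g v x * k5
  rw [← mul_left_cancel₀ n2 (mul_left_cancel₀ n1 h2), hK]
  exact Finset.sum_congr rfl fun J _ => mul_comm _ _

-- Two arguments pass the other `q + 2` by an even permutation for every `q`, which is why `∗∗`
-- carries no sign on 2-forms.
omit [FiniteDimensional ℂ V] in
theorem append_two_right (vol : V [⋀^Fin (q + 4)]→ₗ[ℂ] ℂ) (u : Fin (q + 2) → V) (w : Fin 2 → V) :
    vol (Fin.append u w : Fin (q + 2 + 2) → V) =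
      vol (Fin.cons (w 0) (Fin.cons (w 1) u : Fin (q + 3) → V) : Fin (q + 4) → V) := by
  have h := vol.map_perm (Fin.append u w : Fin (q + 2 + 2) → V) (rotateTwo (q + 2))
  rw [sign_rotateTwo, one_smul] at h
  rw [← h]
  congr 1
  funext k
  refine Fin.cases ?_ (fun k => Fin.cases ?_ (fun k => ?_) k) k
  · rw [Function.comp_apply, rotateTwo_zero, Fin.append_right]; rfl
  · rw [Function.comp_apply]
    exact (congrArg _ (rotateTwo_one (q + 2))).trans (by rw [Fin.append_right]; rfl)
  · rw [Function.comp_apply, rotateTwo_succ_succ, Fin.append_left]; rfl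

/-- `∗∗ = 1` on 2-forms in even dimension. -/
theorem hodgeStar_hodgeStar_two (hg : ∀ v, (∀ w, g v w = 0) → v = 0)
    (hs : ∀ v w, g v w = g w v) (hn : Module.finrank ℂ V = q + 4)
    (vol : V [⋀^Fin (q + 4)]→ₗ[ℂ] ℂ)
    (hvol : ∀ v, vol v ^ 2 = (Matrix.of fun i j => g (v i) (v j)).det)
    {B : V →ₗ[ℂ] V →ₗ[ℂ] A} (hB : ∀ x, B x x = 0) :
    hodgeStar g vol (q + 2) 2 (hodgeStar g vol 2 (q + 2) (twoForm B)) = twoForm B := by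
  funext w
  set b := Module.finBasis ℂ V
  have hd : DualPair g b (dualFrame g b) := dualPair_dualFrame hg b
  have hq : ((q + 2).factorial : ℂ) ≠ 0 := by exact_mod_cast (q + 2).factorial_ne_zero
  rw [hodgeStar, dif_pos rfl]
  simp only [hodgeStar_two]
  have h1 : ∀ I : Fin (q + 2) → Fin (Module.finrank ℂ V),
      vol (fun k => Fin.append (fun i => b (I i)) w (Fin.cast rfl k)) =
      vol (Fin.cons (w 0) (Fin.cons (w 1) (fun i => b (I i)) : Fin (q + 3) → V) :
        Fin (q + 4) → V) := fun I => append_two_right vol _ w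
  -- Summing over `I` first, `sum_vol_two` replaces the two volume forms by `(q + 2)!` times a
  -- determinant of values of `g`. The factorial cancels the one in `hodgeStar`, and the two terms
  -- of the determinant give the same value of `B`, absorbing `½`.
  have h2 : ∑ I : Fin (q + 2) → Fin (Module.finrank ℂ V),
      vol (fun k => Fin.append (fun i => b (I i)) w (Fin.cast rfl k)) • (2⁻¹ : ℂ) •
      ∑ i, ∑ j, vol (Fin.cons (b i) (Fin.cons (b j) (fun l => dualFrame g b (I l)) :
        Fin (q + 3) → V) : Fin (q + 4) → V) • twoForm B ![dualFrame g b i, dualFrame g b j] =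
      (2⁻¹ : ℂ) • ∑ i, ∑ j, (((q + 2).factorial : ℂ) *
        (g (b i) (w 0) * g (b j) (w 1) - g (b i) (w 1) * g (b j) (w 0))) •
          twoForm B ![dualFrame g b i, dualFrame g b j] := by
    simp only [h1, ← sum_vol_two hg hd hn vol hvol, Finset.sum_smul, Finset.smul_sum]
    rw [Finset.sum_comm]
    refine Finset.sum_congr rfl fun i _ => ?_
    rw [Finset.sum_comm]
    refine Finset.sum_congr rfl fun j _ => Finset.sum_congr rfl fun I _ => ?_
    rw [smul_comm, mul_smul]
  have h3 : ∀ x y, ∑ i, ∑ j, (g (b i) x * g (b j) y) •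
      twoForm B ![dualFrame g b i, dualFrame g b j] = B x y := by
    intro x y
    conv_rhs => rw [← hd.sum_left_symm hs x, ← hd.sum_left_symm hs y]
    simp only [map_sum, LinearMap.sum_apply, map_smul, LinearMap.smul_apply, Finset.smul_sum,
      smul_smul, twoForm]
    rw [Finset.sum_comm]
    exact Finset.sum_congr rfl fun i _ => Finset.sum_congr rfl fun j _ => by
      rw [mul_comm]; rfl
  refine (congrArg _ h2).trans ?_
  simp only [mul_smul ((q + 2).factorial : ℂ), sub_smul, ← Finset.smul_sum,
    Finset.sum_sub_distrib, h3]
  rw [smul_comm (2⁻¹ : ℂ), inv_smul_smul₀ hq, bilin_swap hB (w 1) (w 0), twoForm]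
  module

end HodgeSquare

/-! ### The eigenvalue of the contraction with the 4-form -/

section Eigen

variable {E F : Type*} [AddCommGroup E] [Module ℂ E] [AddCommGroup F] [Module ℂ F]
  {A : Type*} [AddCommGroup A] [Module ℂ A]

theorem sum_perm_four {V : Type*} (G : (Fin 4 → V) → A) (v : Fin 4 → V) :
    ∑ σ : Equiv.Perm (Fin 4), ((Equiv.Perm.sign σ : ℤ) : ℂ) • G (fun i => v (σ i)) =
      altSum (fun x => altSum fun y => altSum fun z => altSum fun t (_ : Fin 0 → V) =>
        G ![x, y, z, t]) v := by
  rw [sum_perm_succ]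
  congr 1; funext x w
  rw [sum_perm_succ fun u => G (Fin.cons x u)]
  congr 1; funext y w
  rw [sum_perm_succ fun u => G (Fin.cons x (Fin.cons y u : Fin 3 → V))]
  congr 1; funext z w
  rw [sum_perm_succ fun u => G (Fin.cons x (Fin.cons y (Fin.cons z u : Fin 2 → V) : Fin 3 → V))]
  congr 1; funext t w
  simp only [Finset.univ_unique, Finset.sum_singleton]
  simp
  congr 1
  funext i; fin_cases i <;> rfl

/-- Each of the 24 terms is a product of two distinct pairings of the four indices, one for `a` and
one for `b`. There are six such products, and each arises from four permutations with equal sign,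
because a term is invariant under the Klein four-group by skewness. Hence the factor 4. -/
theorem fourForm_tmul {a : E →ₗ[ℂ] E →ₗ[ℂ] ℂ} {b : F →ₗ[ℂ] F →ₗ[ℂ] ℂ} (ha : ∀ x, a x x = 0)
    (hb : ∀ y, b y y = 0) (e : Fin 4 → E) (f : Fin 4 → F) :
    fourForm a b (fun i => e i ⊗ₜ[ℂ] f i) =
      4 * (a (e 0) (e 1) * a (e 2) (e 3) *
          (b (f 0) (f 2) * b (f 1) (f 3) + b (f 0) (f 3) * b (f 1) (f 2)) -
        a (e 0) (e 2) * a (e 1) (e 3) *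
          (b (f 0) (f 1) * b (f 2) (f 3) - b (f 0) (f 3) * b (f 1) (f 2)) -
        a (e 0) (e 3) * a (e 1) (e 2) *
          (b (f 0) (f 1) * b (f 2) (f 3) + b (f 0) (f 2) * b (f 1) (f 3))) := by
  set G : (Fin 4 → Fin 4) → ℂ := fun I => a (e (I 0)) (e (I 1)) * a (e (I 2)) (e (I 3)) *
    b (f (I 0)) (f (I 2)) * b (f (I 1)) (f (I 3)) with hG
  have h1 : fourForm a b (fun i => e i ⊗ₜ[ℂ] f i) =
      ∑ σ : Equiv.Perm (Fin 4), ((Equiv.Perm.sign σ : ℤ) : ℂ) • G (fun i => id (σ i)) := by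
    rw [fourForm, MultilinearMap.alternatization_apply]
    refine Finset.sum_congr rfl fun σ _ => ?_
    rw [Units.smul_def, ← Int.cast_smul_eq_zsmul ℂ, MultilinearMap.domDomCongr_apply]
    congr 1
    exact fourTensor_tmul a b (fun i => e (σ i)) (fun i => f (σ i))
  rw [h1, sum_perm_four]
  simp [altSum, Fin.sum_univ_succ, Fin.removeNth]
  simp [hG, Fin.succAbove]
  rw [bilin_swap ha (e 1) (e 0), bilin_swap ha (e 2) (e 0), bilin_swap ha (e 3) (e 0),
    bilin_swap ha (e 2) (e 1), bilin_swap ha (e 3) (e 1), bilin_swap ha (e 3) (e 2),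
    bilin_swap hb (f 1) (f 0), bilin_swap hb (f 2) (f 0), bilin_swap hb (f 3) (f 0),
    bilin_swap hb (f 2) (f 1), bilin_swap hb (f 3) (f 1), bilin_swap hb (f 3) (f 2)]
  ring

theorem sum_sum_prod_smul {ι κ : Type*} [Fintype ι] [Fintype κ] (α : ι → ι → ℂ) (β : κ → κ → ℂ)
    (s : ι → ι → A) :
    ∑ k : ι × κ, ∑ l : ι × κ, (α k.1 l.1 * β k.2 l.2) • s k.1 l.1 =
      (∑ I, ∑ J, β I J) • ∑ i, ∑ j, α i j • s i j := by
  simp only [Fintype.sum_prod_type]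
  calc _ = ∑ i, ∑ I, ∑ j, ∑ J, β I J • α i j • s i j := by
        simp only [smul_smul, mul_comm]
    _ = ∑ i, ∑ j, ∑ I, ∑ J, β I J • α i j • s i j :=
        Finset.sum_congr rfl fun i _ => Finset.sum_comm
    _ = _ := by
        simp only [Finset.smul_sum, Finset.sum_smul]

/-- The terms with `a x y` pair the skew `a` with the symmetric `S` and vanish. In each of the other
two groups the sum over `E` returns `S x y`, and the sum over `F` returns `b p q` multiplied by the
trace `N` plus one. So the double sum is `-4 · 2(N + 1)` times the value of `B`, and the `½` in
`contraction` gives `-4(N + 1)`. -/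
theorem contraction_fourForm {ι κ : Type*} [Fintype ι] [Fintype κ]
    {a : E →ₗ[ℂ] E →ₗ[ℂ] ℂ} {b : F →ₗ[ℂ] F →ₗ[ℂ] ℂ} (ha : ∀ x, a x x = 0) (hb : ∀ y, b y y = 0)
    {e e' : ι → E} {f f' : κ → F} (he : DualPair a e e') (hf : DualPair b f f') {N : ℂ}
    (hN : ∑ I, b (f' I) (f I) = N) {S : E →ₗ[ℂ] E →ₗ[ℂ] A} (hS : ∀ x y, S x y = S y x)
    {B : (E ⊗[ℂ] F) →ₗ[ℂ] (E ⊗[ℂ] F) →ₗ[ℂ] A}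
    (hB : ∀ x x' y y', B (x ⊗ₜ[ℂ] y) (x' ⊗ₜ[ℂ] y') = b y y' • S x x') :
    contraction (fun k : ι × κ => e k.1 ⊗ₜ[ℂ] f k.2) (fun k => e' k.1 ⊗ₜ[ℂ] f' k.2)
      (fourForm a b) (twoForm B) = (-4 * (N + 1)) • twoForm B := by
  -- `DualPair` expands with the dual vector on the left; with the arguments exchanged, skewness
  -- costs a sign. These signs occur in pairs in `hE2` and `hF2`.
  have ha1 : ∀ x, ∑ i, a x (e' i) • e i = -x := fun x => by
    rw [← neg_eq_iff_eq_neg, ← Finset.sum_neg_distrib]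
    simpa only [← neg_smul, ← bilin_swap ha] using he.sum_left x
  have hb1 : ∀ y, ∑ I, b y (f' I) • f I = -y := fun y => by
    rw [← neg_eq_iff_eq_neg, ← Finset.sum_neg_distrib]
    simpa only [← neg_smul, ← bilin_swap hb] using hf.sum_left y
  -- Exchanging `i` and `j` changes the sign of `a` and leaves `S` fixed.
  have hE1 : ∑ i, ∑ j, a (e' i) (e' j) • S (e i) (e j) = 0 := by
    have : ∑ i, ∑ j, a (e' i) (e' j) • S (e i) (e j) =
        -∑ i, ∑ j, a (e' i) (e' j) • S (e i) (e j) := by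
      conv_lhs => rw [Finset.sum_comm]
      simp only [← Finset.sum_neg_distrib]
      refine Finset.sum_congr rfl fun i _ => Finset.sum_congr rfl fun j _ => ?_
      rw [bilin_swap ha, hS, neg_smul]
    rw [eq_neg_iff_add_eq_zero, ← two_smul ℂ] at this
    exact (smul_eq_zero.1 this).resolve_left two_ne_zero
  have hE2 : ∀ x y, ∑ i, ∑ j, (a x (e' i) * a y (e' j)) • S (e i) (e j) = S x y := fun x y => by
    have : S (∑ i, a x (e' i) • e i) (∑ j, a y (e' j) • e j) = S x y := by
      rw [ha1, ha1]; simp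
    rw [← this]
    simp only [map_sum, LinearMap.sum_apply, map_smul, LinearMap.smul_apply, smul_smul,
      Finset.smul_sum]
    rw [Finset.sum_comm]
    simp only [mul_comm]
  have hE3 : ∀ x y, ∑ i, ∑ j, (a x (e' j) * a y (e' i)) • S (e i) (e j) = S x y := fun x y => by
    rw [hS x y, ← hE2 y x]
    simp only [mul_comm]
  have hF2 : ∀ p q, ∑ I, ∑ J, (b p (f' I) * b q (f' J)) * b (f I) (f J) = b p q := fun p q => by
    have : b (∑ i, b p (f' i) • f i) (∑ j, b q (f' j) • f j) = b p q := by
      rw [hb1, hb1]; simp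
    rw [← this]
    simp only [map_sum, LinearMap.sum_apply, map_smul, LinearMap.smul_apply, smul_eq_mul,
      Finset.mul_sum]
    rw [Finset.sum_comm]
    simp only [mul_assoc, mul_left_comm]
  have hF3 : ∀ p q, ∑ I, ∑ J, (b p (f' J) * b q (f' I)) * b (f I) (f J) = -b p q := fun p q => by
    rw [bilin_swap hb p q, neg_neg, ← hF2 q p]
    simp only [mul_comm]
  -- Summing over `J` leaves the trace, which is the only place where the dimension of `F` enters.
  have hF1 : ∑ I, ∑ J, b (f' I) (f' J) * b (f I) (f J) = N := by
    rw [← hN]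
    refine Finset.sum_congr rfl fun I _ => ?_
    have : b (f I) (∑ J, b (f' I) (f' J) • f J) = b (f' I) (f I) := by
      rw [hb1, map_neg, ← bilin_swap hb]
    simpa using this
  have key : ∀ x y p q, ∑ k : ι × κ, ∑ l : ι × κ,
      fourForm a b ![x ⊗ₜ[ℂ] p, y ⊗ₜ[ℂ] q, e' k.1 ⊗ₜ[ℂ] f' k.2, e' l.1 ⊗ₜ[ℂ] f' l.2] •
        B (e k.1 ⊗ₜ[ℂ] f k.2) (e l.1 ⊗ₜ[ℂ] f l.2) = (-8 * (N + 1) * b p q) • S x y := by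
    intro x y p q
    have h4 : ∀ i j I J, fourForm a b ![x ⊗ₜ[ℂ] p, y ⊗ₜ[ℂ] q, e' i ⊗ₜ[ℂ] f' I, e' j ⊗ₜ[ℂ] f' J] =
        4 * (a x y * a (e' i) (e' j) *
          (b p (f' I) * b q (f' J) + b p (f' J) * b q (f' I)) -
        a x (e' i) * a y (e' j) *
          (b p q * b (f' I) (f' J) - b p (f' J) * b q (f' I)) -
        a x (e' j) * a y (e' i) *
          (b p q * b (f' I) (f' J) + b p (f' I) * b q (f' J))) := by
      intro i j I J
      have := fourForm_tmul ha hb ![x, y, e' i, e' j] ![p, q, f' I, f' J]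
      simp only [Matrix.cons_val] at this
      rw [← this]
      congr 1
      funext t; fin_cases t <;> rfl
    have h5 : ∀ k l : ι × κ,
        fourForm a b ![x ⊗ₜ[ℂ] p, y ⊗ₜ[ℂ] q, e' k.1 ⊗ₜ[ℂ] f' k.2, e' l.1 ⊗ₜ[ℂ] f' l.2] •
        B (e k.1 ⊗ₜ[ℂ] f k.2) (e l.1 ⊗ₜ[ℂ] f l.2) =
        (a (e' k.1) (e' l.1) * (4 * a x y * (b p (f' k.2) * b q (f' l.2) +
            b p (f' l.2) * b q (f' k.2)) * b (f k.2) (f l.2))) • S (e k.1) (e l.1) +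
        ((a x (e' k.1) * a y (e' l.1)) * (-4 * (b p q * (b (f' k.2) (f' l.2) * b (f k.2) (f l.2)) -
          b p (f' l.2) * b q (f' k.2) * b (f k.2) (f l.2)))) • S (e k.1) (e l.1) +
        ((a x (e' l.1) * a y (e' k.1)) * (-4 * (b p q * (b (f' k.2) (f' l.2) * b (f k.2) (f l.2)) +
          b p (f' k.2) * b q (f' l.2) * b (f k.2) (f l.2)))) • S (e k.1) (e l.1) := by
      intro k l
      rw [h4, hB, smul_smul, ← add_smul, ← add_smul]
      congr 1
      ring
    simp only [h5, Finset.sum_add_distrib]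
    rw [sum_sum_prod_smul (fun i j => a (e' i) (e' j))
        (fun I J => 4 * a x y * (b p (f' I) * b q (f' J) + b p (f' J) * b q (f' I)) *
          b (f I) (f J)) (fun i j => S (e i) (e j)),
      sum_sum_prod_smul (fun i j => a x (e' i) * a y (e' j))
        (fun I J => -4 * (b p q * (b (f' I) (f' J) * b (f I) (f J)) -
          b p (f' J) * b q (f' I) * b (f I) (f J))) (fun i j => S (e i) (e j)),
      sum_sum_prod_smul (fun i j => a x (e' j) * a y (e' i))
        (fun I J => -4 * (b p q * (b (f' I) (f' J) * b (f I) (f J)) +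
          b p (f' I) * b q (f' J) * b (f I) (f J))) (fun i j => S (e i) (e j)),
      hE1, hE2, hE3, smul_zero, zero_add, ← add_smul]
    congr 1
    simp only [← Finset.mul_sum, Finset.sum_sub_distrib, Finset.sum_add_distrib, hF1, hF2, hF3]
    ring
  have hcurry : ∀ X Y c d, fourForm a b ![X, Y, c, d] =
      ((fourForm a b).curryLeft X).curryLeft Y ![c, d] := fun _ _ _ _ => rfl
  funext w
  have main : ∀ X Y, ∑ k : ι × κ, ∑ l : ι × κ,
      fourForm a b ![X, Y, e' k.1 ⊗ₜ[ℂ] f' k.2, e' l.1 ⊗ₜ[ℂ] f' l.2] •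
        B (e k.1 ⊗ₜ[ℂ] f k.2) (e l.1 ⊗ₜ[ℂ] f l.2) = (-8 * (N + 1)) • B X Y := by
    intro X Y
    induction X using TensorProduct.induction_on with
    | zero => simp [hcurry]
    | add X X' h h' =>
      simp only [hcurry] at h h' ⊢
      simp only [map_add, AlternatingMap.curryLeft_add, AlternatingMap.add_apply,
        LinearMap.add_apply, add_smul, Finset.sum_add_distrib, h, h', smul_add]
    | tmul x p =>
      induction Y using TensorProduct.induction_on with
      | zero => simp [hcurry]
      | add Y Y' h h' =>
        simp only [hcurry] at h h' ⊢
        simp only [map_add, AlternatingMap.add_apply,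
          add_smul, Finset.sum_add_distrib, h, h', smul_add]
      | tmul y q => rw [key, hB, smul_smul]
  rw [contraction, Pi.smul_apply]
  refine (congrArg _ (main (w 0) (w 1))).trans ?_
  rw [smul_smul]
  congr 1
  ring

end Eigen

/-! ### Symmetric powers of a symplectic plane -/

section SymplecticPlane

variable {m : ℕ} {H : Type*} [AddCommGroup H] [Module ℂ H]

/-- Each of the `m` factors changes sign. For odd `m` the form is therefore skew, and its tensor
product with `ω_E` is symmetric. -/
theorem powForm_swap {b : H →ₗ[ℂ] H →ₗ[ℂ] ℂ} (hb : ∀ x, b x x = 0) (s s' : Sym[ℂ]^m H) :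
    powForm m b s s' = (-1) ^ m * powForm m b s' s := by
  have : powForm m b = (-1 : ℂ) ^ m • (powForm m b).flip :=
    sym_hom_ext fun h => sym_hom_ext fun h' => by
      rw [LinearMap.smul_apply, LinearMap.smul_apply, LinearMap.flip_apply, powForm_symProd,
        powForm_symProd, smul_eq_mul, Finset.mul_sum, Finset.sum_comm]
      refine Finset.sum_congr rfl fun σ _ => ?_
      rw [Finset.mul_sum]
      refine Finset.sum_congr rfl fun τ _ => ?_
      simp_rw [bilin_swap hb (h _) (h' _)]
      rw [Finset.prod_neg]
      simp
  exact LinearMap.congr_fun (LinearMap.congr_fun this s) s'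

theorem powForm_self (hm : Odd m) {b : H →ₗ[ℂ] H →ₗ[ℂ] ℂ} (hb : ∀ x, b x x = 0)
    (s : Sym[ℂ]^m H) : powForm m b s s = 0 := by
  have := powForm_swap hb s s
  rw [hm.neg_one_pow, neg_one_mul] at this
  exact self_eq_neg.1 this

theorem symMap_symProd (B : H →ₗ[ℂ] H) (h : Fin m → H) :
    symMap B (symProd h) = symProd fun i => B (h i) :=
  symLift_symProd _ _ h

theorem powForm_symMap {b : H →ₗ[ℂ] H →ₗ[ℂ] ℂ} {B : H →ₗ[ℂ] H}
    (hB : ∀ h h', b (B h) (B h') = b h h') (s s' : Sym[ℂ]^m H) :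
    powForm m b (symMap B s) (symMap B s') = powForm m b s s' := by
  have : (powForm m b).compl₁₂ (symMap B) (symMap B) = powForm m b :=
    sym_hom_ext fun h => sym_hom_ext fun h' => by
      rw [LinearMap.compl₁₂_apply, symMap_symProd, symMap_symProd, powForm_symProd,
        powForm_symProd]
      simp only [hB]
  exact LinearMap.congr_fun (LinearMap.congr_fun this s) s'

/-- The product `y ⋯ y x ⋯ x` of `m` factors, the first `k` of which are `y`. -/
def symMonomial (x y : H) (k : Fin (m + 1)) : Sym[ℂ]^m H :=
  symProd fun i : Fin m => if (i : ℕ) < k then y else x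

/-- A product of vectors expands into products of basis vectors, and each of these depends only on
the number `k` of its factors equal to `b 1`. -/
theorem span_symMonomial (b : Module.Basis (Fin 2) ℂ H) :
    Submodule.span ℂ (Set.range (symMonomial (m := m) (b 0) (b 1))) = ⊤ := by
  classical
  rw [eq_top_iff, ← SymmetricPower.span_tprod_eq_top ℂ (Fin m) H, Submodule.span_le]
  rintro _ ⟨h, rfl⟩
  have h1 : h = fun i => ∑ j, b.repr (h i) j • b j := funext fun i => (b.sum_repr (h i)).symm
  rw [h1, SetLike.mem_coe]
  rw [MultilinearMap.map_sum]
  refine Submodule.sum_mem _ fun r _ => ?_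
  rw [MultilinearMap.map_smul_univ]
  refine Submodule.smul_mem _ _ (Submodule.subset_span ?_)
  set k := Fintype.card {i // r i = 1} with hk
  have hkm : k ≤ m := by simpa using Fintype.card_subtype_le fun i => r i = 1
  have hcard : Fintype.card {i : Fin m // (i : ℕ) < k} = Fintype.card {i // r i = 1} := by
    rw [Fintype.card_subtype, Fin.card_filter_val_lt, min_eq_right hkm]
  -- A permutation of the places which carries the first `k` to those where `r` is `1`.
  let e := (Fintype.equivOfCardEq hcard).extendSubtype
  refine ⟨⟨k, by omega⟩, ?_⟩
  rw [symMonomial]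
  refine Eq.trans ?_ (symProd_perm e fun i => b (r i))
  congr 1
  funext i
  split_ifs with hi
  · rw [(Fintype.equivOfCardEq hcard).extendSubtype_mem i hi]
  · have := (Fintype.equivOfCardEq hcard).extendSubtype_not_mem i hi
    congr 1
    change ¬ r (e i) = 1 at this
    omega

/-- A nonzero product must pair every `y` on the left with an `x` on the right and conversely, so
the `k` factors `y` match the `m - l` factors `x`. -/
theorem powForm_symMonomial_eq_zero {b : H →ₗ[ℂ] H →ₗ[ℂ] ℂ} (hb : ∀ x, b x x = 0) (x y : H)
    {k l : Fin (m + 1)} (hkl : (k : ℕ) + l ≠ m) :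
    powForm m b (symMonomial x y k) (symMonomial x y l) = 0 := by
  rw [symMonomial, symMonomial, powForm_symProd]
  refine Finset.sum_eq_zero fun σ _ => Finset.sum_eq_zero fun τ _ => ?_
  by_contra hne
  refine hkl ?_
  have hall : ∀ i, (σ i : ℕ) < k ↔ ¬ (τ i : ℕ) < l := by
    intro i
    have := Finset.prod_ne_zero_iff.1 hne i (Finset.mem_univ i)
    by_cases h1 : (σ i : ℕ) < k <;> by_cases h2 : (τ i : ℕ) < l <;> simp_all
  have h1 : Fintype.card {i : Fin m // (σ i : ℕ) < k} = k := by
    rw [Fintype.card_congr (σ.subtypeEquiv (q := fun i : Fin m => (i : ℕ) < k) fun i => Iff.rfl),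
      Fintype.card_subtype, Fin.card_filter_val_lt]
    omega
  have h2 : Fintype.card {i : Fin m // (τ i : ℕ) < l} = l := by
    rw [Fintype.card_congr (τ.subtypeEquiv (q := fun i : Fin m => (i : ℕ) < l) fun i => Iff.rfl),
      Fintype.card_subtype, Fin.card_filter_val_lt]
    omega
  have h3 := Fintype.card_subtype_compl fun i : Fin m => (τ i : ℕ) < l
  rw [← Fintype.card_congr (Equiv.subtypeEquivRight hall), h1, h2, Fintype.card_fin] at h3
  omega

/-- No cancellation is possible: a nonzero term has `k` factors `b y x` and `m - k` factors `b x y`,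
hence equals `d`. The value is `d` times the number of such terms. -/
theorem powForm_symMonomial_ne_zero {b : H →ₗ[ℂ] H →ₗ[ℂ] ℂ} (hb : ∀ x, b x x = 0) {x y : H}
    (hxy : b x y ≠ 0) {k l : Fin (m + 1)} (hkl : (k : ℕ) + l = m) :
    powForm m b (symMonomial x y k) (symMonomial x y l) ≠ 0 := by
  classical
  set d : ℂ := ∏ i : Fin m, if (i : ℕ) < k then b y x else b x y with hd
  have hd0 : d ≠ 0 := by
    refine Finset.prod_ne_zero_iff.2 fun i _ => ?_
    split_ifs
    · rw [bilin_swap hb]; exact neg_ne_zero.2 hxy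
    · exact hxy
  have hterm : ∀ σ τ : Equiv.Perm (Fin m),
      ∏ i, b (if (σ i : ℕ) < k then y else x) (if (τ i : ℕ) < l then y else x) =
        if ∀ i, ((σ i : ℕ) < k ↔ ¬ (τ i : ℕ) < l) then d else 0 := by
    intro σ τ
    split_ifs with h
    · rw [hd, ← Equiv.prod_comp σ fun i : Fin m => if (i : ℕ) < k then b y x else b x y]
      refine Finset.prod_congr rfl fun i _ => ?_
      by_cases h1 : (σ i : ℕ) < k
      · simp [h1, (h i).1 h1]
      · have : (τ i : ℕ) < l := by by_contra h2; exact h1 ((h i).2 h2)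
        simp [h1, this]
    · push Not at h
      obtain ⟨i, hi⟩ := h
      refine Finset.prod_eq_zero (Finset.mem_univ i) ?_
      rcases hi with ⟨h1, h2⟩ | ⟨h1, h2⟩
      · simp [h1, h2, hb]
      · simp [not_lt.2 h1, not_lt.2 h2, hb]
  rw [symMonomial, symMonomial, powForm_symProd]
  simp only [hterm]
  rw [← Fintype.sum_prod_type' fun σ τ : Equiv.Perm (Fin m) =>
    if ∀ i, ((σ i : ℕ) < k ↔ ¬ (τ i : ℕ) < l) then d else 0, ← Finset.sum_filter,
    Finset.sum_const, nsmul_eq_mul]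
  -- The identity and the reversal give such a term: as `k + l = m`, `i < k` holds exactly when the
  -- reversed index is at least `l`.
  refine mul_ne_zero (Nat.cast_ne_zero.2 (Finset.card_ne_zero_of_mem (a := (1, Fin.revPerm)) ?_)) hd0
  simp only [Finset.mem_filter, Finset.mem_univ, true_and]
  intro i
  simp [Fin.val_rev]
  omega

/-- The Gram matrix of the monomials is antidiagonal, so pairing with the monomial of index `k.rev`
isolates `c k`. This yields both linear independence of the monomials and nondegeneracy of the form.
-/
theorem powForm_sum_symMonomial {b : H →ₗ[ℂ] H →ₗ[ℂ] ℂ} (hb : ∀ x, b x x = 0) {x y : H}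
    (hxy : b x y ≠ 0) (c : Fin (m + 1) → ℂ)
    (hc : ∀ s, powForm m b (∑ k, c k • symMonomial x y k) s = 0) : c = 0 := by
  funext k
  have := hc (symMonomial x y k.rev)
  rw [map_sum, LinearMap.sum_apply, Finset.sum_eq_single k] at this
  · rw [map_smul, LinearMap.smul_apply, smul_eq_mul] at this
    exact (mul_eq_zero.1 this).resolve_right
      (powForm_symMonomial_ne_zero hb hxy (by rw [Fin.val_rev]; omega))
  · intro l _ hl
    rw [map_smul, LinearMap.smul_apply, powForm_symMonomial_eq_zero hb, smul_zero]
    rw [Fin.val_rev]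
    intro h
    exact hl (Fin.ext (by omega))
  · simp

theorem apply_ne_zero_of_basis {b : H →ₗ[ℂ] H →ₗ[ℂ] ℂ} (hb : ∀ x, b x x = 0)
    (hn : ∀ v, (∀ w, b v w = 0) → v = 0) (B : Module.Basis (Fin 2) ℂ H) : b (B 0) (B 1) ≠ 0 := by
  intro h
  refine B.ne_zero 0 (hn _ fun w => ?_)
  rw [← B.sum_repr w, Fin.sum_univ_two, map_add, map_smul, map_smul, hb, h]
  simp

theorem exists_basis_symMonomial {b : H →ₗ[ℂ] H →ₗ[ℂ] ℂ} (hb : ∀ x, b x x = 0)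
    (hn : ∀ v, (∀ w, b v w = 0) → v = 0) (B : Module.Basis (Fin 2) ℂ H) :
    ∃ C : Module.Basis (Fin (m + 1)) ℂ (Sym[ℂ]^m H), ∀ k, C k = symMonomial (B 0) (B 1) k := by
  have hxy := apply_ne_zero_of_basis hb hn B
  refine ⟨Module.Basis.mk (v := symMonomial (B 0) (B 1)) ?_ (span_symMonomial B).ge,
    fun k => Module.Basis.mk_apply _ _ k⟩
  refine Fintype.linearIndependent_iff.2 fun c hc => congrFun ?_
  exact powForm_sum_symMonomial hb hxy c fun s => by rw [hc]; simp

theorem powForm_nondegenerate {b : H →ₗ[ℂ] H →ₗ[ℂ] ℂ} (hb : ∀ x, b x x = 0)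
    (hn : ∀ v, (∀ w, b v w = 0) → v = 0) (B : Module.Basis (Fin 2) ℂ H) (s : Sym[ℂ]^m H)
    (hs : ∀ s', powForm m b s s' = 0) : s = 0 := by
  obtain ⟨C, hC⟩ := exists_basis_symMonomial (m := m) hb hn B
  rw [← C.sum_repr s] at hs ⊢
  simp only [hC] at hs ⊢
  have := powForm_sum_symMonomial hb (apply_ne_zero_of_basis hb hn B) _ hs
  simp [this]

end SymplecticPlane

/-! ### Invariance of the forms -/

section Invariance

variable {E F : Type*} [AddCommGroup E] [Module ℂ E] [AddCommGroup F] [Module ℂ F]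

theorem tmul_map {a : E →ₗ[ℂ] E →ₗ[ℂ] ℂ} {b : F →ₗ[ℂ] F →ₗ[ℂ] ℂ} {A : E →ₗ[ℂ] E} {C : F →ₗ[ℂ] F}
    (hA : ∀ e e', a (A e) (A e') = a e e') (hC : ∀ f f', b (C f) (C f') = b f f')
    (u v : E ⊗[ℂ] F) :
    LinearMap.BilinForm.tmul a b (TensorProduct.map A C u) (TensorProduct.map A C v) =
      LinearMap.BilinForm.tmul a b u v := by
  have : LinearMap.compl₁₂ (LinearMap.BilinForm.tmul a b) (TensorProduct.map A C)
      (TensorProduct.map A C) = LinearMap.BilinForm.tmul a b := by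
    refine TensorProduct.ext' fun x y => TensorProduct.ext' fun x' y' => ?_
    simp only [LinearMap.compl₁₂_apply, TensorProduct.map_tmul, tmul_apply_tmul, hA, hC]
  exact LinearMap.congr_fun (LinearMap.congr_fun this u) v

theorem contractFirst_map {a : E →ₗ[ℂ] E →ₗ[ℂ] ℂ} {A : E →ₗ[ℂ] E} (C : F →ₗ[ℂ] F)
    (hA : ∀ e e', a (A e) (A e') = a e e') (u v : E ⊗[ℂ] F) :
    contractFirst a (TensorProduct.map A C u) (TensorProduct.map A C v) =
      TensorProduct.map C C (contractFirst a u v) := by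
  have : LinearMap.compl₁₂ (contractFirst (F := F) a) (TensorProduct.map A C)
      (TensorProduct.map A C) = (contractFirst a).compr₂ (TensorProduct.map C C) := by
    refine TensorProduct.ext' fun x y => TensorProduct.ext' fun x' y' => ?_
    simp only [LinearMap.compl₁₂_apply, TensorProduct.map_tmul, contractFirst_tmul, hA,
      LinearMap.compr₂_apply, map_smul]
  exact LinearMap.congr_fun (LinearMap.congr_fun this u) v

theorem fourForm_map {a : E →ₗ[ℂ] E →ₗ[ℂ] ℂ} {b : F →ₗ[ℂ] F →ₗ[ℂ] ℂ} {A : E →ₗ[ℂ] E}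
    {C : F →ₗ[ℂ] F} (hA : ∀ e e', a (A e) (A e') = a e e') (hC : ∀ f f', b (C f) (C f') = b f f') :
    (fourForm a b).compLinearMap (TensorProduct.map A C) = fourForm a b := by
  ext v
  simp only [fourForm, AlternatingMap.compLinearMap_apply, MultilinearMap.alternatization_apply]
  refine Finset.sum_congr rfl fun σ _ => ?_
  congr 1
  simp only [MultilinearMap.domDomCongr_apply, fourTensor, MultilinearMap.mk'_apply,
    contractFirst_map C hA, tmul_map hC hC]

end Invariance

/-! ### The metric and the 4-form of a tensor product structure -/

section TensorStructure

variable {V E F : Type*} [AddCommGroup V] [Module ℂ V] [AddCommGroup E] [Module ℂ E]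
  [AddCommGroup F] [Module ℂ F] {A : Type*} [AddCommGroup A] [Module ℂ A]
  {ι κ : Type*} [Fintype ι] [Fintype κ]

theorem DualPair.flip {g : V →ₗ[ℂ] V →ₗ[ℂ] ℂ} {c c' : ι → V} (h : DualPair g c c') :
    DualPair g.flip c' c :=
  ⟨fun v => by simpa using h.sum_right v, fun v => by simpa using h.sum_left v⟩

/-- The form `twoForm B` as a multilinear map. -/
def twoFormMultilinear (B : V →ₗ[ℂ] V →ₗ[ℂ] A) : MultilinearMap ℂ (fun _ : Fin 2 => V) A :=
  MultilinearMap.mk' (twoForm B) (fun v i x y => by fin_cases i <;> simp [twoForm])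
    (fun v i c x => by fin_cases i <;> simp [twoForm])

/-- The dual pairs are flipped because in `contraction` the family `c'` enters the scalar form and
`c` enters `B`. -/
theorem contraction_eq {g : V →ₗ[ℂ] V →ₗ[ℂ] ℂ} {c c' : ι → V} {d d' : κ → V}
    (hc : DualPair g c c') (hd : DualPair g d d') (Ω : V [⋀^Fin 4]→ₗ[ℂ] ℂ)
    (B : V →ₗ[ℂ] V →ₗ[ℂ] A) :
    contraction c c' Ω (twoForm B) = contraction d d' Ω (twoForm B) := by
  funext w
  have := hc.flip.sum_multilinear_eq hd.flip
    ((Ω.curryLeft (w 0)).curryLeft (w 1)).toMultilinearMap (twoFormMultilinear B)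
  simp only [sum_pi_succ] at this
  simp only [Finset.univ_unique, Finset.sum_singleton] at this
  rw [contraction, contraction]
  congr 1
  convert this using 5
  all_goals first | rfl | exact congrArg Ω (by funext t; fin_cases t <;> rfl)

theorem contraction_map {c c' : ι → V} {W : Type*} [AddCommGroup W] [Module ℂ W]
    (φ : V ≃ₗ[ℂ] W) (Ω : V [⋀^Fin 4]→ₗ[ℂ] ℂ) (B : W →ₗ[ℂ] W →ₗ[ℂ] A) (w : Fin 2 → W) :
    contraction (fun i => φ (c i)) (fun i => φ (c' i)) (Ω.compLinearMap φ.symm.toLinearMap)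
      (twoForm B) w = contraction c c' Ω
        (twoForm (B.compl₁₂ φ.toLinearMap φ.toLinearMap)) (fun i => φ.symm (w i)) := by
  rw [contraction, contraction]
  congr 1
  refine Finset.sum_congr rfl fun k _ => Finset.sum_congr rfl fun l _ => ?_
  congr 1
  rw [AlternatingMap.compLinearMap_apply]
  congr 1
  funext i; fin_cases i <;> simp

/-- The trace of the identity: this is the `N` of `contraction_fourForm`. -/
theorem sum_dualFrame_self [DecidableEq κ] {b : F →ₗ[ℂ] F →ₗ[ℂ] ℂ}
    (hb : ∀ v, (∀ w, b v w = 0) → v = 0) (f : Module.Basis κ ℂ F) :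
    ∑ I, b (dualFrame b f I) (f I) = Fintype.card κ := by
  rw [Finset.sum_congr rfl fun I _ => (?_ : b (dualFrame b f I) (f I) = 1)]
  · simp
  · have := congrArg (fun v => f.repr v I) ((dualPair_dualFrame hb f).sum_left (f I))
    simpa [Finsupp.single_apply] using this

variable {a : E →ₗ[ℂ] E →ₗ[ℂ] ℂ} {b : F →ₗ[ℂ] F →ₗ[ℂ] ℂ} {g : V →ₗ[ℂ] V →ₗ[ℂ] ℂ}
  {ρ : Type*} [Fintype ρ] {c c' : ρ → V}

theorem dualPair_tensor [DecidableEq ι] [DecidableEq κ]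
    (hna : ∀ v, (∀ w, a v w = 0) → v = 0) (hnb : ∀ v, (∀ w, b v w = 0) → v = 0)
    (e : Module.Basis ι ℂ E) (f : Module.Basis κ ℂ F) (φ : (E ⊗[ℂ] F) ≃ₗ[ℂ] V) :
    DualPair ((LinearMap.BilinForm.tmul a b).compl₁₂ φ.symm.toLinearMap φ.symm.toLinearMap)
      (fun k : ι × κ => φ (e k.1 ⊗ₜ[ℂ] f k.2))
      (fun k : ι × κ => φ (dualFrame a e k.1 ⊗ₜ[ℂ] dualFrame b f k.2)) :=
  ((dualPair_dualFrame hna e).tmul (dualPair_dualFrame hnb f)).map φ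

theorem contraction_tensor (ha : ∀ x, a x x = 0) (hb : ∀ y, b y y = 0)
    (hna : ∀ v, (∀ w, a v w = 0) → v = 0) (hnb : ∀ v, (∀ w, b v w = 0) → v = 0)
    (e : Module.Basis ι ℂ E) (f : Module.Basis κ ℂ F) (φ : (E ⊗[ℂ] F) ≃ₗ[ℂ] V)
    (hc : DualPair ((LinearMap.BilinForm.tmul a b).compl₁₂ φ.symm.toLinearMap φ.symm.toLinearMap)
      c c') {S : E →ₗ[ℂ] E →ₗ[ℂ] A} (hS : ∀ x y, S x y = S y x) {B : V →ₗ[ℂ] V →ₗ[ℂ] A}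
    (hB : ∀ x x' y y', B (φ (x ⊗ₜ[ℂ] y)) (φ (x' ⊗ₜ[ℂ] y')) = b y y' • S x x') :
    contraction c c' ((fourForm a b).compLinearMap φ.symm.toLinearMap) (twoForm B) =
      (-4 * ((Fintype.card κ : ℂ) + 1)) • twoForm B := by
  classical
  rw [contraction_eq hc (dualPair_tensor hna hnb e f φ)]
  funext w
  rw [contraction_map, contraction_fourForm ha hb (dualPair_dualFrame hna e)
    (dualPair_dualFrame hnb f) (sum_dualFrame_self hnb f) hS
    (fun x x' y y' => by simpa using hB x x' y y')]
  simp [twoForm]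

end TensorStructure

/-! ### Holomorphic functions, sections and frames -/

section Holomorphic

set_option linter.unusedSectionVars false

variable {EM : Type*} [NormedAddCommGroup EM] [NormedSpace ℂ EM]
  {M : Type*} [TopologicalSpace M] [ChartedSpace EM M]

namespace IsHolFun

variable {U U' : Set M} {f f' : M → ℂ} {ι : Type*}

theorem mono (hf : IsHolFun (EM := EM) U f) (h : U' ⊆ U) : IsHolFun (EM := EM) U' f :=
  ContMDiffOn.mono hf h

theorem congr (hf : IsHolFun (EM := EM) U f) (h : ∀ x ∈ U, f' x = f x) :
    IsHolFun (EM := EM) U f' :=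
  ContMDiffOn.congr hf h

theorem of_locally (h : ∀ x ∈ U, ∃ W, IsOpen W ∧ x ∈ W ∧ IsHolFun (EM := EM) W f) :
    IsHolFun (EM := EM) U f := fun x hx => by
  obtain ⟨W, hW, hxW, hf⟩ := h x hx
  exact (hf.contMDiffAt (hW.mem_nhds hxW)).contMDiffWithinAt

theorem const (c : ℂ) : IsHolFun (EM := EM) U fun _ => c :=
  contMDiffOn_const

theorem add (hf : IsHolFun (EM := EM) U f) (hf' : IsHolFun (EM := EM) U f') :
    IsHolFun (EM := EM) U fun x => f x + f' x :=
  ContMDiffOn.add hf hf'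

theorem mul (hf : IsHolFun (EM := EM) U f) (hf' : IsHolFun (EM := EM) U f') :
    IsHolFun (EM := EM) U fun x => f x * f' x :=
  ContMDiffOn.smul hf hf'

theorem neg (hf : IsHolFun (EM := EM) U f) : IsHolFun (EM := EM) U fun x => -f x := by
  simpa using (const (EM := EM) (U := U) (-1)).mul hf

theorem sub (hf : IsHolFun (EM := EM) U f) (hf' : IsHolFun (EM := EM) U f') :
    IsHolFun (EM := EM) U fun x => f x - f' x := by
  simpa [sub_eq_add_neg] using hf.add hf'.neg

theorem sum {s : Finset ι} {f : ι → M → ℂ} (hf : ∀ i ∈ s, IsHolFun (EM := EM) U (f i)) :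
    IsHolFun (EM := EM) U fun x => ∑ i ∈ s, f i x := by
  classical
  induction s using Finset.induction_on with
  | empty => simpa using const 0
  | insert i s hi ih =>
    simp only [Finset.sum_insert hi]
    exact (hf i (Finset.mem_insert_self i s)).add
      (ih fun j hj => hf j (Finset.mem_insert_of_mem hj))

theorem prod {s : Finset ι} {f : ι → M → ℂ} (hf : ∀ i ∈ s, IsHolFun (EM := EM) U (f i)) :
    IsHolFun (EM := EM) U fun x => ∏ i ∈ s, f i x := by
  classical
  induction s using Finset.induction_on with
  | empty => simpa using const 1
  | insert i s hi ih =>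
    simp only [Finset.prod_insert hi]
    exact (hf i (Finset.mem_insert_self i s)).mul
      (ih fun j hj => hf j (Finset.mem_insert_of_mem hj))

theorem inv (hf : IsHolFun (EM := EM) U f) (h : ∀ x ∈ U, f x ≠ 0) :
    IsHolFun (EM := EM) U fun x => (f x)⁻¹ := fun x hx =>
  ContMDiffAt.comp_contMDiffWithinAt (g := fun z : ℂ => z⁻¹) (f := f) (I' := 𝓘(ℂ, ℂ)) x
    ((contDiffAt_inv ℂ (h x hx)).contMDiffAt) (hf x hx)

theorem mdifferentiableAt (hf : IsHolFun (EM := EM) U f) (hU : IsOpen U) {x : M} (hx : x ∈ U) :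
    MDifferentiableAt 𝓘(ℂ, EM) 𝓘(ℂ, ℂ) f x :=
  (ContMDiffOn.contMDiffAt hf (hU.mem_nhds hx)).mdifferentiableAt (by simp)

variable [Fintype ι] [DecidableEq ι]

theorem det {A : M → Matrix ι ι ℂ} (hA : ∀ i j, IsHolFun (EM := EM) U fun x => A x i j) :
    IsHolFun (EM := EM) U fun x => (A x).det := by
  simp only [Matrix.det_apply']
  exact sum fun σ _ => (const _).mul (prod fun i _ => hA _ _)

theorem matrix_inv {A : M → Matrix ι ι ℂ} (hA : ∀ i j, IsHolFun (EM := EM) U fun x => A x i j)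
    (h : ∀ x ∈ U, (A x).det ≠ 0) (i j : ι) : IsHolFun (EM := EM) U fun x => (A x)⁻¹ i j := by
  simp only [Matrix.inv_def, Matrix.smul_apply, Matrix.adjugate_apply, smul_eq_mul,
    Ring.inverse_eq_inv']
  refine ((det hA).inv h).mul (det fun k l => ?_)
  simp only [Matrix.updateRow_apply]
  split_ifs
  · exact const _
  · exact hA k l

end IsHolFun

variable {FV : Type*} [NormedAddCommGroup FV] [NormedSpace ℂ FV]
  {V : M → Type*} [TopologicalSpace (Bundle.TotalSpace FV V)]
  [∀ x, AddCommGroup (V x)] [∀ x, Module ℂ (V x)] [∀ x, TopologicalSpace (V x)]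
  [∀ x, IsTopologicalAddGroup (V x)] [∀ x, ContinuousSMul ℂ (V x)]
  [FiberBundle FV V] [VectorBundle ℂ FV V] {ι : Type*}

namespace IsHolSection

variable {U U' : Set M} {s t : ∀ x, V x} {f : M → ℂ}

theorem mono (hs : IsHolSection (EM := EM) FV U s) (h : U' ⊆ U) :
    IsHolSection (EM := EM) FV U' s :=
  ContMDiffOn.mono hs h

theorem mdifferentiableAt (hs : IsHolSection (EM := EM) FV U s) (hU : IsOpen U) {x : M}
    (hx : x ∈ U) : MDifferentiableAt 𝓘(ℂ, EM) (𝓘(ℂ, EM).prod 𝓘(ℂ, FV))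
      (fun x => Bundle.TotalSpace.mk' FV x (s x)) x :=
  (ContMDiffOn.contMDiffAt hs (hU.mem_nhds hx)).mdifferentiableAt (by simp)

theorem sub (hs : IsHolSection (EM := EM) FV U s) (ht : IsHolSection (EM := EM) FV U t) :
    IsHolSection (EM := EM) FV U fun x => s x - t x :=
  ContMDiffOn.sub_section hs ht

theorem smul (hf : IsHolFun (EM := EM) U f) (hs : IsHolSection (EM := EM) FV U s) :
    IsHolSection (EM := EM) FV U fun x => f x • s x :=
  ContMDiffOn.smul_section hf hs

theorem sum {S : Finset ι} {s : ι → ∀ x, V x} (hs : ∀ i ∈ S, IsHolSection (EM := EM) FV U (s i)) :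
    IsHolSection (EM := EM) FV U fun x => ∑ i ∈ S, s i x :=
  ContMDiffOn.sum_section hs

end IsHolSection

variable (EM FV) in
/-- `e` is a frame of the bundle `V` over `U` by holomorphic sections. -/
structure IsHolFrame (U : Set M) (e : ι → ∀ x, V x) : Prop where
  holomorphic : ∀ i, IsHolSection (EM := EM) FV U (e i)
  basis : ∀ x ∈ U, ∃ B : Module.Basis ι ℂ (V x), ∀ i, B i = e i x

theorem IsHolFrame.mono {U U' : Set M} {e : ι → ∀ x, V x} (h : IsHolFrame EM FV U e) (hU : U' ⊆ U) :
    IsHolFrame EM FV U' e :=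
  ⟨fun i => (h.holomorphic i).mono hU, fun x hx => h.basis x (hU hx)⟩

variable [IsManifold 𝓘(ℂ, EM) ω M] [ContMDiffVectorBundle ω FV V 𝓘(ℂ, EM)]

theorem isHolFrame_localFrame (x : M) (b : Module.Basis ι ℂ FV) :
    IsHolFrame EM FV (trivializationAt FV V x).baseSet
      ((trivializationAt FV V x).localFrame b) :=
  ⟨fun i => (trivializationAt FV V x).contMDiffOn_localFrame_baseSet _ b i, fun y hy =>
    ⟨(trivializationAt FV V x).basisAt b hy, fun i => by simp [hy]⟩⟩

theorem exists_isHolFrame (x : M) (b : Module.Basis ι ℂ FV) :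
    ∃ U : Set M, IsOpen U ∧ x ∈ U ∧ ∃ e : ι → ∀ x, V x, IsHolFrame EM FV U e :=
  ⟨_, (trivializationAt FV V x).open_baseSet, FiberBundle.mem_baseSet_trivializationAt' x, _,
    isHolFrame_localFrame x b⟩

/-- Coefficients in the frame of a trivialisation are holomorphic. The matrix `A` of the given frame
in that frame is holomorphic and invertible, and its inverse is holomorphic by Cramer's rule; this
transfers holomorphy to coefficients in the given frame. -/
theorem IsHolFrame.exists_coeff [FiniteDimensional ℂ FV] [Fintype ι] {U : Set M} (hU : IsOpen U)
    {e : ι → ∀ x, V x} (he : IsHolFrame EM FV U e) {x : M} (hx : x ∈ U) :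
    ∃ W, IsOpen W ∧ x ∈ W ∧ W ⊆ U ∧ ∀ U', IsOpen U' → U' ⊆ W → ∀ s : ∀ x, V x,
      IsHolSection (EM := EM) FV U' s → ∃ f : ι → M → ℂ, (∀ i, IsHolFun (EM := EM) U' (f i)) ∧
        ∀ y ∈ U', s y = ∑ i, f i y • e i y := by
  classical
  set t := trivializationAt FV V x with ht
  have hxt : x ∈ t.baseSet := FiberBundle.mem_baseSet_trivializationAt' x
  obtain ⟨B, hB⟩ := he.basis x hx
  set b : Module.Basis ι ℂ FV := B.map (t.linearEquivAt (R := ℂ) x hxt)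
  have : ContMDiffVectorBundle 1 FV V 𝓘(ℂ, EM) := ContMDiffVectorBundle.of_le (n := ω) (by simp)
  set c := fun i (y : M) => t.localFrameCoeff 𝓘(ℂ, EM) b i y with hc
  have hcoef : ∀ U', IsOpen U' → U' ⊆ t.baseSet → ∀ s : ∀ x, V x,
      IsHolSection (EM := EM) FV U' s → ∀ i, IsHolFun (EM := EM) U' fun y => c i y (s y) :=
    fun U' hU' hU't s hs i => contMDiffOn_localFrameCoeff b hU' hU't hs i
  have hexp : ∀ y ∈ t.baseSet, ∀ s : ∀ x, V x, s y = ∑ i, c i y (s y) • t.localFrame b i y :=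
    fun y hy s => t.eq_sum_localFrameCoeff_smul hy
  set A : M → Matrix ι ι ℂ := fun y => Matrix.of fun i j => c j y (e i y) with hA
  have hdet : ∀ y ∈ U ∩ t.baseSet, (A y).det ≠ 0 := by
    rintro y ⟨hyU, hyt⟩
    obtain ⟨B', hB'⟩ := he.basis y hyU
    have := ((t.basisAt b hyt).isUnit_det B').ne_zero
    rw [Module.Basis.det_apply, ← Matrix.det_transpose] at this
    convert this using 2
    ext i j
    change t.localFrameCoeff 𝓘(ℂ, EM) b j y (e i y) = (t.basisAt b hyt).repr (B' i) j
    rw [t.localFrameCoeff_apply_of_mem_baseSet b hyt, hB']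
  refine ⟨U ∩ t.baseSet, hU.inter t.open_baseSet, ⟨hx, hxt⟩, Set.inter_subset_left,
    fun U' hU' hU'W s hs => ⟨fun i y => ∑ j, c j y (s y) * (A y)⁻¹ j i, fun i => ?_,
      fun y hy => ?_⟩⟩
  · refine IsHolFun.sum fun j _ => (hcoef U' hU' (fun y hy => (hU'W hy).2) s hs j).mul ?_
    refine IsHolFun.matrix_inv (fun k l => ?_) (fun y hy => hdet y (hU'W hy)) j i
    exact hcoef U' hU' (fun y hy => (hU'W hy).2) _
      ((he.holomorphic k).mono fun y hy => (hU'W hy).1) l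
  · have h1 : ∀ j, ∑ i, (A y)⁻¹ j i • e i y = t.localFrame b j y := by
      intro j
      have h2 : ∀ i, e i y = ∑ k, A y i k • t.localFrame b k y := fun i =>
        hexp y (hU'W hy).2 (e i)
      simp only [h2, Finset.smul_sum, smul_smul]
      rw [Finset.sum_comm]
      simp only [← Finset.sum_smul, ← Matrix.mul_apply,
        Matrix.nonsing_inv_mul _ (isUnit_iff_ne_zero.2 (hdet y (hU'W hy))), Matrix.one_apply,
        ite_smul, one_smul, zero_smul, Finset.sum_ite_eq, Finset.mem_univ, if_true]
    rw [hexp y (hU'W hy).2 s]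
    simp only [← h1, Finset.smul_sum, Finset.sum_smul, smul_smul]
    rw [Finset.sum_comm]

end Holomorphic

/-! ### The metric and the 4-form of a Grassmann structure -/

section GrassmannForms

set_option linter.unusedSectionVars false

variable {EM : Type*} [NormedAddCommGroup EM] [NormedSpace ℂ EM] [FiniteDimensional ℂ EM]
  {M : Type*} [TopologicalSpace M] [ChartedSpace EM M] [IsManifold 𝓘(ℂ, EM) ω M]

/-- Values on arbitrary holomorphic fields are sums of products of holomorphic coefficients with
values on frame vectors, so a local frame suffices. -/
theorem isHolForm_of_isHolFrame {p : ℕ} {U : Set M}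
    (α : ∀ x : M, MultilinearMap ℂ (fun _ : Fin p => TangentSpace 𝓘(ℂ, EM) x) ℂ)
    (h : ∀ x ∈ U, ∃ W, IsOpen W ∧ x ∈ W ∧ ∃ (n : ℕ)
      (c : Fin n → ∀ x : M, TangentSpace 𝓘(ℂ, EM) x), IsHolFrame EM EM W c ∧
      ∀ I : Fin p → Fin n, IsHolFun (EM := EM) W fun x => α x fun i => c (I i) x) :
    IsHolForm U fun x v => α x v := by
  classical
  intro U' hU' hU'U X hX
  refine IsHolFun.of_locally fun x hx => ?_
  obtain ⟨W, hW, hxW, n, c, hc, hα⟩ := h x (hU'U hx)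
  obtain ⟨W', hW', hxW', hW'W, hco⟩ := hc.exists_coeff hW hxW
  have := fun i => hco (U' ∩ W') (hU'.inter hW') Set.inter_subset_right (X i)
    ((hX i).mono Set.inter_subset_left)
  choose f hf hfX using this
  refine ⟨U' ∩ W', hU'.inter hW', ⟨hx, hxW'⟩, ?_⟩
  refine IsHolFun.congr (f := fun y => ∑ I : Fin p → Fin n,
    (∏ i, f i (I i) y) * α y fun i => c (I i) y) ?_ fun y hy => ?_
  · exact IsHolFun.sum fun I _ => (IsHolFun.prod fun i _ => hf i (I i)).mul
      ((hα I).mono fun y hy => hW'W hy.2)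
  · change α y (fun i => X i y) = _
    rw [show (fun i => X i y) = fun i => ∑ j, f i j y • c j y from funext fun i => hfX i y hy,
      MultilinearMap.map_sum]
    refine Finset.sum_congr rfl fun I _ => ?_
    rw [MultilinearMap.map_smul_univ, smul_eq_mul]

variable {FE : Type*} [NormedAddCommGroup FE] [NormedSpace ℂ FE] [FiniteDimensional ℂ FE]
  {Es : M → Type*} [TopologicalSpace (Bundle.TotalSpace FE Es)]
  [∀ x, AddCommGroup (Es x)] [∀ x, Module ℂ (Es x)] [∀ x, TopologicalSpace (Es x)]
  [∀ x, IsTopologicalAddGroup (Es x)] [∀ x, ContinuousSMul ℂ (Es x)]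
  [FiberBundle FE Es] [VectorBundle ℂ FE Es] [ContMDiffVectorBundle ω FE Es 𝓘(ℂ, EM)]
  {FH : Type*} [NormedAddCommGroup FH] [NormedSpace ℂ FH] [FiniteDimensional ℂ FH]
  {Hs : M → Type*} [TopologicalSpace (Bundle.TotalSpace FH Hs)]
  [∀ x, AddCommGroup (Hs x)] [∀ x, Module ℂ (Hs x)] [∀ x, TopologicalSpace (Hs x)]
  [∀ x, IsTopologicalAddGroup (Hs x)] [∀ x, ContinuousSMul ℂ (Hs x)]
  [FiberBundle FH Hs] [VectorBundle ℂ FH Hs] [ContMDiffVectorBundle ω FH Hs 𝓘(ℂ, EM)]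
  {m : ℕ} (S : SpinGrassmann EM FE Es FH Hs m)

namespace SpinGrassmann

/-- A basis of `E^*_x`. -/
def basisE (_S : SpinGrassmann EM FE Es FH Hs m) (x : M) :
    Module.Basis (Fin (Module.finrank ℂ FE)) ℂ (Es x) :=
  (trivializationAt FE Es x).basisAt (Module.finBasis ℂ FE)
    (FiberBundle.mem_baseSet_trivializationAt' x)

/-- A basis of `H^*_x`. -/
def basisH (x : M) : Module.Basis (Fin 2) ℂ (Hs x) :=
  (trivializationAt FH Hs x).basisAt (Module.finBasisOfFinrankEq ℂ FH S.rank_H)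
    (FiberBundle.mem_baseSet_trivializationAt' x)

theorem exists_basis_sym (S : SpinGrassmann EM FE Es FH Hs m) (x : M) :
    Nonempty (Module.Basis (Fin (m + 1)) ℂ (Sym[ℂ]^m (Hs x))) :=
  ⟨(exists_basis_symMonomial (S.omegaH_parallel.alt x) (S.omegaH_parallel.nondegenerate x)
    (S.basisH x)).choose⟩

theorem powForm_omegaH_self (hm : Odd m) (x : M) (s : Sym[ℂ]^m (Hs x)) :
    powForm m (S.omegaH x) s s = 0 :=
  powForm_self hm (S.omegaH_parallel.alt x) s

theorem powForm_omegaH_nondegenerate (x : M) (s : Sym[ℂ]^m (Hs x))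
    (hs : ∀ s', powForm m (S.omegaH x) s s' = 0) : s = 0 :=
  powForm_nondegenerate (S.omegaH_parallel.alt x) (S.omegaH_parallel.nondegenerate x)
    (S.basisH x) s hs

variable {omegaE : ∀ x, Es x →ₗ[ℂ] Es x →ₗ[ℂ] ℂ}

theorem metric_iso (x : M) (e e' : Es x) (s s' : Sym[ℂ]^m (Hs x)) :
    S.metric omegaE x (S.iso x (e ⊗ₜ[ℂ] s)) (S.iso x (e' ⊗ₜ[ℂ] s')) =
      powForm m (S.omegaH x) s s' * omegaE x e e' := by
  simp only [metric, LinearMap.compl₁₂_apply, LinearEquiv.coe_coe, LinearEquiv.symm_apply_apply,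
    tmul_apply_tmul]

theorem canonicalForm_iso (homegaE : IsParallelSymplectic S.nablaE omegaE) (hm : Odd m) (x : M)
    (e : Fin 4 → Es x) (s : Fin 4 → Sym[ℂ]^m (Hs x)) :
    S.canonicalForm omegaE x (fun i => S.iso x (e i ⊗ₜ[ℂ] s i)) =
      4 * (omegaE x (e 0) (e 1) * omegaE x (e 2) (e 3) *
        (powForm m (S.omegaH x) (s 0) (s 2) * powForm m (S.omegaH x) (s 1) (s 3) +
          powForm m (S.omegaH x) (s 0) (s 3) * powForm m (S.omegaH x) (s 1) (s 2)) -
      omegaE x (e 0) (e 2) * omegaE x (e 1) (e 3) *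
        (powForm m (S.omegaH x) (s 0) (s 1) * powForm m (S.omegaH x) (s 2) (s 3) -
          powForm m (S.omegaH x) (s 0) (s 3) * powForm m (S.omegaH x) (s 1) (s 2)) -
      omegaE x (e 0) (e 3) * omegaE x (e 1) (e 2) *
        (powForm m (S.omegaH x) (s 0) (s 1) * powForm m (S.omegaH x) (s 2) (s 3) +
          powForm m (S.omegaH x) (s 0) (s 2) * powForm m (S.omegaH x) (s 1) (s 3))) := by
  rw [← fourForm_tmul (homegaE.alt x) (S.powForm_omegaH_self hm x), canonicalForm,
    AlternatingMap.compLinearMap_apply]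
  congr 1
  funext i
  simp

theorem dualPair_metric_exists (homegaE : IsParallelSymplectic S.nablaE omegaE) (x : M) :
    ∃ c c' : Fin (Module.finrank ℂ FE) × Fin (m + 1) → TangentSpace 𝓘(ℂ, EM) x,
      DualPair (S.metric omegaE x) c c' := by
  obtain ⟨f⟩ := S.exists_basis_sym x
  exact ⟨_, _, dualPair_tensor (homegaE.nondegenerate x) (S.powForm_omegaH_nondegenerate x)
    (S.basisE x) f (S.iso x)⟩

theorem metric_symm (homegaE : IsParallelSymplectic S.nablaE omegaE) (hm : Odd m) (x : M)
    (v w : TangentSpace 𝓘(ℂ, EM) x) : S.metric omegaE x v w = S.metric omegaE x w v := by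
  have : LinearMap.BilinForm.tmul (omegaE x) (powForm m (S.omegaH x)) =
      LinearMap.flip (LinearMap.BilinForm.tmul (omegaE x) (powForm m (S.omegaH x))) := by
    refine TensorProduct.ext' fun e s => TensorProduct.ext' fun e' s' => ?_
    rw [LinearMap.flip_apply, tmul_apply_tmul, tmul_apply_tmul, bilin_swap (homegaE.alt x) e',
      bilin_swap (S.powForm_omegaH_self hm x) s', neg_mul_neg]
  exact LinearMap.congr_fun (LinearMap.congr_fun this _) _

/-- The second tensor factors are the monomials in a local frame of `H^*`. They are recorded as
`m`-tuples of sections of `H^*`, the form needed by `iso_holomorphic` and `powForm_symProd`. -/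
theorem exists_isHolFrame_iso (x : M) : ∃ U : Set M, IsOpen U ∧ x ∈ U ∧
    ∃ (e : Fin (Module.finrank ℂ FE) → ∀ x, Es x) (h : Fin (m + 1) → Fin m → ∀ x, Hs x),
      (∀ i, IsHolSection (EM := EM) FE U (e i)) ∧
      (∀ k i, IsHolSection (EM := EM) FH U (h k i)) ∧
      IsHolFrame EM EM U (V := fun x : M => TangentSpace 𝓘(ℂ, EM) x)
        fun (k : Fin (Module.finrank ℂ FE) × Fin (m + 1)) x =>
          S.iso x (e k.1 x ⊗ₜ[ℂ] symProd fun i => h k.2 i x) := by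
  obtain ⟨U, hU, hxU, e, he⟩ :=
    exists_isHolFrame (EM := EM) (V := Es) x (Module.finBasis ℂ FE)
  obtain ⟨U', hU', hxU', h, hh⟩ := exists_isHolFrame (EM := EM) (V := Hs) x
    (Module.finBasisOfFinrankEq ℂ FH S.rank_H)
  have h1 : ∀ i, IsHolSection (EM := EM) FE (U ∩ U') (e i) := fun i =>
    (he.holomorphic i).mono Set.inter_subset_left
  have h2 : ∀ (k : Fin (m + 1)) (i : Fin m),
      IsHolSection (EM := EM) FH (U ∩ U') (if (i : ℕ) < k then h 1 else h 0) := fun k i => by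
    split_ifs
    · exact (hh.holomorphic 1).mono Set.inter_subset_right
    · exact (hh.holomorphic 0).mono Set.inter_subset_right
  refine ⟨U ∩ U', hU.inter hU', ⟨hxU, hxU'⟩, e, fun k i => if (i : ℕ) < k then h 1 else h 0,
    h1, h2, fun k => S.iso_holomorphic _ (hU.inter hU') _ _ (h1 k.1) (h2 k.2), ?_⟩
  rintro y ⟨hy, hy'⟩
  obtain ⟨B, hB⟩ := he.basis y hy
  obtain ⟨B', hB'⟩ := hh.basis y hy'
  obtain ⟨C, hC⟩ := exists_basis_symMonomial (m := m) (S.omegaH_parallel.alt y)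
    (S.omegaH_parallel.nondegenerate y) B'
  refine ⟨(B.tensorProduct C).map (S.iso y), fun k => ?_⟩
  rw [Module.Basis.map_apply, Module.Basis.tensorProduct_apply, hB, hC, hB', hB', symMonomial]
  congr 3
  funext i
  by_cases hk : (i : ℕ) < k.2 <;> simp [hk]

theorem powForm_isHolFun {U : Set M} (hU : IsOpen U) {h h' : Fin m → ∀ x, Hs x}
    (hh : ∀ i, IsHolSection (EM := EM) FH U (h i)) (hh' : ∀ i, IsHolSection (EM := EM) FH U (h' i)) :
    IsHolFun (EM := EM) U fun x =>
      powForm m (S.omegaH x) (symProd fun i => h i x) (symProd fun i => h' i x) := by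
  simp only [powForm_symProd]
  exact IsHolFun.sum fun σ _ => IsHolFun.sum fun τ _ => IsHolFun.prod fun i _ =>
    S.omegaH_parallel.holomorphic U hU _ _ (hh _) (hh' _)

theorem isHolForm_of_iso {p : ℕ}
    (α : ∀ x : M, MultilinearMap ℂ (fun _ : Fin p => TangentSpace 𝓘(ℂ, EM) x) ℂ)
    (h : ∀ U : Set M, IsOpen U → ∀ (e : Fin p → ∀ x, Es x) (h : Fin p → Fin m → ∀ x, Hs x),
      (∀ i, IsHolSection (EM := EM) FE U (e i)) →
      (∀ k i, IsHolSection (EM := EM) FH U (h k i)) → IsHolFun (EM := EM) U fun x =>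
        α x fun i => S.iso x (e i x ⊗ₜ[ℂ] symProd fun j => h i j x)) :
    IsHolForm Set.univ fun x v => α x v := by
  refine isHolForm_of_isHolFrame α fun x _ => ?_
  obtain ⟨U, hU, hxU, e, s, he, hs, hf⟩ := S.exists_isHolFrame_iso x
  refine ⟨U, hU, hxU, _, fun k => _, ⟨fun i => hf.holomorphic (finProdFinEquiv.symm i),
    fun y hy => ?_⟩, fun I => h U hU _ _ (fun i => he _) fun k i => hs _ i⟩
  obtain ⟨B, hB⟩ := hf.basis y hy
  exact ⟨B.reindex finProdFinEquiv, fun i => by rw [Module.Basis.reindex_apply, hB]⟩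

theorem isComplexRiemannian_metric (homegaE : IsParallelSymplectic S.nablaE omegaE) (hm : Odd m) :
    IsComplexRiemannian (S.metric omegaE) where
  symm := S.metric_symm homegaE hm
  nondegenerate x v hv := by
    obtain ⟨c, c', h⟩ := S.dualPair_metric_exists homegaE x
    exact h.left_nondegenerate hv
  holomorphic := by
    refine S.isHolForm_of_iso (fun x => twoFormMultilinear (S.metric omegaE x))
      fun U hU e h he hh => ?_
    refine IsHolFun.congr (f := fun x => powForm m (S.omegaH x) (symProd fun i => h 0 i x)
      (symProd fun i => h 1 i x) * omegaE x (e 0 x) (e 1 x)) ?_ fun x _ => ?_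
    · exact (S.powForm_isHolFun hU (hh 0) (hh 1)).mul
        (homegaE.holomorphic U hU _ _ (he 0) (he 1))
    · exact S.metric_iso x _ _ _ _

theorem isHolForm_canonicalForm (homegaE : IsParallelSymplectic S.nablaE omegaE) (hm : Odd m) :
    IsHolForm Set.univ fun x v => S.canonicalForm omegaE x v := by
  refine S.isHolForm_of_iso (fun x => (S.canonicalForm omegaE x).toMultilinearMap)
    fun U hU e h he hh => ?_
  simp only [AlternatingMap.coe_multilinearMap]
  simp only [S.canonicalForm_iso homegaE hm _ (fun i => e i _)
    fun i => symProd fun j => h i j _]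
  have ha := fun i j => homegaE.holomorphic U hU _ _ (he i) (he j)
  have hb := fun i j => S.powForm_isHolFun hU (hh i) (hh j)
  refine (IsHolFun.const 4).mul (((((ha _ _).mul (ha _ _)).mul
    (((hb _ _).mul (hb _ _)).add ((hb _ _).mul (hb _ _)))).sub (((ha _ _).mul (ha _ _)).mul
    (((hb _ _).mul (hb _ _)).sub ((hb _ _).mul (hb _ _))))).sub (((ha _ _).mul (ha _ _)).mul
    (((hb _ _).mul (hb _ _)).add ((hb _ _).mul (hb _ _)))))

theorem metric_action {x : M} {A : Es x →ₗ[ℂ] Es x} {B : Hs x →ₗ[ℂ] Hs x}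
    (h : S.IsSymplecticPair omegaE x A B) (v w : TangentSpace 𝓘(ℂ, EM) x) :
    S.metric omegaE x (S.action x A B v) (S.action x A B w) = S.metric omegaE x v w := by
  simp only [metric, action, LinearMap.compl₁₂_apply, LinearMap.comp_apply, LinearEquiv.coe_coe,
    LinearEquiv.symm_apply_apply]
  exact tmul_map h.1 (powForm_symMap h.2) _ _

theorem canonicalForm_action {x : M} {A : Es x →ₗ[ℂ] Es x} {B : Hs x →ₗ[ℂ] Hs x}
    (h : S.IsSymplecticPair omegaE x A B) :
    (S.canonicalForm omegaE x).compLinearMap (S.action x A B) = S.canonicalForm omegaE x := by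
  ext v
  have := AlternatingMap.congr_fun (fourForm_map h.1 (powForm_symMap (m := m) h.2))
    fun i => (S.iso x).symm (v i)
  simpa [canonicalForm, action] using this

theorem contraction_canonicalForm (homegaE : IsParallelSymplectic S.nablaE omegaE) (hm : Odd m)
    {x : M} {ρ : Type*} [Fintype ρ] {c c' : ρ → TangentSpace 𝓘(ℂ, EM) x}
    (hc : DualPair (S.metric omegaE x) c c') {A : Type*} [AddCommGroup A] [Module ℂ A]
    {T : Es x →ₗ[ℂ] Es x →ₗ[ℂ] A} (hT : ∀ e e', T e e' = T e' e)
    {B : TangentSpace 𝓘(ℂ, EM) x →ₗ[ℂ] TangentSpace 𝓘(ℂ, EM) x →ₗ[ℂ] A}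
    (hB : ∀ e e' s s', B (S.iso x (e ⊗ₜ[ℂ] s)) (S.iso x (e' ⊗ₜ[ℂ] s')) =
      powForm m (S.omegaH x) s s' • T e e') :
    contraction c c' (S.canonicalForm omegaE x) (twoForm B) =
      (-4 * ((m : ℂ) + 2)) • twoForm B := by
  obtain ⟨f⟩ := S.exists_basis_sym x
  refine (contraction_tensor (homegaE.alt x) (S.powForm_omegaH_self hm x)
    (homegaE.nondegenerate x) (S.powForm_omegaH_nondegenerate x) (S.basisE x) f (S.iso x) hc
    hT hB).trans ?_
  congr 1
  rw [Fintype.card_fin]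
  push_cast
  ring

end SpinGrassmann

end GrassmannForms

/-! ### The eigenvalue of the operator of the 4-form -/

section Eigenvalue

variable {V : Type*} [AddCommGroup V] [Module ℂ V] [FiniteDimensional ℂ V]
  {A : Type*} [AddCommGroup A] [Module ℂ A] {g : V →ₗ[ℂ] V →ₗ[ℂ] ℂ} {n : ℕ}

omit [FiniteDimensional ℂ V] in
theorem twoForm_smul (l : ℂ) (B : V →ₗ[ℂ] V →ₗ[ℂ] A) : twoForm (l • B) = l • twoForm B := rfl

/-- By `wedge_hodgeStar`, `B_Ω β` is `∗∗` of the contraction, which is a multiple of `β`; then `∗∗ =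
1` applies. -/
theorem bOperator_twoForm (hg : ∀ v, (∀ w, g v w = 0) → v = 0) (hs : ∀ v w, g v w = g w v)
    (hn : Module.finrank ℂ V = n) (h4 : 4 ≤ n) (vol : V [⋀^Fin n]→ₗ[ℂ] ℂ)
    (hvol : ∀ v : Fin n → V, vol v ^ 2 = (Matrix.of fun i j => g (v i) (v j)).det)
    (Ω : V [⋀^Fin 4]→ₗ[ℂ] ℂ) {B : V →ₗ[ℂ] V →ₗ[ℂ] A} (hB : ∀ x, B x x = 0) {l : ℂ}
    (hl : contraction (Module.finBasis ℂ V) (dualFrame g (Module.finBasis ℂ V)) Ω (twoForm B) =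
      l • twoForm B) : bOperator g vol Ω (twoForm B) = l • twoForm B := by
  obtain ⟨q, rfl⟩ : ∃ q, n = q + 4 := ⟨n - 4, by omega⟩
  -- With `n = q + 4` the truncated differences in `bOperator` reduce definitionally.
  change hodgeStar g vol (q + 2) 2 (wedge (hodgeStar g vol 4 q Ω) (twoForm B)) = _
  rw [wedge_hodgeStar hn vol Ω hB, hl, ← twoForm_smul]
  exact hodgeStar_hodgeStar_two hg hs hn vol hvol (B := l • B) fun x => by simp [hB]

theorem hodgeStar_smul (vol : (Fin n → V) → ℂ) (p q : ℕ) (l : ℂ) (β : (Fin p → V) → A) :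
    hodgeStar g vol p q (l • β) = l • hodgeStar g vol p q β := by
  funext v
  simp only [hodgeStar, Pi.smul_apply]
  split_ifs
  · rw [smul_comm l, Finset.smul_sum (r := l)]
    congr 1
    exact Finset.sum_congr rfl fun I _ => smul_comm _ _ _
  · simp

/-- One Hodge star fewer than in `bOperator_twoForm`, so no normalisation of `vol` is needed. It
reduces the Yang–Mills equation to a Leibniz rule. -/
theorem hodgeStar_two_eq_wedge {q : ℕ} (hn : Module.finrank ℂ V = q + 4)
    (vol : V [⋀^Fin (q + 4)]→ₗ[ℂ] ℂ)
    (Ω : V [⋀^Fin 4]→ₗ[ℂ] ℂ) {B : V →ₗ[ℂ] V →ₗ[ℂ] A} (hB : ∀ x, B x x = 0) {l : ℂ} (hl0 : l ≠ 0)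
    (hl : contraction (Module.finBasis ℂ V) (dualFrame g (Module.finBasis ℂ V)) Ω (twoForm B) =
      l • twoForm B) :
    hodgeStar g vol 2 (q + 2) (twoForm B) = l⁻¹ • wedge (hodgeStar g vol 4 q Ω) (twoForm B) := by
  rw [wedge_hodgeStar hn vol Ω hB, hl, hodgeStar_smul, smul_smul, inv_mul_cancel₀ hl0, one_smul]

end Eigenvalue

/-! ### ### The eigenvalue `-4(m + 2)` and the nonvanishing of the 4-form -/

section GrassmannEigenvalue

set_option linter.unusedSectionVars false

variable {EM : Type*} [NormedAddCommGroup EM] [NormedSpace ℂ EM] [FiniteDimensional ℂ EM]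
  {M : Type*} [TopologicalSpace M] [ChartedSpace EM M] [IsManifold 𝓘(ℂ, EM) ω M]
  {FE : Type*} [NormedAddCommGroup FE] [NormedSpace ℂ FE] [FiniteDimensional ℂ FE]
  {Es : M → Type*} [TopologicalSpace (Bundle.TotalSpace FE Es)]
  [∀ x, AddCommGroup (Es x)] [∀ x, Module ℂ (Es x)] [∀ x, TopologicalSpace (Es x)]
  [∀ x, IsTopologicalAddGroup (Es x)] [∀ x, ContinuousSMul ℂ (Es x)]
  [FiberBundle FE Es] [VectorBundle ℂ FE Es] [ContMDiffVectorBundle ω FE Es 𝓘(ℂ, EM)]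
  {FH : Type*} [NormedAddCommGroup FH] [NormedSpace ℂ FH] [FiniteDimensional ℂ FH]
  {Hs : M → Type*} [TopologicalSpace (Bundle.TotalSpace FH Hs)]
  [∀ x, AddCommGroup (Hs x)] [∀ x, Module ℂ (Hs x)] [∀ x, TopologicalSpace (Hs x)]
  [∀ x, IsTopologicalAddGroup (Hs x)] [∀ x, ContinuousSMul ℂ (Hs x)]
  [FiberBundle FH Hs] [VectorBundle ℂ FH Hs] [ContMDiffVectorBundle ω FH Hs 𝓘(ℂ, EM)]
  {m : ℕ} (S : SpinGrassmann EM FE Es FH Hs m)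

namespace SpinGrassmann

variable {omegaE : ∀ x, Es x →ₗ[ℂ] Es x →ₗ[ℂ] ℂ}

/-- The dimension is `rank E * (m + 1)`, and a nonzero space with a symplectic form has dimension at
least 2. The bound ensures that `n - 4` is the true degree of `∗Ω`. -/
theorem four_le_finrank [Nontrivial FE] (homegaE : IsParallelSymplectic S.nablaE omegaE)
    (hm : Odd m) (x : M) : 4 ≤ Module.finrank ℂ EM := by
  obtain ⟨f⟩ := S.exists_basis_sym x
  have h1 : Module.finrank ℂ EM = Module.finrank ℂ FE * (m + 1) := by
    have := Module.finrank_eq_card_basis (((S.basisE x).tensorProduct f).map (S.iso x))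
    rw [Fintype.card_prod, Fintype.card_fin, Fintype.card_fin] at this
    exact this
  have h2 : 2 ≤ Module.finrank ℂ FE := by
    set e := S.basisE x ⟨0, Module.finrank_pos⟩ with he
    have he0 : e ≠ 0 := (S.basisE x).ne_zero _
    obtain ⟨e', he'⟩ : ∃ e', omegaE x e e' ≠ 0 := by
      by_contra! h
      exact he0 (homegaE.nondegenerate x e h)
    have hli : LinearIndependent ℂ ![e, e'] := by
      refine LinearIndependent.pair_iff.2 fun s t hst => ?_
      have hs := congrArg (fun v => omegaE x v e') hst
      have ht := congrArg (omegaE x e) hst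
      simp [homegaE.alt, he'] at hs ht
      exact ⟨hs, ht⟩
    have := Module.Finite.of_basis (S.basisE x)
    have h3 := hli.fintype_card_le_finrank
    rwa [Fintype.card_fin, Module.finrank_eq_card_basis (S.basisE x), Fintype.card_fin] at h3
  have := hm.pos
  nlinarith

theorem bilin_self_of_iso {A : Type*} [AddCommGroup A] [Module ℂ A] (hm : Odd m) {x : M}
    {T : Es x →ₗ[ℂ] Es x →ₗ[ℂ] A} (hT : ∀ e e', T e e' = T e' e)
    {B : TangentSpace 𝓘(ℂ, EM) x →ₗ[ℂ] TangentSpace 𝓘(ℂ, EM) x →ₗ[ℂ] A}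
    (hB : ∀ e e' s s', B (S.iso x (e ⊗ₜ[ℂ] s)) (S.iso x (e' ⊗ₜ[ℂ] s')) =
      powForm m (S.omegaH x) s s' • T e e') (v : TangentSpace 𝓘(ℂ, EM) x) : B v v = 0 := by
  have : B.compl₁₂ (S.iso x).toLinearMap (S.iso x).toLinearMap =
      -(B.compl₁₂ (S.iso x).toLinearMap (S.iso x).toLinearMap).flip := by
    refine TensorProduct.ext' fun e s => TensorProduct.ext' fun e' s' => ?_
    simp only [LinearMap.neg_apply, LinearMap.flip_apply, LinearMap.compl₁₂_apply,
      LinearEquiv.coe_coe, hB]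
    rw [hT e' e, bilin_swap (S.powForm_omegaH_self hm x), neg_smul]
  have h := LinearMap.congr_fun (LinearMap.congr_fun this ((S.iso x).symm v)) ((S.iso x).symm v)
  simp only [LinearMap.neg_apply, LinearMap.flip_apply, LinearMap.compl₁₂_apply,
      LinearEquiv.coe_coe, LinearEquiv.apply_symm_apply] at h
  rw [eq_neg_iff_add_eq_zero, ← two_smul ℂ] at h
  exact (smul_eq_zero.1 h).resolve_left two_ne_zero

/-- Take `T = φ ⊗ φ` for a nonzero covector `φ`. The resulting 2-form realises the eigenvalue at
every point and detects that `Ω` is not zero. -/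
theorem exists_twoForm [Nontrivial FE] (x : M) :
    ∃ (T : Es x →ₗ[ℂ] Es x →ₗ[ℂ] ℂ)
      (B : TangentSpace 𝓘(ℂ, EM) x →ₗ[ℂ] TangentSpace 𝓘(ℂ, EM) x →ₗ[ℂ] ℂ),
      (∀ e e', T e e' = T e' e) ∧ (∀ e e' s s', B (S.iso x (e ⊗ₜ[ℂ] s)) (S.iso x (e' ⊗ₜ[ℂ] s')) =
        powForm m (S.omegaH x) s s' • T e e') ∧ ∃ v w, B v w ≠ 0 := by
  obtain ⟨f⟩ := S.exists_basis_sym x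
  set i : Fin (Module.finrank ℂ FE) := ⟨0, Module.finrank_pos⟩
  set φ := (S.basisE x).coord i with hφ
  set T : Es x →ₗ[ℂ] Es x →ₗ[ℂ] ℂ := (LinearMap.mul ℂ ℂ).compl₁₂ φ φ with hT
  have hB : ∀ e e' s s', (LinearMap.BilinForm.tmul T (powForm m (S.omegaH x))).compl₁₂
      (S.iso x).symm.toLinearMap (S.iso x).symm.toLinearMap
      (S.iso x (e ⊗ₜ[ℂ] s)) (S.iso x (e' ⊗ₜ[ℂ] s')) = powForm m (S.omegaH x) s s' • T e e' := by
    intro e e' s s'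
    simp only [LinearMap.compl₁₂_apply, LinearEquiv.coe_coe, LinearEquiv.symm_apply_apply,
      tmul_apply_tmul, smul_eq_mul]
  refine ⟨T, _, fun e e' => ?_, hB, ?_⟩
  · simp [hT, mul_comm]
  · obtain ⟨s', hs'⟩ : ∃ s', powForm m (S.omegaH x) (f 0) s' ≠ 0 := by
      by_contra! h
      exact f.ne_zero 0 (S.powForm_omegaH_nondegenerate x _ h)
    refine ⟨S.iso x (S.basisE x i ⊗ₜ[ℂ] f 0), S.iso x (S.basisE x i ⊗ₜ[ℂ] s'), ?_⟩
    rw [hB]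
    simp [hT, hφ, hs']

theorem eigenvalue_ne_zero : (-4 * ((m : ℂ) + 2)) ≠ 0 := by
  have : ((m : ℂ) + 2) ≠ 0 := by exact_mod_cast Nat.succ_ne_zero (m + 1)
  simp [this]

/-- If `Ω` vanished at `x`, so would its contraction with the eigenform, against a nonzero
eigenvalue. -/
theorem canonicalForm_ne_zero [Nontrivial FE] (homegaE : IsParallelSymplectic S.nablaE omegaE)
    (hm : Odd m) (x : M) : S.canonicalForm omegaE x ≠ 0 := by
  intro h0
  obtain ⟨T, B, hT, hB, v, w, hvw⟩ := S.exists_twoForm x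
  obtain ⟨c, c', hc⟩ := S.dualPair_metric_exists homegaE x
  have := congrFun (S.contraction_canonicalForm homegaE hm hc hT hB) ![v, w]
  rw [h0] at this
  have h1 : (-4 * ((m : ℂ) + 2)) • B v w = 0 := by
    simpa [contraction, twoForm] using this.symm
  exact hvw ((smul_eq_zero.1 h1).resolve_left eigenvalue_ne_zero)

/-- The twofold alternating form `twoForm B`. -/
def _root_.GrassmannYM.twoFormAlternating {V A : Type*} [AddCommGroup V] [Module ℂ V]
    [AddCommGroup A] [Module ℂ A] (B : V →ₗ[ℂ] V →ₗ[ℂ] A) (hB : ∀ x, B x x = 0) :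
    V [⋀^Fin 2]→ₗ[ℂ] A where
  __ := twoFormMultilinear B
  map_eq_zero_of_eq' v i j hij hne := by
    have h : v 0 = v 1 := by
      fin_cases i <;> fin_cases j <;> simp_all
    change B (v 0) (v 1) = 0
    rw [h, hB]

theorem contraction_dualFrame (homegaE : IsParallelSymplectic S.nablaE omegaE) (hm : Odd m)
    {x : M} {A : Type*} [AddCommGroup A] [Module ℂ A]
    {T : Es x →ₗ[ℂ] Es x →ₗ[ℂ] A} (hT : ∀ e e', T e e' = T e' e)
    {B : TangentSpace 𝓘(ℂ, EM) x →ₗ[ℂ] TangentSpace 𝓘(ℂ, EM) x →ₗ[ℂ] A}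
    (hB : ∀ e e' s s', B (S.iso x (e ⊗ₜ[ℂ] s)) (S.iso x (e' ⊗ₜ[ℂ] s')) =
      powForm m (S.omegaH x) s s' • T e e') :
    contraction (Module.finBasis ℂ (TangentSpace 𝓘(ℂ, EM) x))
      (dualFrame (S.metric omegaE x) (Module.finBasis ℂ (TangentSpace 𝓘(ℂ, EM) x)))
      (S.canonicalForm omegaE x) (twoForm B) = (-4 * ((m : ℂ) + 2)) • twoForm B :=
  S.contraction_canonicalForm homegaE hm (dualPair_dualFrame
    ((S.isComplexRiemannian_metric homegaE hm).nondegenerate x) _) hT hB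

theorem bOperator_canonicalForm [Nontrivial FE] (homegaE : IsParallelSymplectic S.nablaE omegaE)
    (hm : Odd m) {U : Set M}
    {vol : ∀ x : M, TangentSpace 𝓘(ℂ, EM) x [⋀^Fin (Module.finrank ℂ EM)]→ₗ[ℂ] ℂ}
    (hvol : IsVolumeFormOn (S.metric omegaE) U vol) {x : M} (hx : x ∈ U)
    {A : Type*} [AddCommGroup A] [Module ℂ A]
    {T : Es x →ₗ[ℂ] Es x →ₗ[ℂ] A} (hT : ∀ e e', T e e' = T e' e)
    {B : TangentSpace 𝓘(ℂ, EM) x →ₗ[ℂ] TangentSpace 𝓘(ℂ, EM) x →ₗ[ℂ] A}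
    (hB : ∀ e e' s s', B (S.iso x (e ⊗ₜ[ℂ] s)) (S.iso x (e' ⊗ₜ[ℂ] s')) =
      powForm m (S.omegaH x) s s' • T e e') :
    bOperator (S.metric omegaE x) (vol x) (S.canonicalForm omegaE x) (twoForm B) =
      (-4 * ((m : ℂ) + 2)) • twoForm B :=
  bOperator_twoForm ((S.isComplexRiemannian_metric homegaE hm).nondegenerate x)
    (S.metric_symm homegaE hm x) rfl (S.four_le_finrank homegaE hm x) (vol x) (hvol.unit x hx) _
    (S.bilin_self_of_iso hm hT hB) (S.contraction_dualFrame homegaE hm hT hB)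

theorem isAppropriate_canonicalForm [Nontrivial FE]
    (homegaE : IsParallelSymplectic S.nablaE omegaE) (hm : Odd m) :
    IsAppropriate (S.metric omegaE) (S.canonicalForm omegaE) := by
  refine ⟨-4 * ((m : ℝ) + 2), ?_, fun U _ vol hvol x hx => ?_⟩
  · have := eigenvalue_ne_zero (m := m)
    exact_mod_cast this
  · obtain ⟨T, B, hT, hB, v, w, hvw⟩ := S.exists_twoForm x
    refine ⟨twoFormAlternating B (S.bilin_self_of_iso hm hT hB), fun h => hvw ?_, ?_⟩
    · exact AlternatingMap.congr_fun h ![v, w]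
    · push_cast
      exact S.bOperator_canonicalForm homegaE hm hvol hx hT hB

end SpinGrassmann

end GrassmannEigenvalue

/-! ### Extensions that are constant in a trivialisation -/

section Extend

set_option linter.unusedSectionVars false

variable {EM : Type*} [NormedAddCommGroup EM] [NormedSpace ℂ EM]
  {M : Type*} [TopologicalSpace M] [ChartedSpace EM M]
  {FV : Type*} [NormedAddCommGroup FV] [NormedSpace ℂ FV]
  {V : M → Type*} [TopologicalSpace (Bundle.TotalSpace FV V)]
  [∀ x, AddCommGroup (V x)] [∀ x, Module ℂ (V x)] [∀ x, TopologicalSpace (V x)]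
  [∀ x, IsTopologicalAddGroup (V x)] [∀ x, ContinuousSMul ℂ (V x)]
  [FiberBundle FV V] [VectorBundle ℂ FV V]

open Filter Topology

theorem extend_isHolSection [ContMDiffVectorBundle ω FV V 𝓘(ℂ, EM)] {x : M} (u : V x) :
    IsHolSection (EM := EM) FV (trivializationAt FV V x).baseSet (FiberBundle.extend FV u) := by
  set t := trivializationAt FV V x
  rw [IsHolSection, t.contMDiffOn_section_baseSet_iff]
  exact (contMDiffOn_const (c := (t ⟨x, u⟩).2)).congr fun y hy => by
    simp [FiberBundle.extend, t, hy]

theorem mem_baseSet (x : M) : x ∈ (trivializationAt FV V x).baseSet :=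
  FiberBundle.mem_baseSet_trivializationAt' x

end Extend

/-! ### Coordinate vector fields -/

section Coordinate

set_option linter.unusedSectionVars false

variable {EM : Type*} [NormedAddCommGroup EM] [NormedSpace ℂ EM]
  {M : Type*} [TopologicalSpace M] [ChartedSpace EM M] [IsManifold 𝓘(ℂ, EM) ω M]

open Filter Topology

variable {x : M}

/-- The coordinates of a tangent vector in the chart at its base point. -/
def chartCoord (v : TangentSpace 𝓘(ℂ, EM) x) : EM :=
  (trivializationAt EM (TangentSpace 𝓘(ℂ, EM)) x ⟨x, v⟩).2

/-- The constant vector field with value `c` on a vector space. -/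
def constField (c : EM) (z : EM) : TangentSpace 𝓘(ℂ, EM) z := c

theorem mvfderiv_congr {f f' : M → ℂ} (h : f =ᶠ[𝓝 x] f') :
    mvfderiv 𝓘(ℂ, EM) f x = mvfderiv 𝓘(ℂ, EM) f' x :=
  ContinuousLinearMap.ext fun v =>
    congrArg (fun L : TangentSpace 𝓘(ℂ, EM) x →L[ℂ] ℂ => L v) h.mfderiv_eq

theorem mfderiv_extChartAt_extend (v : TangentSpace 𝓘(ℂ, EM) x) {y : M}
    (hy : y ∈ (chartAt EM x).source) :
    mfderiv 𝓘(ℂ, EM) 𝓘(ℂ, EM) (extChartAt 𝓘(ℂ, EM) x) y (FiberBundle.extend EM v y) =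
      constField (chartCoord v) (extChartAt 𝓘(ℂ, EM) x y) := by
  set t := trivializationAt EM (TangentSpace 𝓘(ℂ, EM)) x
  have hyt : y ∈ t.baseSet := by simpa [t, TangentBundle.trivializationAt_baseSet] using hy
  rw [← TangentBundle.continuousLinearMapAt_trivializationAt hy]
  change t.continuousLinearMapAt ℂ y (t.symm y (chartCoord v)) = _
  rw [Bundle.Trivialization.continuousLinearMapAt_apply, t.linearMapAt_apply, if_pos hyt,
    t.apply_mk_symm hyt]
  rfl

/-- The trivialisation of the tangent bundle at `x` is the differential of the chart, so an
extension constant in it is the pullback of a constant field. Naturality of the Lie bracket then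
reduces commutation to a vector space. -/
theorem extend_eq_mpullback (v : TangentSpace 𝓘(ℂ, EM) x) {y : M}
    (hy : y ∈ (chartAt EM x).source) :
    FiberBundle.extend EM v y = VectorField.mpullback 𝓘(ℂ, EM) 𝓘(ℂ, EM) (extChartAt 𝓘(ℂ, EM) x)
      (constField (chartCoord v)) y := by
  rw [VectorField.mpullback_apply, eq_comm,
    (isInvertible_mfderiv_extChartAt (by simpa using hy)).inverse_apply_eq]
  exact (mfderiv_extChartAt_extend v hy).symm

/-- Vector fields that are constant in a chart commute. -/
theorem mlieBracket_extend [CompleteSpace EM] (v w : TangentSpace 𝓘(ℂ, EM) x) {y : M}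
    (hy : y ∈ (chartAt EM x).source) :
    VectorField.mlieBracket 𝓘(ℂ, EM) (FiberBundle.extend EM v) (FiberBundle.extend EM w) y = 0 := by
  have hev : ∀ v : TangentSpace 𝓘(ℂ, EM) x, (FiberBundle.extend EM v :
      ∀ y, TangentSpace 𝓘(ℂ, EM) y) =ᶠ[𝓝 y]
      VectorField.mpullback 𝓘(ℂ, EM) 𝓘(ℂ, EM) (extChartAt 𝓘(ℂ, EM) x)
      (constField (chartCoord v)) := fun v => by
    filter_upwards [(chartAt EM x).open_source.mem_nhds hy] with z hz
    exact extend_eq_mpullback v hz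
  have hc : ∀ c : EM, MDifferentiableAt 𝓘(ℂ, EM) (𝓘(ℂ, EM).prod 𝓘(ℂ, EM))
      (fun z : EM => (⟨z, constField c z⟩ : TangentBundle 𝓘(ℂ, EM) EM))
      (extChartAt 𝓘(ℂ, EM) x y) := fun c => by
    rw [mdifferentiableAt_section]
    simpa [constField] using mdifferentiableAt_const
  have hb : ∀ c c' : EM, VectorField.mlieBracket 𝓘(ℂ, EM) (constField c) (constField c') = 0 := by
    intro c c'
    rw [← VectorField.mlieBracketWithin_univ, VectorField.mlieBracketWithin_eq_lieBracketWithin]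
    change VectorField.lieBracketWithin ℂ (fun _ : EM => c) (fun _ : EM => c') Set.univ = 0
    rw [VectorField.lieBracketWithin_univ]
    funext z
    simp [VectorField.lieBracket]
  rw [(hev v).mlieBracket_vectorField_eq (hev w), ← VectorField.mpullback_mlieBracket (n := ω)
    (hc _) (hc _) (contMDiffAt_extChartAt' hy) (by simp), hb]
  simp [VectorField.mpullback_apply]

/-- Derivatives of a function along vector fields that are constant in a chart commute. -/
theorem mvfderiv_extend {U : Set M} (hU : IsOpen U) (hx : x ∈ U) {f : M → ℂ}
    (hf : IsHolFun (EM := EM) U f) :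
    (∀ w : TangentSpace 𝓘(ℂ, EM) x, MDifferentiableAt 𝓘(ℂ, EM) 𝓘(ℂ, ℂ)
      (fun y => mvfderiv 𝓘(ℂ, EM) f y (FiberBundle.extend EM w y)) x) ∧
    ∀ v w : TangentSpace 𝓘(ℂ, EM) x,
      mvfderiv 𝓘(ℂ, EM) (fun y => mvfderiv 𝓘(ℂ, EM) f y (FiberBundle.extend EM w y)) x v =
      mvfderiv 𝓘(ℂ, EM) (fun y => mvfderiv 𝓘(ℂ, EM) f y (FiberBundle.extend EM v y)) x w := by
  set φ := extChartAt 𝓘(ℂ, EM) x with hφ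
  set h : EM → ℂ := f ∘ φ.symm with hh
  have hfx : ContMDiffAt 𝓘(ℂ, EM) 𝓘(ℂ, ℂ) ω f x := ContMDiffOn.contMDiffAt hf (hU.mem_nhds hx)
  have hcd : ContDiffAt ℂ ω h (φ x) := by
    have h1 : ContMDiffAt 𝓘(ℂ, EM) 𝓘(ℂ, EM) ω φ.symm (φ x) :=
      (contMDiffOn_extChartAt_symm x).contMDiffAt (extChartAt_target_mem_nhds x)
    rw [← contMDiffAt_iff_contDiffAt]
    refine ContMDiffAt.comp (φ x) (g := f) (f := φ.symm) ?_ h1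
    rwa [extChartAt_to_inv]
  have hsrc : ∀ᶠ y in 𝓝 x, y ∈ (chartAt EM x).source :=
    (chartAt EM x).open_source.mem_nhds (mem_chart_source EM x)
  have hφd : ∀ y ∈ (chartAt EM x).source, MDifferentiableAt 𝓘(ℂ, EM) 𝓘(ℂ, EM) φ y :=
    fun y hy => mdifferentiableAt_extChartAt hy
  have hφc : Tendsto φ (𝓝 x) (𝓝 (φ x)) := (continuousAt_extChartAt x).tendsto
  have hfh : ∀ᶠ y in 𝓝 x, f y = (h ∘ φ) y := by
    filter_upwards [hsrc] with y hy
    simp only [hh, Function.comp_apply]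
    rw [φ.left_inv (by simpa [hφ] using hy)]
  have hdiff : ∀ᶠ z in 𝓝 (φ x), DifferentiableAt ℂ h z := by
    have := hcd.eventually (by simp)
    filter_upwards [this] with z hz
    exact hz.differentiableAt (by simp)
  have hcomp : ∀ (k : EM → ℂ) (y : M), y ∈ (chartAt EM x).source → DifferentiableAt ℂ k (φ y) →
      ∀ v : TangentSpace 𝓘(ℂ, EM) x, mvfderiv 𝓘(ℂ, EM) (k ∘ φ) y (FiberBundle.extend EM v y) =
        fderiv ℂ k (φ y) (chartCoord v) := by
    intro k y hy hk v
    rw [mvfderiv_comp_apply y hk.mdifferentiableAt (hφd y hy), mfderiv_extChartAt_extend v hy,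
      mvfderiv, mfderiv_eq_fderiv]
    rfl
  have h1 : ∀ w : TangentSpace 𝓘(ℂ, EM) x, ∀ᶠ y in 𝓝 x,
      mvfderiv 𝓘(ℂ, EM) f y (FiberBundle.extend EM w y) =
        ((fun z => fderiv ℂ h z (chartCoord w)) ∘ φ) y := by
    intro w
    filter_upwards [hsrc, eventually_eventually_nhds.2 hfh, hφc.eventually hdiff] with y hy hfy hd
    rw [mvfderiv_congr hfy, hcomp h y hy hd]
    rfl
  have hd2 : DifferentiableAt ℂ (fderiv ℂ h) (φ x) :=
    (hcd.fderiv_right (m := 1) (by simp)).differentiableAt (by simp)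
  -- In the chart the iterated derivative is the second Fréchet derivative of the analytic function
  -- `h`, which is symmetric.
  have h2 : ∀ v w : TangentSpace 𝓘(ℂ, EM) x,
      mvfderiv 𝓘(ℂ, EM) (fun y => mvfderiv 𝓘(ℂ, EM) f y (FiberBundle.extend EM w y)) x v =
        fderiv ℂ (fderiv ℂ h) (φ x) (chartCoord v) (chartCoord w) := by
    intro v w
    have h3 := hcomp (fun z => fderiv ℂ h z (chartCoord w)) x (mem_chart_source EM x)
      (hd2.clm_apply (differentiableAt_const _)) v
    rw [FiberBundle.extend_apply_self] at h3
    have : mvfderiv 𝓘(ℂ, EM) (fun y => mvfderiv 𝓘(ℂ, EM) f y (FiberBundle.extend EM w y)) x =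
        mvfderiv 𝓘(ℂ, EM) ((fun z => fderiv ℂ h z (chartCoord w)) ∘ φ) x :=
      mvfderiv_congr (h1 w)
    rw [this, h3, fderiv_clm_apply hd2 (differentiableAt_const _)]
    simp
  refine ⟨fun w => ?_, fun v w => ?_⟩
  · refine MDifferentiableAt.congr_of_eventuallyEq ?_ (h1 w)
    exact (hd2.clm_apply (differentiableAt_const _)).mdifferentiableAt.comp x
      (hφd x (mem_chart_source EM x))
  rw [h2, h2]
  exact (hcd.isSymmSndFDerivAt (by simp)).eq _ _

end Coordinate

/-! ### Curvature -/

section Curvature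

set_option linter.unusedSectionVars false

variable {EM : Type*} [NormedAddCommGroup EM] [NormedSpace ℂ EM]
  {M : Type*} [TopologicalSpace M] [ChartedSpace EM M] [IsManifold 𝓘(ℂ, EM) ω M]
  {FV : Type*} [NormedAddCommGroup FV] [NormedSpace ℂ FV]
  {V : M → Type*} [TopologicalSpace (Bundle.TotalSpace FV V)]
  [∀ x, AddCommGroup (V x)] [∀ x, Module ℂ (V x)] [∀ x, TopologicalSpace (V x)]
  [∀ x, IsTopologicalAddGroup (V x)] [∀ x, ContinuousSMul ℂ (V x)]
  [FiberBundle FV V] [VectorBundle ℂ FV V]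

open Filter Topology

variable (EM FV) in
/-- The section `s` is differentiable at `x`. -/
abbrev SectionDiffAt (s : ∀ x, V x) (x : M) : Prop :=
  MDifferentiableAt 𝓘(ℂ, EM) (𝓘(ℂ, EM).prod 𝓘(ℂ, FV)) (fun y => Bundle.TotalSpace.mk' FV y (s y)) x

variable {cov : CovariantDerivative 𝓘(ℂ, EM) FV V} {x : M}

theorem cov_congr {s t : ∀ x, V x} (hs : SectionDiffAt EM FV s x) (ht : SectionDiffAt EM FV t x)
    (h : ∀ᶠ y in 𝓝 x, s y = t y) : cov s x = cov t x :=
  cov.isCovariantDerivativeOnUniv.congr_of_eventuallyEq hs ht univ_mem h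

theorem cov_add {s t : ∀ x, V x} (hs : SectionDiffAt EM FV s x) (ht : SectionDiffAt EM FV t x) :
    cov (fun y => s y + t y) x = cov s x + cov t x :=
  cov.isCovariantDerivativeOnUniv.add hs ht

theorem cov_smul {f : M → ℂ} {s : ∀ x, V x} (hf : MDifferentiableAt 𝓘(ℂ, EM) 𝓘(ℂ, ℂ) f x)
    (hs : SectionDiffAt EM FV s x) (v : TangentSpace 𝓘(ℂ, EM) x) :
    cov (fun y => f y • s y) x v = f x • cov s x v + mvfderiv 𝓘(ℂ, EM) f x v • s x := by
  have := cov.isCovariantDerivativeOnUniv.leibniz hs hf (Set.mem_univ x)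
  exact congrArg (fun L => L v) this

theorem cov_const_smul (c : ℂ) {s : ∀ x, V x} (hs : SectionDiffAt EM FV s x) :
    cov (fun y => c • s y) x = c • cov s x :=
  cov.isCovariantDerivativeOnUniv.smul_const c hs

theorem SectionDiffAt.add {s t : ∀ x, V x} (hs : SectionDiffAt EM FV s x)
    (ht : SectionDiffAt EM FV t x) : SectionDiffAt EM FV (fun y => s y + t y) x :=
  mdifferentiableAt_add_section hs ht

theorem SectionDiffAt.smul {f : M → ℂ} {s : ∀ x, V x}
    (hf : MDifferentiableAt 𝓘(ℂ, EM) 𝓘(ℂ, ℂ) f x) (hs : SectionDiffAt EM FV s x) :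
    SectionDiffAt EM FV (fun y => f y • s y) x :=
  hf.smul_section hs

theorem SectionDiffAt.const_smul (c : ℂ) {s : ∀ x, V x} (hs : SectionDiffAt EM FV s x) :
    SectionDiffAt EM FV (fun y => c • s y) x :=
  SectionDiffAt.smul (f := fun _ => c) mdifferentiableAt_const hs

theorem SectionDiffAt.sum {ι : Type*} {S : Finset ι} {s : ι → ∀ x, V x}
    (hs : ∀ i ∈ S, SectionDiffAt EM FV (s i) x) :
    SectionDiffAt EM FV (fun y => ∑ i ∈ S, s i y) x :=
  MDifferentiableAt.sum_section hs

theorem cov_sub {s t : ∀ x, V x} (hs : SectionDiffAt EM FV s x) (ht : SectionDiffAt EM FV t x) :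
    cov (fun y => s y - t y) x = cov s x - cov t x := by
  have := cov_add (cov := cov) hs (ht.const_smul (-1))
  simp only [neg_smul, one_smul, ← sub_eq_add_neg] at this
  rw [this, sub_eq_add_neg]
  congr 1
  simpa using cov_const_smul (cov := cov) (-1) ht

theorem cov_sum {ι : Type*} (S : Finset ι) {s : ι → ∀ x, V x}
    (hs : ∀ i ∈ S, SectionDiffAt EM FV (s i) x) :
    cov (fun y => ∑ i ∈ S, s i y) x = ∑ i ∈ S, cov (s i) x := by
  classical
  induction S using Finset.induction_on with
  | empty =>
    simp only [Finset.sum_empty]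
    exact cov.isCovariantDerivativeOnUniv.zero
  | insert i S hi ih =>
    have hS : ∀ j ∈ S, SectionDiffAt EM FV (s j) x := fun j hj => hs j (Finset.mem_insert_of_mem hj)
    simp only [Finset.sum_insert hi]
    rw [cov_add (hs i (Finset.mem_insert_self i S)) (SectionDiffAt.sum hS), ih hS]

theorem cov_isHolSection (hcov : IsHolConnection cov) {U : Set M} (hU : IsOpen U) {s : ∀ x, V x}
    (hs : IsHolSection (EM := EM) FV U s) {X : ∀ y : M, TangentSpace 𝓘(ℂ, EM) y}
    (hX : IsHolVectorField U X) : IsHolSection (EM := EM) FV U fun y => cov s y (X y) :=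
  ContMDiffOn.clm_bundle_apply ((hcov U hU).contMDiff hs) hX

theorem cov_sectionDiffAt (hcov : IsHolConnection cov) {U : Set M} (hU : IsOpen U) {s : ∀ x, V x}
    (hs : IsHolSection (EM := EM) FV U s) (hx : x ∈ U) {X : ∀ y : M, TangentSpace 𝓘(ℂ, EM) y}
    (hX : SectionDiffAt EM EM X x) : SectionDiffAt EM FV (fun y => cov s y (X y)) x :=
  MDifferentiableAt.clm_bundle_apply
    ((((hcov U hU).contMDiff hs).contMDiffAt (hU.mem_nhds hx)).mdifferentiableAt (by simp)) hX

/-- `∇_X ∇_Y s - ∇_Y ∇_X s - ∇_{[X,Y]} s`. -/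
def curvatureOperator (cov : CovariantDerivative 𝓘(ℂ, EM) FV V)
    (X Y : ∀ y : M, TangentSpace 𝓘(ℂ, EM) y) (s : ∀ x, V x) (x : M) : V x :=
  cov (fun y => cov s y (Y y)) x (X x) - cov (fun y => cov s y (X y)) x (Y x) -
    cov s x (VectorField.mlieBracket 𝓘(ℂ, EM) X Y x)

theorem curvature_eq (x : M) (v : Fin 2 → TangentSpace 𝓘(ℂ, EM) x) (u : V x) :
    curvature cov x v u = curvatureOperator cov (FiberBundle.extend EM (v 0))
      (FiberBundle.extend EM (v 1)) (FiberBundle.extend FV u) x := by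
  rw [curvatureOperator, FiberBundle.extend_apply_self, FiberBundle.extend_apply_self]
  rfl

theorem curvatureOperator_swap (X Y : ∀ y : M, TangentSpace 𝓘(ℂ, EM) y) (s : ∀ x, V x) (x : M) :
    curvatureOperator cov X Y s x = -curvatureOperator cov Y X s x := by
  rw [curvatureOperator, curvatureOperator, VectorField.mlieBracket_swap_apply, map_neg]
  abel

variable [CompleteSpace EM]

/-- The derivative of `f` enters through `∇_Y (f ∇_X s)` and through `[fX, Y]`; the two
contributions cancel. -/
theorem curvatureOperator_tensorialAt (hcov : IsHolConnection cov) {U : Set M} (hU : IsOpen U)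
    (hx : x ∈ U) {s : ∀ x, V x} (hs : IsHolSection (EM := EM) FV U s)
    (Y : ∀ y : M, TangentSpace 𝓘(ℂ, EM) y) :
    TensorialAt 𝓘(ℂ, EM) EM (fun X => curvatureOperator cov X Y s x) x where
  smul {f X} hf hX := by
    have h1 := cov_smul (cov := cov) hf (cov_sectionDiffAt hcov hU hs hx hX) (Y x)
    have h2 : (fun y => cov s y ((f • X) y)) = fun y => f y • cov s y (X y) :=
      funext fun y => map_smul _ _ _
    simp only [curvatureOperator]
    rw [h2, h1, VectorField.mlieBracket_smul_left hf hX]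
    simp only [map_add, map_neg, map_smul, Pi.smul_apply', neg_smul]
    module
  add {X X'} hX hX' := by
    have h1 := cov_add (cov := cov) (cov_sectionDiffAt hcov hU hs hx hX)
      (cov_sectionDiffAt hcov hU hs hx hX')
    have h2 : (fun y => cov s y ((X + X') y)) = fun y => cov s y (X y) + cov s y (X' y) :=
      funext fun y => map_add _ _ _
    simp only [curvatureOperator]
    rw [h2, h1, VectorField.mlieBracket_add_left hX hX']
    simp only [map_add, Pi.add_apply, add_apply]
    abel

theorem curvatureOperator_tensorialAt_right (hcov : IsHolConnection cov) {U : Set M}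
    (hU : IsOpen U) (hx : x ∈ U) {s : ∀ x, V x} (hs : IsHolSection (EM := EM) FV U s)
    (X : ∀ y : M, TangentSpace 𝓘(ℂ, EM) y) :
    TensorialAt 𝓘(ℂ, EM) EM (fun Y => curvatureOperator cov X Y s x) x := by
  have h := curvatureOperator_tensorialAt hcov hU hx hs X
  simp only [fun Y => curvatureOperator_swap (cov := cov) X Y s x]
  exact ⟨fun hf hY => by rw [h.smul hf hY, smul_neg], fun hY hY' => by rw [h.add hY hY', neg_add]⟩

variable [FiniteDimensional ℂ EM]

theorem curvatureOperator_congr_fields (hcov : IsHolConnection cov) {U : Set M}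
    (hU : IsOpen U) (hx : x ∈ U) {s : ∀ x, V x} (hs : IsHolSection (EM := EM) FV U s)
    {X X' Y Y' : ∀ y : M, TangentSpace 𝓘(ℂ, EM) y} (hX : SectionDiffAt EM EM X x)
    (hX' : SectionDiffAt EM EM X' x) (hY : SectionDiffAt EM EM Y x)
    (hY' : SectionDiffAt EM EM Y' x) (hXX : X x = X' x) (hYY : Y x = Y' x) :
    curvatureOperator cov X Y s x = curvatureOperator cov X' Y' s x :=
  TensorialAt.pointwise₂ (Φ := fun X Y => curvatureOperator cov X Y s x)
    (fun Y _ => curvatureOperator_tensorialAt hcov hU hx hs Y)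
    (fun X _ => curvatureOperator_tensorialAt_right hcov hU hx hs X) hX hX' hY hY' hXX hYY

theorem curvatureOperator_congr_section (hcov : IsHolConnection cov) {U : Set M}
    (hU : IsOpen U) (hx : x ∈ U) {s t : ∀ x, V x} (hs : IsHolSection (EM := EM) FV U s)
    (ht : IsHolSection (EM := EM) FV U t) (hst : ∀ y ∈ U, s y = t y)
    {X Y : ∀ y : M, TangentSpace 𝓘(ℂ, EM) y} (hX : SectionDiffAt EM EM X x)
    (hY : SectionDiffAt EM EM Y x) :
    curvatureOperator cov X Y s x = curvatureOperator cov X Y t x := by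
  have h1 : ∀ y ∈ U, cov s y = cov t y := fun y hy => cov_congr (hs.mdifferentiableAt hU hy)
    (ht.mdifferentiableAt hU hy) (Filter.mem_of_superset (hU.mem_nhds hy) hst)
  have h2 : ∀ {X : ∀ y : M, TangentSpace 𝓘(ℂ, EM) y}, SectionDiffAt EM EM X x →
      cov (fun y => cov s y (X y)) x = cov (fun y => cov t y (X y)) x := fun hX =>
    cov_congr (cov_sectionDiffAt hcov hU hs hx hX) (cov_sectionDiffAt hcov hU ht hx hX)
      (Filter.mem_of_superset (hU.mem_nhds hx) fun y hy => by
        change cov s y _ = cov t y _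
        rw [h1 y hy])
  rw [curvatureOperator, curvatureOperator, h2 hX, h2 hY, h1 x hx]

theorem extend_sectionDiffAt (v : TangentSpace 𝓘(ℂ, EM) x) :
    SectionDiffAt EM EM (FiberBundle.extend EM v : ∀ y, TangentSpace 𝓘(ℂ, EM) y) x :=
  (extend_isHolSection v).mdifferentiableAt (Bundle.Trivialization.open_baseSet _) (mem_baseSet x)

/-- For commuting fields, the terms with first derivatives of `f` are symmetric in `v` and `w`, and
those with second derivatives are too by `mvfderiv_extend`. Both cancel in the commutator. -/
theorem curvatureOperator_smul (hcov : IsHolConnection cov) {U : Set M}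
    (hU : IsOpen U) (hx : x ∈ U) {f : M → ℂ} (hf : IsHolFun (EM := EM) U f) {s : ∀ x, V x}
    (hs : IsHolSection (EM := EM) FV U s) (v w : TangentSpace 𝓘(ℂ, EM) x) :
    curvatureOperator cov (FiberBundle.extend EM v) (FiberBundle.extend EM w)
      (fun y => f y • s y) x = f x • curvatureOperator cov (FiberBundle.extend EM v)
      (FiberBundle.extend EM w) s x := by
  obtain ⟨hfd, hfc⟩ := mvfderiv_extend hU hx hf
  have hfx := hf.mdifferentiableAt hU hx
  have hsx := hs.mdifferentiableAt hU hx
  have h1 : ∀ v w : TangentSpace 𝓘(ℂ, EM) x,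
      cov (fun y => cov (fun y => f y • s y) y (FiberBundle.extend EM w y)) x v =
        f x • cov (fun y => cov s y (FiberBundle.extend EM w y)) x v +
        mvfderiv 𝓘(ℂ, EM) f x v • cov s x w + (mvfderiv 𝓘(ℂ, EM) f x w • cov s x v +
        mvfderiv 𝓘(ℂ, EM) (fun y => mvfderiv 𝓘(ℂ, EM) f y (FiberBundle.extend EM w y)) x v •
          s x) := by
    intro v w
    have hd := cov_sectionDiffAt hcov hU hs hx (extend_sectionDiffAt w)
    rw [cov_congr (cov_sectionDiffAt hcov hU (IsHolSection.smul hf hs) hx (extend_sectionDiffAt w))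
      ((SectionDiffAt.smul hfx hd).add (SectionDiffAt.smul (hfd w) hsx))
      (Filter.mem_of_superset (hU.mem_nhds hx) fun y hy =>
        cov_smul (hf.mdifferentiableAt hU hy) (hs.mdifferentiableAt hU hy) _),
      cov_add (SectionDiffAt.smul hfx hd) (SectionDiffAt.smul (hfd w) hsx), add_apply,
      cov_smul hfx hd, cov_smul (hfd w) hsx, FiberBundle.extend_apply_self]
  have hb := mlieBracket_extend v w (mem_chart_source EM x)
  simp only [curvatureOperator, hb, map_zero, sub_zero, FiberBundle.extend_apply_self, h1,
    hfc w v]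
  module

theorem curvatureOperator_sum (hcov : IsHolConnection cov) {U : Set M}
    (hU : IsOpen U) (hx : x ∈ U) {ι : Type*} (S : Finset ι) {s : ι → ∀ x, V x}
    (hs : ∀ i, IsHolSection (EM := EM) FV U (s i)) {X Y : ∀ y : M, TangentSpace 𝓘(ℂ, EM) y}
    (hX : SectionDiffAt EM EM X x) (hY : SectionDiffAt EM EM Y x) :
    curvatureOperator cov X Y (fun y => ∑ i ∈ S, s i y) x =
      ∑ i ∈ S, curvatureOperator cov X Y (s i) x := by
  have h1 : ∀ y ∈ U, cov (fun y => ∑ i ∈ S, s i y) y = ∑ i ∈ S, cov (s i) y := fun y hy =>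
    cov_sum S fun i _ => (hs i).mdifferentiableAt hU hy
  have h2 : ∀ {X : ∀ y : M, TangentSpace 𝓘(ℂ, EM) y}, SectionDiffAt EM EM X x →
      cov (fun y => cov (fun y => ∑ i ∈ S, s i y) y (X y)) x =
        ∑ i ∈ S, cov (fun y => cov (s i) y (X y)) x := fun {X} hX => by
    have h3 : ∀ i ∈ S, SectionDiffAt EM FV (fun y => cov (s i) y (X y)) x := fun i _ =>
      cov_sectionDiffAt hcov hU (hs i) hx hX
    rw [← cov_sum S h3]
    refine cov_congr (cov_sectionDiffAt hcov hU (IsHolSection.sum fun i _ => hs i) hx hX)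
      (SectionDiffAt.sum h3) (Filter.mem_of_superset (hU.mem_nhds hx) fun y hy => ?_)
    change cov (fun y => ∑ i ∈ S, s i y) y _ = _
    rw [h1 y hy]
    simp
  simp only [curvatureOperator]
  rw [h2 hX, h2 hY, h1 x hx]
  simp

variable [FiniteDimensional ℂ FV] [ContMDiffVectorBundle ω FV V 𝓘(ℂ, EM)]

/-- The curvature may be computed with any holomorphic extensions of the arguments. -/
theorem curvature_eq_curvatureOperator (hcov : IsHolConnection cov) {U : Set M}
    (hU : IsOpen U) (hx : x ∈ U) {s : ∀ x, V x} (hs : IsHolSection (EM := EM) FV U s)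
    {X Y : ∀ y : M, TangentSpace 𝓘(ℂ, EM) y} (hX : SectionDiffAt EM EM X x)
    (hY : SectionDiffAt EM EM Y x) :
    curvature cov x ![X x, Y x] (s x) = curvatureOperator cov X Y s x := by
  classical
  rw [curvatureOperator_congr_fields hcov hU hx hs hX (extend_sectionDiffAt (X x)) hY
    (extend_sectionDiffAt (Y x)) (FiberBundle.extend_apply_self ..).symm
    (FiberBundle.extend_apply_self ..).symm, curvature_eq]
  set t : ∀ y, V y := FiberBundle.extend FV (s x) with ht
  set b := Module.finBasis ℂ FV
  set e := (trivializationAt FV V x).localFrame b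
  have he := isHolFrame_localFrame (EM := EM) (V := V) x b
  obtain ⟨W, hW, hxW, hWU, hco⟩ := he.exists_coeff (Bundle.Trivialization.open_baseSet _)
    (mem_baseSet x)
  have hUW : IsOpen (U ∩ W) := hU.inter hW
  -- In a local frame the operator sees only the coefficients of the section at `x`, and these agree
  -- for `s` and for the extension `t` of `s x`.
  have key : ∀ s : ∀ y, V y, IsHolSection (EM := EM) FV (U ∩ W) s →
      ∃ c : Fin (Module.finrank ℂ FV) → ℂ, s x = ∑ i, c i • e i x ∧
      curvatureOperator cov (FiberBundle.extend EM (X x)) (FiberBundle.extend EM (Y x)) s x =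
      ∑ i, c i • curvatureOperator cov (FiberBundle.extend EM (X x)) (FiberBundle.extend EM (Y x))
        (e i) x := by
    intro s hs
    obtain ⟨f, hf, hsf⟩ := hco (U ∩ W) hUW Set.inter_subset_right s hs
    have hfe : ∀ i, IsHolSection (EM := EM) FV (U ∩ W) fun y => f i y • e i y := fun i =>
      IsHolSection.smul (hf i) ((he.holomorphic i).mono fun y hy => hWU hy.2)
    refine ⟨fun i => f i x, hsf x ⟨hx, hxW⟩, ?_⟩
    rw [curvatureOperator_congr_section hcov hUW ⟨hx, hxW⟩ hs (IsHolSection.sum fun i _ => hfe i)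
      hsf (extend_sectionDiffAt _) (extend_sectionDiffAt _), curvatureOperator_sum hcov hUW
      ⟨hx, hxW⟩ _ hfe (extend_sectionDiffAt _) (extend_sectionDiffAt _)]
    exact Finset.sum_congr rfl fun i _ => curvatureOperator_smul hcov hUW ⟨hx, hxW⟩ (hf i)
      ((he.holomorphic i).mono fun y hy => hWU hy.2) _ _
  obtain ⟨c, hc, hcs⟩ := key s (hs.mono Set.inter_subset_left)
  obtain ⟨c', hc', hct⟩ := key t ((extend_isHolSection (s x)).mono fun y hy => hWU hy.2)
  have hst : t x = s x := FiberBundle.extend_apply_self ..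
  have hcc : c = c' := by
    obtain ⟨B, hB⟩ := he.basis x (mem_baseSet x)
    have h0 : ∑ i, (c i - c' i) • B i = 0 := by
      simp only [sub_smul, Finset.sum_sub_distrib, hB]
      rw [sub_eq_zero]
      exact (hc.symm.trans hst.symm).trans hc'
    funext i
    exact sub_eq_zero.1 (Fintype.linearIndependent_iff.1 B.linearIndependent _ h0 i)
  rw [hcs, hcc, ← hct]
  rfl

end Curvature

/-! ### The Bianchi identity -/

section Bianchi

set_option linter.unusedSectionVars false

variable {EM : Type*} [NormedAddCommGroup EM] [NormedSpace ℂ EM] [FiniteDimensional ℂ EM]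
  [CompleteSpace EM]
  {M : Type*} [TopologicalSpace M] [ChartedSpace EM M] [IsManifold 𝓘(ℂ, EM) ω M]
  {FV : Type*} [NormedAddCommGroup FV] [NormedSpace ℂ FV] [FiniteDimensional ℂ FV]
  {V : M → Type*} [TopologicalSpace (Bundle.TotalSpace FV V)]
  [∀ x, AddCommGroup (V x)] [∀ x, Module ℂ (V x)] [∀ x, TopologicalSpace (V x)]
  [∀ x, IsTopologicalAddGroup (V x)] [∀ x, ContinuousSMul ℂ (V x)]
  [FiberBundle FV V] [VectorBundle ℂ FV V] [ContMDiffVectorBundle ω FV V 𝓘(ℂ, EM)]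
  {cov : CovariantDerivative 𝓘(ℂ, EM) FV V} {x : M}

open Filter Topology

theorem curvature_add (hcov : IsHolConnection cov) (v v' w : TangentSpace 𝓘(ℂ, EM) x) :
    curvature cov x ![v + v', w] = curvature cov x ![v, w] + curvature cov x ![v', w] := by
  funext u
  have ho := Bundle.Trivialization.open_baseSet (trivializationAt FV V x)
  have hs := extend_isHolSection (EM := EM) (FV := FV) u
  have hX := fun v : TangentSpace 𝓘(ℂ, EM) x => extend_sectionDiffAt v
  refine (curvature_eq x ![v + v', w] u).trans ?_
  refine Eq.trans ?_ (congrArg₂ (· + ·) (curvature_eq x ![v, w] u)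
    (curvature_eq x ![v', w] u)).symm
  simp only [Matrix.cons_val_zero, Matrix.cons_val_one]
  rw [← (curvatureOperator_tensorialAt hcov ho (mem_baseSet x) hs _).add (hX v) (hX v')]
  refine curvatureOperator_congr_fields hcov ho (mem_baseSet x) hs (hX _) ((hX v).add (hX v'))
    (hX w) (hX w) ?_ rfl
  simp [FiberBundle.extend_apply_self]

theorem curvature_smul (hcov : IsHolConnection cov) (c : ℂ) (v w : TangentSpace 𝓘(ℂ, EM) x) :
    curvature cov x ![c • v, w] = c • curvature cov x ![v, w] := by
  funext u
  have ho := Bundle.Trivialization.open_baseSet (trivializationAt FV V x)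
  have hs := extend_isHolSection (EM := EM) (FV := FV) u
  have hX := fun v : TangentSpace 𝓘(ℂ, EM) x => extend_sectionDiffAt v
  refine (curvature_eq x ![c • v, w] u).trans ?_
  refine Eq.trans ?_ (congrArg (c • ·) (curvature_eq x ![v, w] u)).symm
  simp only [Matrix.cons_val_zero, Matrix.cons_val_one]
  rw [← (curvatureOperator_tensorialAt hcov ho (mem_baseSet x) hs _).smul (f := fun _ => c)
    mdifferentiableAt_const (hX v)]
  refine curvatureOperator_congr_fields hcov ho (mem_baseSet x) hs (hX _)
    ((hX v).const_smul c) (hX w) (hX w) ?_ rfl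
  simp [FiberBundle.extend_apply_self]

theorem curvature_swap (v w : TangentSpace 𝓘(ℂ, EM) x) :
    curvature cov x ![v, w] = -curvature cov x ![w, v] := by
  funext u
  refine (curvature_eq x ![v, w] u).trans ?_
  refine Eq.trans ?_ (congrArg (- ·) (curvature_eq x ![w, v] u)).symm
  exact curvatureOperator_swap _ _ _ _

variable (cov x) in
/-- The curvature as a bilinear map. -/
def curvatureForm (hcov : IsHolConnection cov) :
    TangentSpace 𝓘(ℂ, EM) x →ₗ[ℂ] TangentSpace 𝓘(ℂ, EM) x →ₗ[ℂ] (V x → V x) :=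
  LinearMap.mk₂ ℂ (fun v w => curvature cov x ![v, w]) (curvature_add hcov)
    (curvature_smul hcov)
    (fun v w w' => by
      rw [curvature_swap, curvature_add hcov, neg_add, ← curvature_swap, ← curvature_swap])
    (fun c v w => by rw [curvature_swap, curvature_smul hcov, ← smul_neg, ← curvature_swap])

theorem twoForm_curvatureForm (hcov : IsHolConnection cov) :
    twoForm (curvatureForm cov x hcov) = curvature cov x := rfl

theorem curvatureForm_self (hcov : IsHolConnection cov) (v : TangentSpace 𝓘(ℂ, EM) x) :
    curvatureForm cov x hcov v v = 0 := by
  have h : curvatureForm cov x hcov v v = -curvatureForm cov x hcov v v := curvature_swap v v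
  rw [eq_neg_iff_add_eq_zero, ← two_smul ℂ] at h
  exact (smul_eq_zero.1 h).resolve_left two_ne_zero

theorem extend_isHolVectorField (v : TangentSpace 𝓘(ℂ, EM) x) :
    IsHolVectorField (chartAt EM x).source (FiberBundle.extend EM v) := by
  have := extend_isHolSection (EM := EM) (FV := EM) (V := fun y : M => TangentSpace 𝓘(ℂ, EM) y) v
  rwa [TangentBundle.trivializationAt_baseSet] at this

/-- At `y ≠ x` the definition of `curvature` uses extensions from `y`, not from `x`. Tensoriality
permits the fields extended from `x`, whose bracket vanishes on the whole chart domain, so that the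
identity can be differentiated at `x`. -/
theorem curvature_extend (hcov : IsHolConnection cov) {U : Set M} (hU : IsOpen U)
    {s : ∀ y, V y} (hs : IsHolSection (EM := EM) FV U s) (v w : TangentSpace 𝓘(ℂ, EM) x) {y : M}
    (hy : y ∈ U) (hyx : y ∈ (chartAt EM x).source) :
    curvature cov y ![FiberBundle.extend EM v y, FiberBundle.extend EM w y] (s y) =
      cov (fun z => cov s z (FiberBundle.extend EM w z)) y (FiberBundle.extend EM v y) -
      cov (fun z => cov s z (FiberBundle.extend EM v z)) y (FiberBundle.extend EM w y) := by
  have hX := fun v : TangentSpace 𝓘(ℂ, EM) x =>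
    (extend_isHolVectorField v).mdifferentiableAt (chartAt EM x).open_source hyx
  rw [curvature_eq_curvatureOperator hcov hU hy hs (hX v) (hX w), curvatureOperator,
    mlieBracket_extend v w hyx, map_zero, sub_zero]

theorem curvature_extend_isHolSection (hcov : IsHolConnection cov) {U : Set M} (hU : IsOpen U)
    {s : ∀ y, V y} (hs : IsHolSection (EM := EM) FV U s) (v w : TangentSpace 𝓘(ℂ, EM) x) :
    IsHolSection (EM := EM) FV (U ∩ (chartAt EM x).source) fun y =>
      curvature cov y ![FiberBundle.extend EM v y, FiberBundle.extend EM w y] (s y) := by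
  have hW : IsOpen (U ∩ (chartAt EM x).source) := hU.inter (chartAt EM x).open_source
  have hX := fun v : TangentSpace 𝓘(ℂ, EM) x => (extend_isHolVectorField v).mono
    (U' := U ∩ (chartAt EM x).source) Set.inter_subset_right
  have hN := fun v w => cov_isHolSection hcov hW
    (cov_isHolSection hcov hW (hs.mono Set.inter_subset_left) (hX w)) (hX v)
  refine ContMDiffOn.congr ((hN v w).sub (hN w v)) fun y hy => ?_
  exact congrArg (Bundle.TotalSpace.mk' FV y) (curvature_extend hcov hU hs v w hy.1 hy.2)

/-- `K a b c` is `(∇_a F)(b, c)` applied to `s`, for fields that commute. As `F(b, c) = [∇_b, ∇_c]`,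
it equals `[∇_a, [∇_b, ∇_c]] s`, and the cyclic sum vanishes by the Jacobi identity. -/
theorem bianchi (hcov : IsHolConnection cov) {U : Set M} (hU : IsOpen U) (hx : x ∈ U)
    {s : ∀ y, V y} (hs : IsHolSection (EM := EM) FV U s) :
    let K := fun a b c : TangentSpace 𝓘(ℂ, EM) x =>
      cov (fun y => curvature cov y ![FiberBundle.extend EM b y, FiberBundle.extend EM c y] (s y))
        x a - curvature cov x ![b, c] (cov s x a)
    ∀ a b c, K a b c + K b c a + K c a b = 0 := by
  intro K a b c
  have hW : IsOpen (U ∩ (chartAt EM x).source) := hU.inter (chartAt EM x).open_source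
  have hxW : x ∈ U ∩ (chartAt EM x).source := ⟨hx, mem_chart_source EM x⟩
  have hX := fun v : TangentSpace 𝓘(ℂ, EM) x => (extend_isHolVectorField v).mono
    (U' := U ∩ (chartAt EM x).source) Set.inter_subset_right
  have hN := fun v => cov_isHolSection hcov hW (hs.mono Set.inter_subset_left) (hX v)
  have hNN := fun v w => cov_isHolSection hcov hW (hN w) (hX v)
  have hK : ∀ a b c, K a b c =
      cov (fun y => cov (fun z => cov s z (FiberBundle.extend EM c z)) y
        (FiberBundle.extend EM b y)) x a -
      cov (fun y => cov (fun z => cov s z (FiberBundle.extend EM b z)) y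
        (FiberBundle.extend EM c y)) x a -
      (cov (fun y => cov (fun z => cov s z (FiberBundle.extend EM a z)) y
        (FiberBundle.extend EM c y)) x b -
      cov (fun y => cov (fun z => cov s z (FiberBundle.extend EM a z)) y
        (FiberBundle.extend EM b y)) x c) := by
    intro a b c
    have h1 := curvature_extend hcov hW (hN a) b c hxW hxW.2
    simp only [FiberBundle.extend_apply_self] at h1
    have h2 := cov_congr (cov := cov)
      ((curvature_extend_isHolSection hcov hU hs b c).mdifferentiableAt hW hxW)
      (((hNN b c).sub (hNN c b)).mdifferentiableAt hW hxW)
      (Filter.mem_of_superset (hW.mem_nhds hxW) fun y hy =>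
        curvature_extend hcov hU hs b c hy.1 hy.2)
    rw [cov_sub ((hNN b c).mdifferentiableAt hW hxW) ((hNN c b).mdifferentiableAt hW hxW)] at h2
    simp only [K]
    rw [h1, h2]
    rfl
  rw [hK, hK, hK]
  abel

end Bianchi

/-! ### Holomorphy of the Hodge operator -/

section HodgeHolomorphic

set_option linter.unusedSectionVars false

variable {EM : Type*} [NormedAddCommGroup EM] [NormedSpace ℂ EM] [FiniteDimensional ℂ EM]
  {M : Type*} [TopologicalSpace M] [ChartedSpace EM M] [IsManifold 𝓘(ℂ, EM) ω M]
  {g : ∀ x : M, TangentSpace 𝓘(ℂ, EM) x →ₗ[ℂ] TangentSpace 𝓘(ℂ, EM) x →ₗ[ℂ] ℂ}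

theorem IsHolFrame.dualFrame (hg : IsComplexRiemannian g) {ι : Type*} [Fintype ι] [DecidableEq ι]
    {U : Set M} (hU : IsOpen U) {c : ι → ∀ x : M, TangentSpace 𝓘(ℂ, EM) x}
    (hc : IsHolFrame EM EM U c) (i : ι) :
    IsHolVectorField U fun y => GrassmannYM.dualFrame (g y) (fun i => c i y) i := by
  have hgc : ∀ k l, IsHolFun (EM := EM) U fun y => g y (c k y) (c l y) := fun k l =>
    hg.holomorphic U hU (Set.subset_univ U) ![c k, c l]
      (by intro i; fin_cases i; exacts [hc.holomorphic k, hc.holomorphic l])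
  have hdet : ∀ y ∈ U, (Matrix.of fun k l => g y (c k y) (c l y)).det ≠ 0 := fun y hy => by
    obtain ⟨B, hB⟩ := hc.basis y hy
    simpa only [hB] using gram_det_ne_zero (hg.nondegenerate y) B
  exact IsHolSection.sum fun j _ => IsHolSection.smul
    (IsHolFun.matrix_inv (A := fun y => Matrix.of fun k l => g y (c k y) (c l y)) hgc hdet i j)
    (hc.holomorphic j)

/-- By `hodgeStar_eq` the operator may be computed in a holomorphic frame and its dual frame, where
every term is holomorphic. -/
theorem isHolForm_hodgeStar (hg : IsComplexRiemannian g) {n p q : ℕ} (h : p + q = n) {U : Set M}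
    {vol : ∀ x : M, TangentSpace 𝓘(ℂ, EM) x [⋀^Fin n]→ₗ[ℂ] ℂ}
    (hvol : IsHolForm U fun x v => vol x v)
    {Ω : ∀ x : M, TangentSpace 𝓘(ℂ, EM) x [⋀^Fin p]→ₗ[ℂ] ℂ} (hΩ : IsHolForm U fun x v => Ω x v) :
    IsHolForm U fun x => hodgeStar (g x) (vol x) p q (Ω x) := by
  classical
  intro U' hU' hU'U X hX
  refine IsHolFun.of_locally fun x hx => ?_
  obtain ⟨W, hW, hxW, c, hc⟩ := exists_isHolFrame (EM := EM) (FV := EM)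
    (V := fun x : M => TangentSpace 𝓘(ℂ, EM) x) x (Module.finBasis ℂ EM)
  have hUW := hU'.inter hW
  have hc' := hc.mono (U' := U' ∩ W) Set.inter_subset_right
  have hsub : U' ∩ W ⊆ U := fun y hy => hU'U hy.1
  refine ⟨U' ∩ W, hUW, ⟨hx, hxW⟩, ?_⟩
  refine IsHolFun.congr (f := fun y => (p.factorial : ℂ)⁻¹ * ∑ I : Fin p → _,
    vol y (fun k => (Fin.append (fun i => c (I i)) X (Fin.cast h.symm k)) y) *
      Ω y (fun i => dualFrame (g y) (fun i => c i y) (I i))) ?_ fun y hy => ?_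
  · refine (IsHolFun.const _).mul (IsHolFun.sum fun I _ => ?_)
    refine (hvol _ hUW hsub _ fun k => ?_).mul
      (hΩ _ hUW hsub (fun i y => dualFrame (g y) (fun i => c i y) (I i))
        fun i => hc'.dualFrame hg hUW _)
    refine Fin.addCases (fun i => ?_) (fun j => ?_) (Fin.cast h.symm k)
    · rw [Fin.append_left]
      exact hc'.holomorphic _
    · rw [Fin.append_right]
      exact (hX j).mono Set.inter_subset_left
  · obtain ⟨B, hB⟩ := hc.basis y hy.2
    have hBc : ⇑B = fun i => c i y := funext hB
    have := hodgeStar_eq (hg.nondegenerate y) (dualPair_dualFrame (hg.nondegenerate y) B) h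
      (vol y).toMultilinearMap (Ω y).toMultilinearMap (fun j => X j y)
    rw [hBc] at this
    refine this.trans ?_
    rw [smul_eq_mul]
    refine congrArg _ (Finset.sum_congr rfl fun I _ => congrArg₂ (· * ·) ?_ rfl)
    refine congrArg (vol y) (funext fun k => ?_)
    refine Fin.addCases (fun i => ?_) (fun j => ?_) (Fin.cast h.symm k)
    · simp only [Fin.append_left]
    · simp only [Fin.append_right]

end HodgeHolomorphic

/-! ### The Yang–Mills equation -/

section AltSumMap

variable {V W A : Type*} [AddCommGroup A] [Module ℂ A]

theorem altSum_altSum_comp {k : ℕ} (f : W → W → (Fin k → W) → A) (φ : V → W)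
    (v : Fin (k + 2) → V) :
    altSum (fun x => altSum (f x)) (fun j => φ (v j)) =
      altSum (fun x => altSum fun y w => f (φ x) (φ y) fun j => φ (w j)) v :=
  rfl

theorem altSum_apply {ι : Type*} {k : ℕ} (f : V → (Fin k → V) → ι → A) (v : Fin (k + 1) → V)
    (i : ι) : altSum f v i = altSum (fun x w => f x w i) v := by
  simp [altSum]

theorem wedge_smul [AddCommGroup V] [Module ℂ V] {p q : ℕ} (l : ℂ) (α : (Fin p → V) → ℂ)
    (β : (Fin q → V) → A) : wedge (l • α) β = l • wedge α β := by
  funext v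
  simp only [wedge, Pi.smul_apply, smul_eq_mul, mul_smul]
  rw [smul_comm l, Finset.smul_sum (r := l)]
  exact congrArg _ (Finset.sum_congr rfl fun σ _ => smul_comm _ _ _)

end AltSumMap

/-! ### ### The exterior covariant derivative of `∗F` -/

section YangMills

set_option linter.unusedSectionVars false

variable {EM : Type*} [NormedAddCommGroup EM] [NormedSpace ℂ EM] [FiniteDimensional ℂ EM]
  [CompleteSpace EM]
  {M : Type*} [TopologicalSpace M] [ChartedSpace EM M] [IsManifold 𝓘(ℂ, EM) ω M]
  {FV : Type*} [NormedAddCommGroup FV] [NormedSpace ℂ FV] [FiniteDimensional ℂ FV]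
  {V : M → Type*} [TopologicalSpace (Bundle.TotalSpace FV V)]
  [∀ x, AddCommGroup (V x)] [∀ x, Module ℂ (V x)] [∀ x, TopologicalSpace (V x)]
  [∀ x, IsTopologicalAddGroup (V x)] [∀ x, ContinuousSMul ℂ (V x)]
  [FiberBundle FV V] [VectorBundle ℂ FV V] [ContMDiffVectorBundle ω FV V 𝓘(ℂ, EM)]
  {cov : CovariantDerivative 𝓘(ℂ, EM) FV V} {x : M}

open Filter Topology

theorem SectionDiffAt.altSum {X : Type*} {k : ℕ} {f : X → (Fin k → X) → ∀ y, V y}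
    (hf : ∀ a w, SectionDiffAt EM FV (f a w) x) (v : Fin (k + 1) → X) :
    SectionDiffAt EM FV (fun y => GrassmannYM.altSum (fun a w => f a w y) v) x :=
  SectionDiffAt.sum fun _ _ => (hf _ _).const_smul _

theorem cov_altSum {X : Type*} {k : ℕ} {f : X → (Fin k → X) → ∀ y, V y}
    (hf : ∀ a w, SectionDiffAt EM FV (f a w) x) (v : Fin (k + 1) → X)
    (z : TangentSpace 𝓘(ℂ, EM) x) :
    cov (fun y => altSum (fun a w => f a w y) v) x z = altSum (fun a w => cov (f a w) x z) v := by
  have h := cov_sum (cov := cov) Finset.univ (s := fun (i : Fin (k + 1)) y =>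
    (-1 : ℂ) ^ (i : ℕ) • f (v i) (i.removeNth v) y) fun i _ => (hf _ _).const_smul _
  refine (congrArg (fun L => L z) h).trans ?_
  rw [sum_apply]
  exact Finset.sum_congr rfl fun i _ => congrArg (fun L => L z) (cov_const_smul _ (hf _ _))

/-- The operator is local. Differentiability is required of `β` only, since it passes to `α` by
equality near `x`. -/
theorem extDNabla_congr {p : ℕ}
    {α β : ∀ x : M, (Fin p → TangentSpace 𝓘(ℂ, EM) x) → (V x → V x)} {U : Set M} (hU : IsOpen U)
    (hx : x ∈ U) (h : ∀ y ∈ U, α y = β y)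
    (hβ : ∀ (w : Fin p → TangentSpace 𝓘(ℂ, EM) x) (u : V x), SectionDiffAt EM FV (fun y =>
      β y (fun j => FiberBundle.extend EM (w j) y) (FiberBundle.extend FV u y)) x)
    (v : Fin (p + 1) → TangentSpace 𝓘(ℂ, EM) x) (u : V x) :
    extDNabla cov α x v u = extDNabla cov β x v u := by
  refine Finset.sum_congr rfl fun i _ => ?_
  have he : ∀ᶠ y in 𝓝 x, α y (fun j => FiberBundle.extend EM (v (i.succAbove j)) y)
      (FiberBundle.extend FV u y) = β y (fun j => FiberBundle.extend EM (v (i.succAbove j)) y)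
      (FiberBundle.extend FV u y) :=
    Filter.mem_of_superset (hU.mem_nhds hx) fun y hy => by
      change α y _ _ = β y _ _
      rw [h y hy]
  have hβ' := hβ (fun j => v (i.succAbove j)) u
  rw [h x hx, cov_congr (MDifferentiableAt.congr_of_eventuallyEq hβ'
    (he.mono fun y hy => congrArg (Bundle.TotalSpace.mk' FV y) hy)) hβ' he]

variable {q : ℕ} {ψ : ∀ x : M, (Fin q → TangentSpace 𝓘(ℂ, EM) x) → ℂ}

theorem wedge_curvature_extend
    (hψ : ∀ y w (τ : Equiv.Perm (Fin q)),
      ψ y (fun i => w (τ i)) = ((Equiv.Perm.sign τ : ℤ) : ℂ) * ψ y w)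
    (w : Fin (q + 2) → TangentSpace 𝓘(ℂ, EM) x) (y : M) (u : V y) :
    wedge (ψ y) (curvature cov y) (fun j => FiberBundle.extend EM (w j) y) u =
      (2⁻¹ : ℂ) • altSum (fun a => altSum fun b w => ψ y (fun j => FiberBundle.extend EM (w j) y) •
        curvature cov y ![FiberBundle.extend EM a y, FiberBundle.extend EM b y] u) w := by
  rw [wedge_two_eq _ (hψ y), altSum_altSum_comp _ fun a : TangentSpace 𝓘(ℂ, EM) x =>
    FiberBundle.extend EM a y]
  simp only [Pi.smul_apply, altSum_apply]

theorem wedge_curvature_sectionDiffAt (hcov : IsHolConnection cov) {U : Set M} (hU : IsOpen U)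
    (hx : x ∈ U)
    (hψ : ∀ y w (τ : Equiv.Perm (Fin q)),
      ψ y (fun i => w (τ i)) = ((Equiv.Perm.sign τ : ℤ) : ℂ) * ψ y w)
    (hψd : ∀ w : Fin q → TangentSpace 𝓘(ℂ, EM) x, MDifferentiableAt 𝓘(ℂ, EM) 𝓘(ℂ, ℂ)
      (fun y => ψ y fun j => FiberBundle.extend EM (w j) y) x)
    {s : ∀ y, V y} (hs : IsHolSection (EM := EM) FV U s)
    (w : Fin (q + 2) → TangentSpace 𝓘(ℂ, EM) x) :
    SectionDiffAt EM FV (fun y =>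
      wedge (ψ y) (curvature cov y) (fun j => FiberBundle.extend EM (w j) y) (s y)) x := by
  have hW : IsOpen (U ∩ (chartAt EM x).source) := hU.inter (chartAt EM x).open_source
  have hxW : x ∈ U ∩ (chartAt EM x).source := ⟨hx, mem_chart_source EM x⟩
  simp only [wedge_curvature_extend hψ]
  exact SectionDiffAt.const_smul _ (SectionDiffAt.altSum (fun a w => SectionDiffAt.altSum
    (fun b w => SectionDiffAt.smul (hψd w)
      ((curvature_extend_isHolSection hcov hU hs a b).mdifferentiableAt hW hxW)) w) w)

/-- After the Leibniz rule, the part with `∇F` is a triple alternating sum whose cyclic sums vanish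
by `bianchi`. In the other part the derivative of `ψ` is rotated to the innermost place, where its
alternating sum is `dψ = 0`. -/
theorem extDNabla_wedge_curvature (hcov : IsHolConnection cov)
    (hψ : ∀ y w (τ : Equiv.Perm (Fin q)),
      ψ y (fun i => w (τ i)) = ((Equiv.Perm.sign τ : ℤ) : ℂ) * ψ y w)
    (hψd : ∀ w : Fin q → TangentSpace 𝓘(ℂ, EM) x, MDifferentiableAt 𝓘(ℂ, EM) 𝓘(ℂ, ℂ)
      (fun y => ψ y fun j => FiberBundle.extend EM (w j) y) x)
    (hd : ∀ v, extD ψ x v = 0) (v : Fin (q + 3) → TangentSpace 𝓘(ℂ, EM) x) (u : V x) :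
    extDNabla cov (fun y => wedge (ψ y) (curvature cov y)) x v u = 0 := by
  set s : ∀ y, V y := FiberBundle.extend FV u with hs_def
  have hU := Bundle.Trivialization.open_baseSet (trivializationAt FV V x)
  have hx := mem_baseSet (FV := FV) (V := V) x
  have hs : IsHolSection (EM := EM) FV _ s := extend_isHolSection u
  have hsx : s x = u := FiberBundle.extend_apply_self ..
  have hW : IsOpen ((trivializationAt FV V x).baseSet ∩ (chartAt EM x).source) :=
    hU.inter (chartAt EM x).open_source
  have hxW : x ∈ (trivializationAt FV V x).baseSet ∩ (chartAt EM x).source :=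
    ⟨hx, mem_chart_source EM x⟩
  set K := fun a b c : TangentSpace 𝓘(ℂ, EM) x =>
      cov (fun y => curvature cov y ![FiberBundle.extend EM b y, FiberBundle.extend EM c y] (s y))
        x a - curvature cov x ![b, c] (cov s x a) with hK
  set dψ := fun (z : TangentSpace 𝓘(ℂ, EM) x) (w : Fin q → TangentSpace 𝓘(ℂ, EM) x) =>
    mvfderiv 𝓘(ℂ, EM) (fun y => ψ y fun j => FiberBundle.extend EM (w j) y) x z with hdψ
  have hF : ∀ a b, SectionDiffAt EM FV (fun y => curvature cov y
      ![FiberBundle.extend EM a y, FiberBundle.extend EM b y] (s y)) x := fun a b =>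
    (curvature_extend_isHolSection hcov hU hs a b).mdifferentiableAt hW hxW
  -- The covariant derivative of `ψ ∧ F` in direction `z`, split into the terms `ψ ∇F` and `dψ F`.
  -- Subtracting the value on `∇s` removes the derivative of the section.
  have h1 : ∀ z (w : Fin (q + 2) → TangentSpace 𝓘(ℂ, EM) x),
      cov (fun y => wedge (ψ y) (curvature cov y) (fun j => FiberBundle.extend EM (w j) y) (s y)) x
        z - wedge (ψ x) (curvature cov x) w (cov s x z) =
      (2⁻¹ : ℂ) • (altSum (fun a => altSum fun b w => ψ x w • K z a b) w +
        altSum (fun a => altSum fun b w => dψ z w • curvature cov x ![a, b] u) w) := by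
    intro z w
    have h2 := wedge_curvature_extend (cov := cov) hψ w x (cov s x z)
    simp only [FiberBundle.extend_apply_self] at h2
    simp only [wedge_curvature_extend hψ]
    rw [h2, cov_const_smul _ (SectionDiffAt.altSum (fun a w => SectionDiffAt.altSum
      (fun b w => SectionDiffAt.smul (hψd w) (hF a b)) w) w), smul_apply, cov_altSum (fun a w => SectionDiffAt.altSum
      (fun b w => SectionDiffAt.smul (hψd w) (hF a b)) w), ← smul_sub]
    congr 1
    rw [sub_eq_iff_eq_add, ← Pi.add_apply, ← altSum_add, ← Pi.add_apply, ← altSum_add]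
    congr 1
    funext a w
    rw [cov_altSum (fun b w => SectionDiffAt.smul (hψd w) (hF a b)), ← Pi.add_apply, ← altSum_add,
      ← Pi.add_apply, ← altSum_add]
    congr 1
    funext b w
    rw [cov_smul (hψd w) (hF a b)]
    simp only [FiberBundle.extend_apply_self, hsx, hK, hdψ, smul_sub]
    abel
  have h3 : extDNabla cov (fun y => wedge (ψ y) (curvature cov y)) x v u =
      altSum (fun z w => (2⁻¹ : ℂ) • (altSum (fun a => altSum fun b w => ψ x w • K z a b) w +
        altSum (fun a => altSum fun b w => dψ z w • curvature cov x ![a, b] u) w)) v :=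
    Finset.sum_congr rfl fun i _ => congrArg _ (h1 _ _)
  rw [h3, altSum_smul, altSum_add, Pi.smul_apply, Pi.add_apply,
    altSum_three_eq_zero (fun z a b w => ψ x w • K z a b) (fun a b c w => by
      rw [← smul_add, ← smul_add, bianchi hcov hU hx hs a b c, smul_zero]),
    altSum_three_rotate (fun z a b w => dψ z w • curvature cov x ![a, b] u), zero_add]
  have h4 : ∀ a b : TangentSpace 𝓘(ℂ, EM) x,
      altSum (fun z w => dψ z w • curvature cov x ![a, b] u) = fun _ => 0 := fun a b => by
    funext w
    rw [altSum_smul_const]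
    have : altSum dψ w = extD ψ x w := rfl
    rw [this, hd, zero_smul]
  simp only [h4]
  simp [altSum]

/-- The eigenvalue equation gives `∗F = ψ ∧ F` for the form `ψ = l⁻¹ ∗Ω`, which is closed at `x` and
differentiable there, so `extDNabla_wedge_curvature` applies. -/
theorem extDNabla_hodgeStar_curvature (hcov : IsHolConnection cov)
    {g : ∀ x : M, TangentSpace 𝓘(ℂ, EM) x →ₗ[ℂ] TangentSpace 𝓘(ℂ, EM) x →ₗ[ℂ] ℂ}
    (hg : IsComplexRiemannian g)
    {Ω : ∀ x : M, TangentSpace 𝓘(ℂ, EM) x [⋀^Fin 4]→ₗ[ℂ] ℂ}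
    (hΩ : IsHolForm Set.univ fun x v => Ω x v) {l : ℂ} (hl0 : l ≠ 0)
    (hl : ∀ x, contraction (Module.finBasis ℂ (TangentSpace 𝓘(ℂ, EM) x))
      (dualFrame (g x) (Module.finBasis ℂ (TangentSpace 𝓘(ℂ, EM) x))) (Ω x) (curvature cov x) =
        l • curvature cov x)
    {n : ℕ} (hn : Module.finrank ℂ EM = n) (h4 : 4 ≤ n) {U : Set M} (hU : IsOpen U)
    {vol : ∀ x : M, TangentSpace 𝓘(ℂ, EM) x [⋀^Fin n]→ₗ[ℂ] ℂ}
    (hvol : IsHolForm U fun x v => vol x v) (hx : x ∈ U)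
    (hd : ∀ v, extD (fun y => hodgeStar (g y) (vol y) 4 (n - 4) (Ω y)) x v = 0)
    (v : Fin (n - 2 + 1) → TangentSpace 𝓘(ℂ, EM) x) (u : V x) :
    extDNabla cov (fun y => hodgeStar (g y) (vol y) 2 (n - 2) (curvature cov y)) x v u = 0 := by
  obtain ⟨q, rfl⟩ : ∃ q, n = q + 4 := ⟨n - 4, by omega⟩
  set ψ : ∀ y : M, (Fin q → TangentSpace 𝓘(ℂ, EM) y) → ℂ := fun y =>
    l⁻¹ • hodgeStar (g y) (vol y) 4 q (Ω y) with hψ_def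
  have hhol := isHolForm_hodgeStar hg (add_comm 4 q) hvol
    (fun U' hU' _ => hΩ U' hU' (Set.subset_univ U'))
  have hW : IsOpen (U ∩ (chartAt EM x).source) := hU.inter (chartAt EM x).open_source
  have hxW : x ∈ U ∩ (chartAt EM x).source := ⟨hx, mem_chart_source EM x⟩
  have hψd0 : ∀ w : Fin q → TangentSpace 𝓘(ℂ, EM) x, MDifferentiableAt 𝓘(ℂ, EM) 𝓘(ℂ, ℂ)
      (fun y => hodgeStar (g y) (vol y) 4 q (Ω y) fun j => FiberBundle.extend EM (w j) y) x :=
    fun w => IsHolFun.mdifferentiableAt (hhol _ hW Set.inter_subset_left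
      (fun j => FiberBundle.extend EM (w j)) fun j =>
        (extend_isHolVectorField (w j)).mono Set.inter_subset_right) hW hxW
  have hψd : ∀ w : Fin q → TangentSpace 𝓘(ℂ, EM) x, MDifferentiableAt 𝓘(ℂ, EM) 𝓘(ℂ, ℂ)
      (fun y => ψ y fun j => FiberBundle.extend EM (w j) y) x :=
    fun w => (hψd0 w).const_smul l⁻¹
  have hψ : ∀ y w (τ : Equiv.Perm (Fin q)),
      ψ y (fun i => w (τ i)) = ((Equiv.Perm.sign τ : ℤ) : ℂ) * ψ y w := fun y w τ => by
    simp only [hψ_def, Pi.smul_apply, hodgeStar_four_perm, smul_eq_mul]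
    ring
  have hdψ : ∀ v, extD ψ x v = 0 := fun v => by
    have : extD ψ x v = l⁻¹ * extD (fun y => hodgeStar (g y) (vol y) 4 q (Ω y)) x v := by
      simp only [extD, Finset.mul_sum]
      refine Finset.sum_congr rfl fun i _ => ?_
      rw [mul_left_comm]
      congr 1
      exact congrArg (fun L : TangentSpace 𝓘(ℂ, EM) x →L[ℂ] ℂ => L (v i))
        (const_smul_mfderiv (hψd0 fun j => v (i.succAbove j)) l⁻¹)
    rw [this]
    exact (congrArg _ (hd v)).trans (mul_zero _)
  refine (extDNabla_congr (p := q + 2) (β := fun y => wedge (ψ y) (curvature cov y)) hU hx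
    (fun y _ => ?_) (fun w u => ?_) v u).trans (extDNabla_wedge_curvature hcov hψ hψd hdψ v u)
  · have := hodgeStar_two_eq_wedge hn (vol y) (Ω y) (curvatureForm_self hcov) hl0 (hl y)
    refine this.trans ?_
    exact (wedge_smul _ _ _).symm
  · exact wedge_curvature_sectionDiffAt hcov (Bundle.Trivialization.open_baseSet _) (mem_baseSet x)
      hψ hψd (extend_isHolSection u) w

end YangMills

/-! ### Partially flat connections -/

section PartiallyFlat

set_option linter.unusedSectionVars false

variable {EM : Type*} [NormedAddCommGroup EM] [NormedSpace ℂ EM] [FiniteDimensional ℂ EM]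
  {M : Type*} [TopologicalSpace M] [ChartedSpace EM M] [IsManifold 𝓘(ℂ, EM) ω M]
  {FE : Type*} [NormedAddCommGroup FE] [NormedSpace ℂ FE] [FiniteDimensional ℂ FE]
  {Es : M → Type*} [TopologicalSpace (Bundle.TotalSpace FE Es)]
  [∀ x, AddCommGroup (Es x)] [∀ x, Module ℂ (Es x)] [∀ x, TopologicalSpace (Es x)]
  [∀ x, IsTopologicalAddGroup (Es x)] [∀ x, ContinuousSMul ℂ (Es x)]
  [FiberBundle FE Es] [VectorBundle ℂ FE Es] [ContMDiffVectorBundle ω FE Es 𝓘(ℂ, EM)]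
  {FH : Type*} [NormedAddCommGroup FH] [NormedSpace ℂ FH] [FiniteDimensional ℂ FH]
  {Hs : M → Type*} [TopologicalSpace (Bundle.TotalSpace FH Hs)]
  [∀ x, AddCommGroup (Hs x)] [∀ x, Module ℂ (Hs x)] [∀ x, TopologicalSpace (Hs x)]
  [∀ x, IsTopologicalAddGroup (Hs x)] [∀ x, ContinuousSMul ℂ (Hs x)]
  [FiberBundle FH Hs] [VectorBundle ℂ FH Hs] [ContMDiffVectorBundle ω FH Hs 𝓘(ℂ, EM)]
  {FV : Type*} [NormedAddCommGroup FV] [NormedSpace ℂ FV] [FiniteDimensional ℂ FV]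
  {V : M → Type*} [TopologicalSpace (Bundle.TotalSpace FV V)]
  [∀ x, AddCommGroup (V x)] [∀ x, Module ℂ (V x)] [∀ x, TopologicalSpace (V x)]
  [∀ x, IsTopologicalAddGroup (V x)] [∀ x, ContinuousSMul ℂ (V x)]
  [FiberBundle FV V] [VectorBundle ℂ FV V] [ContMDiffVectorBundle ω FV V 𝓘(ℂ, EM)]
  {cov : CovariantDerivative 𝓘(ℂ, EM) FV V}
  {m : ℕ} (S : SpinGrassmann EM FE Es FH Hs m)
  {omegaE : ∀ x, Es x →ₗ[ℂ] Es x →ₗ[ℂ] ℂ}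

namespace SpinGrassmann

/-- If all components of the curvature but the last one vanish, then `F = ω_H^m ⊗ T` with `T`
symmetric. -/
theorem curvatureForm_of_isPartiallyFlat [CompleteSpace EM] (hm : Odd m)
    (hcov : IsHolConnection cov) (hflat : S.IsPartiallyFlat ((m - 1) / 2) cov) (x : M) :
    ∃ T : Es x →ₗ[ℂ] Es x →ₗ[ℂ] (V x → V x), (∀ e e', T e e' = T e' e) ∧
      ∀ e e' s s', curvatureForm cov x hcov (S.iso x (e ⊗ₜ[ℂ] s)) (S.iso x (e' ⊗ₜ[ℂ] s')) =
        powForm m (S.omegaH x) s s' • T e e' := by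
  obtain ⟨comp, hcomp, h0⟩ := hflat x
  -- The last component has no arguments from `H^*`, so it is determined by its value at the empty
  -- tuple, written `0` below.
  have hlast : IsEmpty (Fin (m - (Fin.last m : Fin (m + 1)))) := by
    rw [Fin.val_last, Nat.sub_self]
    infer_instance
  set C := comp (Fin.last m) with hC
  refine ⟨LinearMap.mk₂ ℂ (fun e e' => ⇑(C e e' 0)) ?_ ?_ ?_ ?_, fun e e' => ?_,
    fun e e' s s' => ?_⟩
  · intro e₁ e₂ e'; ext u; simp
  · intro c e e'; ext u; simp
  · intro e e₁ e₂; ext u; simp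
  · intro c e e'; ext u; simp
  · have := hcomp.symm_E (Fin.last m) e' e
    -- For odd `m` the exponent `m + 1` is even, so the last component is symmetric in `e` and `e'`.
    have hsgn : (-1 : ℂ) ^ ((Fin.last m : ℕ) + 1) = 1 := hm.add_one.neg_one_pow
    rw [hsgn, one_smul] at this
    simp only [LinearMap.mk₂_apply, hC, this]
  · set T : Es x →ₗ[ℂ] Es x →ₗ[ℂ] (V x → V x) :=
      LinearMap.mk₂ ℂ (fun e e' => ⇑(C e e' 0)) _ _ _ _ with hT
    have key : ∀ h h' : Fin m → Hs x, curvatureForm cov x hcov (S.iso x (e ⊗ₜ[ℂ] symProd h))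
        (S.iso x (e' ⊗ₜ[ℂ] symProd h')) =
        powForm m (S.omegaH x) (symProd h) (symProd h') • T e e' := by
      intro h h'
      funext u
      refine (hcomp.eq_sum e e' h h' u).trans ?_
      rw [powForm_symProd, Pi.smul_apply]
      simp only [Finset.sum_smul]
      refine Finset.sum_congr rfl fun σ _ => Finset.sum_congr rfl fun τ _ => ?_
      rw [Fin.sum_univ_castSucc, Finset.sum_eq_zero fun i _ => ?_, zero_add]
      · congr 1
        change C e e' _ u = C e e' _ u
        congr 2
        funext j
        rcases j with j | j <;> exact hlast.elim j
      -- As `m` is odd, `2 * ((m - 1) / 2) = m - 1`, so partial flatness covers every index below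
      -- `m`.
      · rw [h0 i.castSucc (by
          have := i.2
          obtain ⟨k, hk⟩ := hm
          simp only [Fin.val_castSucc]
          omega)]
        simp
    -- Products span the symmetric power, so the identity extends to arbitrary `s'` and then to
    -- arbitrary `s`.
    have h1 : ∀ h, (curvatureForm cov x hcov (S.iso x (e ⊗ₜ[ℂ] symProd h))) ∘ₗ
        (S.iso x).toLinearMap ∘ₗ TensorProduct.mk ℂ _ _ e' =
        (powForm m (S.omegaH x) (symProd h)).smulRight (T e e') := fun h =>
      sym_hom_ext fun h' => key h h'
    have h2 : (curvatureForm cov x hcov).flip (S.iso x (e' ⊗ₜ[ℂ] s')) ∘ₗ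
        (S.iso x).toLinearMap ∘ₗ TensorProduct.mk ℂ _ _ e =
        ((powForm m (S.omegaH x)).flip s').smulRight (T e e') :=
      sym_hom_ext fun h => LinearMap.congr_fun (h1 h) s'
    exact LinearMap.congr_fun h2 s

variable [Nontrivial FE]

theorem isSelfDual_of_isPartiallyFlat (homegaE : IsParallelSymplectic S.nablaE omegaE)
    (hm : Odd m) (hco : IsCoClosed (S.metric omegaE) (S.canonicalForm omegaE))
    (hcov : IsHolConnection cov) (hflat : S.IsPartiallyFlat ((m - 1) / 2) cov) :
    IsSelfDual (S.metric omegaE) (S.canonicalForm omegaE) (-4 * (m + 2)) cov where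
  appropriate := S.isAppropriate_canonicalForm homegaE hm
  ne_zero := by
    have := eigenvalue_ne_zero (m := m)
    exact_mod_cast this
  eigen U _ vol hvol x hx := by
    have := FiniteDimensional.complete ℂ EM
    obtain ⟨T, hT, hB⟩ := S.curvatureForm_of_isPartiallyFlat hm hcov hflat x
    push_cast
    rw [← twoForm_curvatureForm hcov]
    exact S.bOperator_canonicalForm homegaE hm hvol hx hT hB
  wedge_eq_zero U hU vol hvol x hx := by
    have h0 := funext (hco U hU vol hvol x hx)
    rw [h0]
    funext v
    simp [wedge]

theorem isYangMills_of_isPartiallyFlat (homegaE : IsParallelSymplectic S.nablaE omegaE)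
    (hm : Odd m) (hco : IsCoClosed (S.metric omegaE) (S.canonicalForm omegaE))
    (hcov : IsHolConnection cov) (hflat : S.IsPartiallyFlat ((m - 1) / 2) cov) :
    IsYangMills (S.metric omegaE) cov := by
  intro U hU vol hvol x hx v u
  have := FiniteDimensional.complete ℂ EM
  refine extDNabla_hodgeStar_curvature hcov (S.isComplexRiemannian_metric homegaE hm)
    (S.isHolForm_canonicalForm homegaE hm) (eigenvalue_ne_zero (m := m)) (fun y => ?_) rfl
    (S.four_le_finrank homegaE hm x) hU hvol.holomorphic hx (hco U hU vol hvol x hx) v u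
  obtain ⟨T, hT, hB⟩ := S.curvatureForm_of_isPartiallyFlat hm hcov hflat y
  rw [← twoForm_curvatureForm hcov]
  exact S.contraction_dualFrame homegaE hm hT hB

end SpinGrassmann

end PartiallyFlat

end GrassmannYM

end

/-! ### ### The theorem -/

theorem mainTheorem4
    {EM : Type*} [NormedAddCommGroup EM] [NormedSpace ℂ EM] [FiniteDimensional ℂ EM]
    {M : Type*} [TopologicalSpace M] [ChartedSpace EM M] [IsManifold 𝓘(ℂ, EM) ω M]
    {FE : Type*} [NormedAddCommGroup FE] [NormedSpace ℂ FE] [FiniteDimensional ℂ FE] [Nontrivial FE]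
    {Es : M → Type*} [TopologicalSpace (Bundle.TotalSpace FE Es)]
    [∀ x, AddCommGroup (Es x)] [∀ x, Module ℂ (Es x)] [∀ x, TopologicalSpace (Es x)]
    [∀ x, IsTopologicalAddGroup (Es x)] [∀ x, ContinuousSMul ℂ (Es x)]
    [FiberBundle FE Es] [VectorBundle ℂ FE Es] [ContMDiffVectorBundle ω FE Es 𝓘(ℂ, EM)]
    {FH : Type*} [NormedAddCommGroup FH] [NormedSpace ℂ FH] [FiniteDimensional ℂ FH]
    {Hs : M → Type*} [TopologicalSpace (Bundle.TotalSpace FH Hs)]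
    [∀ x, AddCommGroup (Hs x)] [∀ x, Module ℂ (Hs x)] [∀ x, TopologicalSpace (Hs x)]
    [∀ x, IsTopologicalAddGroup (Hs x)] [∀ x, ContinuousSMul ℂ (Hs x)]
    [FiberBundle FH Hs] [VectorBundle ℂ FH Hs] [ContMDiffVectorBundle ω FH Hs 𝓘(ℂ, EM)]
    (m : ℕ) (hm : Odd m)
    (S : GrassmannYM.SpinGrassmann EM FE Es FH Hs m) (hS : S.IsHalfFlat)
    (omegaE : ∀ x, Es x →ₗ[ℂ] Es x →ₗ[ℂ] ℂ)
    (homegaE : GrassmannYM.IsParallelSymplectic S.nablaE omegaE) :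
    -- the metric `g = ω_E ⊗ ω_H^m` and its invariance
    GrassmannYM.IsComplexRiemannian (S.metric omegaE) ∧
    (∀ x A B, S.IsSymplecticPair omegaE x A B → ∀ v w,
      S.metric omegaE x (S.action x A B v) (S.action x A B w) = S.metric omegaE x v w) ∧
    -- the 4-form `Ω`, its invariance and its nonvanishing
    GrassmannYM.IsHolForm Set.univ (fun x v => S.canonicalForm omegaE x v) ∧
    (∀ x A B, S.IsSymplecticPair omegaE x A B →
      (S.canonicalForm omegaE x).compLinearMap (S.action x A B) = S.canonicalForm omegaE x) ∧
    (∀ x, S.canonicalForm omegaE x ≠ 0) ∧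
    -- self-duality and the Yang–Mills equation
    (GrassmannYM.IsCoClosed (S.metric omegaE) (S.canonicalForm omegaE) →
      ∀ {FW : Type*} [NormedAddCommGroup FW] [NormedSpace ℂ FW] [FiniteDimensional ℂ FW]
        {W : M → Type*} [TopologicalSpace (Bundle.TotalSpace FW W)]
        [∀ x, AddCommGroup (W x)] [∀ x, Module ℂ (W x)] [∀ x, TopologicalSpace (W x)]
        [∀ x, IsTopologicalAddGroup (W x)] [∀ x, ContinuousSMul ℂ (W x)]
        [FiberBundle FW W] [VectorBundle ℂ FW W] [ContMDiffVectorBundle ω FW W 𝓘(ℂ, EM)]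
        (nabla : CovariantDerivative 𝓘(ℂ, EM) FW W),
        GrassmannYM.IsHolConnection nabla → S.IsPartiallyFlat ((m - 1) / 2) nabla →
          GrassmannYM.IsSelfDual (S.metric omegaE) (S.canonicalForm omegaE) (-4 * (m + 2)) nabla ∧
          GrassmannYM.IsYangMills (S.metric omegaE) nabla) := by
  refine ⟨S.isComplexRiemannian_metric homegaE hm, fun x A B h => S.metric_action h,
    S.isHolForm_canonicalForm homegaE hm, fun x A B h => S.canonicalForm_action h,
    S.canonicalForm_ne_zero homegaE hm, ?_⟩
  intro hco FW _ _ _ W _ _ _ _ _ _ _ _ _ nabla hnabla hflat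
  exact ⟨S.isSelfDual_of_isPartiallyFlat homegaE hm hco hnabla hflat,
    S.isYangMills_of_isPartiallyFlat homegaE hm hco hnabla hflat⟩
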